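/- Consider the linear system $x_{k+1}=Ax_k+w_k$, $y_k=Cx_k+v_k$ ($k\ge 0$) with $x_k\in\mathbb R^n$ and $y_k=(y_k^{(1)},\dots,y_k^{(m)})$, where $y_k^{(i)}\in\mathbb R^{s_i}$ is the measurement of sensor $i$ and $s=\sum_i s_i$. Assume the system is stable, i.e. the spectral radius of $A$ satisfies $\rho(A)<1$. The random vectors $x_0\sim\mathcal N(0,\Sigma_0)$, $w_k\sim\mathcal N(0,Q)$, $v_k\sim\mathcal N(0,R)$ ($k\ge 0$) are mutually independent, with $\Sigma_0,Q,R$ positive definite. Let $Y^{(i)}\in\mathbb R^{s_i\times s_i}$ be positive definite, $Y=\operatorname{diag}(Y^{(1)},\dots,Y^{(m)})$, and let $\zeta_k^{(i)}$ ($k\ge 0$, $1\le i\le m$) be i.i.d. uniform on $[0,1]$ and independent of $x_0,(w_k),(v_k)$. Sensor $i$ does not transmit at time $k$, $\gamma_k^{(i)}=0$, if $\zeta_k^{(i)}\le\exp\bigl(-\tfrac12 y_k^{(i)\prime}Y^{(i)}y_k^{(i)}\bigr)$, and transmits $y_k^{(i)}$, $\gamma_k^{(i)}=1$, otherwise. Let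 $\mathcal I_{k-1}$ be the information consisting of all decision variables $\gamma_j=(\gamma_j^{(1)},\dots,\gamma_j^{(m)})$ and all transmitted measurements at the times $0\le j\le k-1$ (trivial for $k=0$), and put $$\hat x_k^-=\mathbb E[x_k\mid\mathcal I_{k-1}],\qquad P_k^-=\mathbb E\bigl[(x_k-\hat x_k^-)(x_k-\hat x_k^-)^{\prime}\mid\mathcal I_{k-1}\bigr].$$ For a positive definite $W\in\mathbb R^{s\times s}$ let $$g_W(X)=AXA^{\prime}+Q-AXC^{\prime}(CXC^{\prime}+W)^{-1}CXA^{\prime}.$$ In the following, inequalities between symmetric matrices are in the positive semidefinite order. 1. There is a (deterministic) positive definite matrix $M$ such that, almost surely, $P_k^-\le M$ for all $k\ge 0$. 2. Each of the equations $X=g_R(X)$ and $X=g_{R+Y^{-1}}(X)$ has exactly one positive semidefinite solution, denoted $\underline X$ and $\overline X$ respectively; both are positive definite. For every $\epsilon>0$ there is a (deterministic) $N$ such that, almost surely, for all $k\ge N$, $$\underline X-\epsilon I\le P_k^-\le\overline X+\epsilon I.$$ 3. For every $\epsilon>0$, almost surely $P_k^-\ge\overline X-\epsilon I$ for infinitely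 many $k$, and almost surely $P_k^-\le\underline X+\epsilon I$ for infinitely many $k$. -/

import Mathlib

open MeasureTheory ProbabilityTheory Filter Matrix
open scoped MatrixOrder

namespace EventTrigger

/-- The index set of the stacked measurement vector of `m` sensors, where sensor `i` produces
`s i` real numbers: the pair `⟨i, j⟩` is the `j`-th coordinate of sensor `i`. -/
abbrev Coord {m : ℕ} (s : Fin m → ℕ) : Type := Σ i : Fin m, Fin (s i)

/-- The Riccati map
`g_W(X) = A X A' + Q - A X C' (C X C' + W)⁻¹ C X A'`. -/
noncomputable def riccati {ι κ : Type*} [Fintype ι] [Fintype κ] [DecidableEq κ]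
    (A Q : Matrix ι ι ℝ) (C : Matrix κ ι ℝ) (W : Matrix κ κ ℝ) (X : Matrix ι ι ℝ) :
    Matrix ι ι ℝ :=
  A * X * Aᵀ + Q - A * X * Cᵀ * (C * X * Cᵀ + W)⁻¹ * C * X * Aᵀ

section Model

variable {Ω : Type*} {n m : ℕ} {s : Fin m → ℕ}

/-- The state process `x_{k+1} = A x_k + w_k`, started at `x₀`. -/
noncomputable def state (A : Matrix (Fin n) (Fin n) ℝ) (x₀ : Ω → EuclideanSpace ℝ (Fin n))
    (w : ℕ → Ω → EuclideanSpace ℝ (Fin n)) : ℕ → Ω → EuclideanSpace ℝ (Fin n)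
  | 0 => x₀
  | k + 1 => fun ω => WithLp.toLp 2 (A *ᵥ (state A x₀ w k ω).ofLp) + w k ω

/-- The stacked measurement `y_k = C x_k + v_k` of all sensors. -/
noncomputable def meas (A : Matrix (Fin n) (Fin n) ℝ) (C : Matrix (Coord s) (Fin n) ℝ)
    (x₀ : Ω → EuclideanSpace ℝ (Fin n)) (w : ℕ → Ω → EuclideanSpace ℝ (Fin n))
    (v : ℕ → Ω → EuclideanSpace ℝ (Coord s)) (k : ℕ) (ω : Ω) : EuclideanSpace ℝ (Coord s) :=
  WithLp.toLp 2 (C *ᵥ (state A x₀ w k ω).ofLp) + v k ω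

/-- The trigger function `φ(α) = exp (-(1/2) α' Y α)`. -/
noncomputable def trigger {r : ℕ} (Y : Matrix (Fin r) (Fin r) ℝ) (α : Fin r → ℝ) : ℝ :=
  Real.exp (-(1 / 2) * (α ⬝ᵥ (Y *ᵥ α)))

/-- The decision variable of sensor `i` at time `k`: it is `0` (no transmission) if
`ζ_k^{(i)} ≤ φ^{(i)}(y_k^{(i)})`, and `1` (transmission) otherwise. -/
noncomputable def decision (A : Matrix (Fin n) (Fin n) ℝ) (C : Matrix (Coord s) (Fin n) ℝ)
    (Y : (i : Fin m) → Matrix (Fin (s i)) (Fin (s i)) ℝ)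
    (x₀ : Ω → EuclideanSpace ℝ (Fin n)) (w : ℕ → Ω → EuclideanSpace ℝ (Fin n))
    (v : ℕ → Ω → EuclideanSpace ℝ (Coord s)) (ζ : ℕ → Fin m → Ω → ℝ)
    (k : ℕ) (i : Fin m) (ω : Ω) : ℝ :=
  if ζ k i ω ≤ trigger (Y i) (fun j => meas A C x₀ w v k ω ⟨i, j⟩) then 0 else 1

/-- The measurements received at time `k`: the blocks of the transmitting sensors, with the
blocks of the silent sensors replaced by zero. Together with the decision variables
it carries the same information as the list of the transmitted measurements. -/
noncomputable def received (A : Matrix (Fin n) (Fin n) ℝ) (C : Matrix (Coord s) (Fin n) ℝ)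
    (Y : (i : Fin m) → Matrix (Fin (s i)) (Fin (s i)) ℝ)
    (x₀ : Ω → EuclideanSpace ℝ (Fin n)) (w : ℕ → Ω → EuclideanSpace ℝ (Fin n))
    (v : ℕ → Ω → EuclideanSpace ℝ (Coord s)) (ζ : ℕ → Fin m → Ω → ℝ)
    (k : ℕ) (ω : Ω) (p : Coord s) : ℝ :=
  decision A C Y x₀ w v ζ k p.1 ω * meas A C x₀ w v k ω p

/-- The σ-algebra of the information that the estimator holds before time `k`: it is generated by
the decision variables and the received measurements at the times `0, …, k - 1` (and is trivial
for `k = 0`). -/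
@[reducible] noncomputable def infoBefore (A : Matrix (Fin n) (Fin n) ℝ) (C : Matrix (Coord s) (Fin n) ℝ)
    (Y : (i : Fin m) → Matrix (Fin (s i)) (Fin (s i)) ℝ)
    (x₀ : Ω → EuclideanSpace ℝ (Fin n)) (w : ℕ → Ω → EuclideanSpace ℝ (Fin n))
    (v : ℕ → Ω → EuclideanSpace ℝ (Coord s)) (ζ : ℕ → Fin m → Ω → ℝ) (k : ℕ) :
    MeasurableSpace Ω :=
  ⨆ j ∈ Finset.range k,
    (MeasurableSpace.comap (fun ω i => decision A C Y x₀ w v ζ j i ω) MeasurableSpace.pi ⊔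
      MeasurableSpace.comap (fun ω p => received A C Y x₀ w v ζ j ω p) MeasurableSpace.pi)

variable [mΩ : MeasurableSpace Ω]

/-- The a priori estimate: the conditional expectation of `x_k` given the information before
time `k`. -/
noncomputable def prioriEstimate (μ : Measure Ω) (A : Matrix (Fin n) (Fin n) ℝ)
    (C : Matrix (Coord s) (Fin n) ℝ) (Y : (i : Fin m) → Matrix (Fin (s i)) (Fin (s i)) ℝ)
    (x₀ : Ω → EuclideanSpace ℝ (Fin n)) (w : ℕ → Ω → EuclideanSpace ℝ (Fin n))
    (v : ℕ → Ω → EuclideanSpace ℝ (Coord s)) (ζ : ℕ → Fin m → Ω → ℝ) (k : ℕ) :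
    Ω → EuclideanSpace ℝ (Fin n) :=
  μ[state A x₀ w k | infoBefore A C Y x₀ w v ζ k]

/-- The a priori error covariance `P_k⁻`: the matrix of the conditional expectations of the
entries of `(x_k - x̂_k⁻) (x_k - x̂_k⁻)'` given the information before time `k`. -/
noncomputable def prioriCov (μ : Measure Ω) (A : Matrix (Fin n) (Fin n) ℝ)
    (C : Matrix (Coord s) (Fin n) ℝ) (Y : (i : Fin m) → Matrix (Fin (s i)) (Fin (s i)) ℝ)
    (x₀ : Ω → EuclideanSpace ℝ (Fin n)) (w : ℕ → Ω → EuclideanSpace ℝ (Fin n))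
    (v : ℕ → Ω → EuclideanSpace ℝ (Coord s)) (ζ : ℕ → Fin m → Ω → ℝ) (k : ℕ) (ω : Ω) :
    Matrix (Fin n) (Fin n) ℝ :=
  Matrix.of fun a b =>
    (μ[fun ω' =>
        (state A x₀ w k ω' a - prioriEstimate μ A C Y x₀ w v ζ k ω' a) *
          (state A x₀ w k ω' b - prioriEstimate μ A C Y x₀ w v ζ k ω' b)
      | infoBefore A C Y x₀ w v ζ k]) ω

end Model

/-- Labels of the elementary random sources of the model: the initial state, the process noise
and the measurement noise at each time, and the uniform variable of each sensor at each time. -/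
inductive Source (m : ℕ) : Type
  | init : Source m
  | process (k : ℕ) : Source m
  | measurement (k : ℕ) : Source m
  | uniform (k : ℕ) (i : Fin m) : Source m

/-- The σ-algebra generated by one elementary random source. -/
@[reducible] def sourceSigma {Ω : Type*} {n m : ℕ} {s : Fin m → ℕ} (x₀ : Ω → EuclideanSpace ℝ (Fin n))
    (w : ℕ → Ω → EuclideanSpace ℝ (Fin n)) (v : ℕ → Ω → EuclideanSpace ℝ (Coord s))
    (ζ : ℕ → Fin m → Ω → ℝ) : Source m → MeasurableSpace Ω
  | .init => MeasurableSpace.comap x₀ inferInstance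
  | .process k => MeasurableSpace.comap (w k) inferInstance
  | .measurement k => MeasurableSpace.comap (v k) inferInstance
  | .uniform k i => MeasurableSpace.comap (ζ k i) inferInstance

/-- The standing probabilistic assumptions: the initial state, the noises and the uniform variables
are mutually independent, `x₀ ∼ N(0, Σ₀)`, `w_k ∼ N(0, Q)`, `v_k ∼ N(0, R)`, and every
`ζ_k^{(i)}` is uniform on `[0, 1]`. -/
structure IsNoiseModel {Ω : Type*} [MeasurableSpace Ω] (μ : Measure Ω) {n m : ℕ} {s : Fin m → ℕ}
    (Q Sigma₀ : Matrix (Fin n) (Fin n) ℝ) (R : Matrix (Coord s) (Coord s) ℝ)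
    (x₀ : Ω → EuclideanSpace ℝ (Fin n)) (w : ℕ → Ω → EuclideanSpace ℝ (Fin n))
    (v : ℕ → Ω → EuclideanSpace ℝ (Coord s)) (ζ : ℕ → Fin m → Ω → ℝ) : Prop where
  measurable_init : Measurable x₀
  measurable_process : ∀ k, Measurable (w k)
  measurable_measurement : ∀ k, Measurable (v k)
  measurable_uniform : ∀ k i, Measurable (ζ k i)
  law_init : HasLaw x₀ (multivariateGaussian 0 Sigma₀) μ
  law_process : ∀ k, HasLaw (w k) (multivariateGaussian 0 Q) μ
  law_measurement : ∀ k, HasLaw (v k) (multivariateGaussian 0 R) μ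
  law_uniform : ∀ k i, HasLaw (ζ k i) (volume.restrict (Set.Icc (0 : ℝ) 1)) μ
  indep : iIndep (sourceSigma x₀ w v ζ) μ

end EventTrigger

set_option linter.unusedSectionVars false

/-! Factor each `Y i` as `(B i)ᵀ * B i` and put `F = (blockDiagonal' B)⁻¹`, so that `F * Fᵀ` is the
inverse of the block diagonal matrix of the `Y i`. The probability exp(-½ y'Yy) of silence is, up to
a constant, the standard Gaussian density at -By, that is, the density at 0 of By + ξ given y, with
ξ standard Gaussian. Hence silence carries the same information as the linear observation y + Fξ =
0. Given the transmission pattern, the filter is therefore an ordinary Kalman filter with noise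
covariance R + F D F', where D projects onto the silent coordinates, and P_k⁻ is almost surely the
deterministic function `errCov` of the pattern (`prioriCov_ae_eq`).

The event y + Fξ = 0 is null, so conditioning on it needs an argument. On the product of Ω with a
space of auxiliary Gaussian noises up to a finite horizon, `kalman_filter` shows that the prediction
error is Gaussian and independent of the virtual observations y + F D ξ. `integral_density_eq_zero`
then passes, by continuity, from integrals against test functions to the single value 0; this gives
`integral_innovation_eq_zero`. `integral_innovation_mul_pattern` brings back the uniform variables:
the factors 1 - φ of the transmitting sensors depend on received data only and are harmless. Summing
over the finitely many patterns identifies both conditional expectations.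

The rest concerns the Riccati map. It is the minimum over gains K of the maps `joseph`, which are
monotone in X and W and affine in X. So it is monotone in X and W, and R ≤ R + F D F' ≤ R + F F'
traps `errCov` between two Riccati iterations. Stability provides M with A M A' + Q ≤ M, which
bounds all of them. The affine form also yields a subhomogeneity estimate with a gain from Q, by
which any two orbits below M approach each other geometrically (`riccati_iterate_le_smul`);
existence, uniqueness and attraction of the fixed points follow (`exists_riccati_limit`).

For the recurrence claims it suffices that arbitrarily long windows of common silence, and of common
transmission, occur infinitely often (`ae_frequently_pattern_eq`). Second moments of the state are
bounded, so by Fatou the state returns infinitely often to a bounded set. From there a noise event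
of fixed positive probability forces the pattern, and Lévy's Borel–Cantelli lemma makes it happen
infinitely often. -/

namespace EventTrigger

/-! ### The positive semidefinite order and the Riccati map -/

section Riccati

variable {ι κ : Type*} [Fintype ι] [Fintype κ]

lemma _root_.Matrix.PosSemidef.mul_mul_transpose {X : Matrix ι ι ℝ} (hX : X.PosSemidef)
    (B : Matrix κ ι ℝ) : (B * X * Bᵀ).PosSemidef := by
  simpa [conjTranspose_eq_transpose_of_trivial] using hX.mul_mul_conjTranspose_same B

lemma mul_mul_transpose_mono {X Y : Matrix ι ι ℝ} (h : X ≤ Y) (B : Matrix κ ι ℝ) :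
    B * X * Bᵀ ≤ B * Y * Bᵀ := by
  rw [Matrix.le_iff] at h ⊢
  have := h.mul_mul_transpose B
  rwa [Matrix.mul_sub, Matrix.sub_mul] at this

lemma _root_.Matrix.PosSemidef.transpose_eq {X : Matrix ι ι ℝ} (hX : X.PosSemidef) : Xᵀ = X := by
  simpa [conjTranspose_eq_transpose_of_trivial] using hX.isHermitian.eq

lemma _root_.Matrix.PosDef.of_le {X Y : Matrix ι ι ℝ} (hX : X.PosDef) (h : X ≤ Y) : Y.PosDef := by
  have := hX.add_posSemidef (Matrix.le_iff.1 h)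
  simpa using this

lemma dotProduct_mulVec_mono {X Y : Matrix ι ι ℝ} (h : X ≤ Y) (t : ι → ℝ) :
    t ⬝ᵥ (X *ᵥ t) ≤ t ⬝ᵥ (Y *ᵥ t) := by
  have := (Matrix.le_iff.1 h).dotProduct_mulVec_nonneg t
  simp only [star_trivial, Matrix.sub_mulVec, dotProduct_sub] at this
  linarith

lemma le_of_dotProduct_mulVec_le {X Y : Matrix ι ι ℝ} (hX : Xᵀ = X) (hY : Yᵀ = Y)
    (h : ∀ t : ι → ℝ, t ⬝ᵥ (X *ᵥ t) ≤ t ⬝ᵥ (Y *ᵥ t)) : X ≤ Y := by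
  rw [Matrix.le_iff]
  refine PosSemidef.of_dotProduct_mulVec_nonneg ?_ fun t => ?_
  · simp [IsHermitian, conjTranspose_eq_transpose_of_trivial, hX, hY]
  · simp only [star_trivial, Matrix.sub_mulVec, dotProduct_sub]
    linarith [h t]

section Order

variable [DecidableEq ι]

lemma exists_pos_smul_one_le {Q : Matrix ι ι ℝ} (hQ : Q.PosDef) :
    ∃ r : ℝ, 0 < r ∧ r • (1 : Matrix ι ι ℝ) ≤ Q := by
  cases isEmpty_or_nonempty ι
  · exact ⟨1, one_pos, (Subsingleton.elim _ _).le⟩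
  have h := (CFC.exists_pos_algebraMap_le_iff (a := Q) (by exact hQ.isHermitian)).2
    (fun x hx => by
      rw [hQ.isHermitian.spectrum_real_eq_range_eigenvalues] at hx
      obtain ⟨i, rfl⟩ := hx
      exact hQ.eigenvalues_pos i)
  simpa [Algebra.algebraMap_eq_smul_one] using h

lemma exists_le_smul_one {M : Matrix ι ι ℝ} (hM : Mᵀ = M) :
    ∃ r : ℝ, 0 < r ∧ M ≤ r • (1 : Matrix ι ι ℝ) := by
  obtain ⟨r, hr⟩ := (Matrix.finite_real_spectrum (A := M)).bddAbove
  refine ⟨max r 1, by positivity, ?_⟩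
  rw [← Algebra.algebraMap_eq_smul_one]
  refine le_algebraMap_of_spectrum_le (fun x hx => (hr hx).trans (le_max_left _ _)) ?_
  simpa [IsSelfAdjoint, star_eq_conjTranspose, conjTranspose_eq_transpose_of_trivial] using hM

lemma smul_one_nonneg {r : ℝ} (hr : 0 ≤ r) : (0 : Matrix ι ι ℝ) ≤ r • 1 := by
  rw [Matrix.nonneg_iff_posSemidef]
  exact PosSemidef.one.smul hr

lemma smul_one_mono {r s : ℝ} (h : r ≤ s) :
    r • (1 : Matrix ι ι ℝ) ≤ s • (1 : Matrix ι ι ℝ) := by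
  have := smul_one_nonneg (ι := ι) (sub_nonneg.2 h)
  rwa [sub_smul, sub_nonneg] at this

end Order

lemma smul_mono_matrix {r : ℝ} (hr : 0 ≤ r) {X Y : Matrix ι ι ℝ} (h : X ≤ Y) :
    r • X ≤ r • Y := by
  rw [Matrix.le_iff, ← smul_sub]
  exact (Matrix.le_iff.1 h).smul hr

lemma smul_mono_left_matrix {r s : ℝ} (h : r ≤ s) {X : Matrix ι ι ℝ} (hX : X.PosSemidef) :
    r • X ≤ s • X := by
  rw [Matrix.le_iff, ← sub_smul]
  exact hX.smul (sub_nonneg.2 h)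

variable [DecidableEq κ]

/-- The covariance of the a posteriori error propagated through the dynamics with an arbitrary
gain `K`. -/
noncomputable def joseph (A Q : Matrix ι ι ℝ) (C : Matrix κ ι ℝ) (W : Matrix κ κ ℝ)
    (K : Matrix ι κ ℝ) (X : Matrix ι ι ℝ) : Matrix ι ι ℝ :=
  (A - K * C) * X * (A - K * C)ᵀ + Q + K * W * Kᵀ

/-- The Kalman gain `A X C' (C X C' + W)⁻¹`. -/
noncomputable def kalmanGain (A : Matrix ι ι ℝ) (C : Matrix κ ι ℝ) (W : Matrix κ κ ℝ)
    (X : Matrix ι ι ℝ) : Matrix ι κ ℝ :=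
  A * X * Cᵀ * (C * X * Cᵀ + W)⁻¹

lemma innovation_posDef {X : Matrix ι ι ℝ} (hX : X.PosSemidef) {W : Matrix κ κ ℝ}
    (hW : W.PosDef) (C : Matrix κ ι ℝ) : (C * X * Cᵀ + W).PosDef :=
  hW.posSemidef_add (hX.mul_mul_transpose C)

variable (A Q : Matrix ι ι ℝ) (C : Matrix κ ι ℝ)

lemma kalmanGain_mul {X : Matrix ι ι ℝ} (hX : X.PosSemidef) {W : Matrix κ κ ℝ}
    (hW : W.PosDef) : kalmanGain A C W X * (C * X * Cᵀ + W) = A * X * Cᵀ := by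
  have h := (innovation_posDef hX hW C).isUnit
  rw [Matrix.isUnit_iff_isUnit_det] at h
  rw [kalmanGain, Matrix.mul_assoc, Matrix.nonsing_inv_mul _ h, Matrix.mul_one]

/-- Completing the square in the gain: the remainder is positive semidefinite and vanishes at the
Kalman gain, so the Riccati map is the minimum of `joseph` over all gains. Every order property of
the Riccati map below comes from this. -/
lemma joseph_eq {X : Matrix ι ι ℝ} (hX : X.PosSemidef) {W : Matrix κ κ ℝ} (hW : W.PosDef)
    (K : Matrix ι κ ℝ) :
    joseph A Q C W K X = riccati A Q C W X +
      (K - kalmanGain A C W X) * (C * X * Cᵀ + W) * (K - kalmanGain A C W X)ᵀ := by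
  set V := C * X * Cᵀ + W with hV
  set G := kalmanGain A C W X with hG
  have hGV : G * V = A * X * Cᵀ := kalmanGain_mul A C hX hW
  have hVt : Vᵀ = V := (innovation_posDef hX hW C).posSemidef.transpose_eq
  have hVG : V * Gᵀ = C * X * Aᵀ := by
    have := congrArg Matrix.transpose hGV
    simpa [Matrix.transpose_mul, hVt, hX.transpose_eq, Matrix.mul_assoc] using this
  have hric : riccati A Q C W X = A * X * Aᵀ + Q - G * V * Gᵀ := by
    rw [riccati, Matrix.mul_assoc G V, hVG, hG, kalmanGain]
    simp only [Matrix.mul_assoc]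
  have h1 : (K - G) * V * (K - G)ᵀ
      = K * V * Kᵀ - A * X * Cᵀ * Kᵀ - K * (C * X * Aᵀ) + G * V * Gᵀ := by
    rw [← hGV, ← hVG, transpose_sub]
    simp only [Matrix.mul_sub, Matrix.sub_mul, Matrix.mul_assoc]
    abel
  rw [h1, hric, joseph, hV]
  simp only [transpose_sub, transpose_mul, Matrix.mul_sub, Matrix.sub_mul, Matrix.mul_add,
    Matrix.add_mul, Matrix.mul_assoc]
  abel

lemma riccati_eq_joseph {X : Matrix ι ι ℝ} (hX : X.PosSemidef) {W : Matrix κ κ ℝ}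
    (hW : W.PosDef) : riccati A Q C W X = joseph A Q C W (kalmanGain A C W X) X := by
  simp [joseph_eq A Q C hX hW]

lemma riccati_le_joseph {X : Matrix ι ι ℝ} (hX : X.PosSemidef) {W : Matrix κ κ ℝ}
    (hW : W.PosDef) (K : Matrix ι κ ℝ) : riccati A Q C W X ≤ joseph A Q C W K X := by
  rw [joseph_eq A Q C hX hW, Matrix.le_iff, add_sub_cancel_left]
  exact (innovation_posDef hX hW C).posSemidef.mul_mul_transpose _

lemma le_riccati {X : Matrix ι ι ℝ} (hX : X.PosSemidef) {W : Matrix κ κ ℝ}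
    (hW : W.PosDef) : Q ≤ riccati A Q C W X := by
  rw [riccati_eq_joseph A Q C hX hW, joseph, Matrix.le_iff]
  have := (hX.mul_mul_transpose (A - kalmanGain A C W X * C)).add
    (hW.posSemidef.mul_mul_transpose (kalmanGain A C W X))
  convert! this using 1
  abel

lemma riccati_le {X : Matrix ι ι ℝ} (hX : X.PosSemidef) {W : Matrix κ κ ℝ}
    (hW : W.PosDef) : riccati A Q C W X ≤ A * X * Aᵀ + Q := by
  simpa [joseph] using riccati_le_joseph A Q C hX hW 0

variable {Q} in
lemma riccati_posDef (hQ : Q.PosDef) {X : Matrix ι ι ℝ} (hX : X.PosSemidef) {W : Matrix κ κ ℝ}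
    (hW : W.PosDef) : (riccati A Q C W X).PosDef :=
  hQ.of_le (le_riccati A Q C hX hW)

/-- For a fixed gain, `joseph` is monotone in the covariance and in the noise. Use the gain that is
optimal for the larger pair as a competitor for the smaller one. -/
lemma riccati_mono {X X' : Matrix ι ι ℝ} (hX : X.PosSemidef) (hXX' : X ≤ X')
    {W W' : Matrix κ κ ℝ} (hW : W.PosDef) (hWW' : W ≤ W') :
    riccati A Q C W X ≤ riccati A Q C W' X' := by
  have hX' : X'.PosSemidef := by
    rw [← Matrix.nonneg_iff_posSemidef] at hX ⊢
    exact hX.trans hXX'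
  refine (riccati_le_joseph A Q C hX hW (kalmanGain A C W' X')).trans ?_
  rw [riccati_eq_joseph A Q C hX' (hW.of_le hWW'), joseph, joseph]
  gcongr
  · exact mul_mul_transpose_mono hXX' _
  · exact mul_mul_transpose_mono hWW' _

/-- Use the optimal gain of `Y` for `X`. The part of `joseph` linear in the covariance scales by
`a`, the term `K W K'` only grows when multiplied by `a ≥ 1`, and `Q` is not scaled at all. That
unscaled `Q` is the source of the contraction. -/
lemma riccati_le_of_le_smul {X Y : Matrix ι ι ℝ} (hX : X.PosSemidef) (hY : Y.PosSemidef) {a : ℝ}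
    (ha : 1 ≤ a) (h : X ≤ a • Y) {W : Matrix κ κ ℝ} (hW : W.PosDef) :
    riccati A Q C W X ≤ a • (riccati A Q C W Y - Q) + Q := by
  refine (riccati_le_joseph A Q C hX hW (kalmanGain A C W Y)).trans ?_
  rw [riccati_eq_joseph A Q C hY hW, joseph, joseph]
  set K := kalmanGain A C W Y
  have h1 : a • ((A - K * C) * Y * (A - K * C)ᵀ + Q + K * W * Kᵀ - Q) + Q
      = (A - K * C) * (a • Y) * (A - K * C)ᵀ + Q + a • (K * W * Kᵀ) := by
    rw [Matrix.mul_smul, Matrix.smul_mul]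
    simp only [smul_sub, smul_add]
    abel
  rw [h1]
  gcongr
  · exact mul_mul_transpose_mono h _
  · have := smul_mono_left_matrix ha (hW.posSemidef.mul_mul_transpose K)
    simpa using this

end Riccati

/-! ### Stability and invariant covariance bounds -/

open scoped ENNReal Topology in
-- Gelfand's formula: the k-th roots of the norms are eventually below some r < 1, so the norms are
-- dominated by r ^ k.
lemma tendsto_pow_of_spectralRadius_lt_one {𝔸 : Type*} [NormedRing 𝔸] [NormedAlgebra ℂ 𝔸]
    [CompleteSpace 𝔸] {a : 𝔸} (ha : spectralRadius ℂ a < 1) :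
    Tendsto (fun k : ℕ => a ^ k) atTop (𝓝 0) := by
  obtain ⟨r, har, hr⟩ := exists_between ha
  have h := (spectrum.pow_nnnorm_pow_one_div_tendsto_nhds_spectralRadius a).eventually
    (gt_mem_nhds har)
  have hlim : Tendsto (fun k : ℕ => ((‖a ^ k‖₊ : NNReal) : ℝ≥0∞)) atTop (𝓝 0) := by
    refine tendsto_of_tendsto_of_tendsto_of_le_of_le' tendsto_const_nhds
      (ENNReal.tendsto_pow_atTop_nhds_zero_of_lt_one hr) (Eventually.of_forall fun _ => zero_le) ?_
    filter_upwards [h, eventually_gt_atTop 0] with k hk hk0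
    have hk0' : (k : ℝ) ≠ 0 := by positivity
    calc ((‖a ^ k‖₊ : NNReal) : ℝ≥0∞)
        = (((‖a ^ k‖₊ : NNReal) : ℝ≥0∞) ^ (1 / k : ℝ)) ^ (k : ℝ) := by
          rw [← ENNReal.rpow_mul, one_div, inv_mul_cancel₀ hk0', ENNReal.rpow_one]
      _ ≤ r ^ (k : ℝ) := ENNReal.rpow_le_rpow hk.le (by positivity)
      _ = r ^ k := ENNReal.rpow_natCast r k
  rw [tendsto_zero_iff_norm_tendsto_zero]
  have h2 := (ENNReal.tendsto_toReal ENNReal.zero_ne_top).comp hlim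
  simpa [Function.comp_def] using h2

section Stability

variable {ι : Type*} [Fintype ι] [DecidableEq ι]

open scoped Topology in
lemma tendsto_pow_apply {A : Matrix ι ι ℝ} (hA : spectralRadius ℂ (A.map Complex.ofReal) < 1)
    (i j : ι) : Tendsto (fun k : ℕ => (A ^ k) i j) atTop (𝓝 0) := by
  let _ : NormedRing (Matrix ι ι ℂ) := Matrix.linftyOpNormedRing
  let _ : NormedAlgebra ℂ (Matrix ι ι ℂ) := Matrix.linftyOpNormedAlgebra
  have h := tendsto_pow_of_spectralRadius_lt_one hA
  have hij : Tendsto (fun k : ℕ => ((A.map Complex.ofReal) ^ k) i j) atTop (𝓝 0) :=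
    ((continuous_id.matrix_elem i j).tendsto 0).comp h
  have hmap : ∀ k : ℕ, ((A.map Complex.ofReal) ^ k) i j = (((A ^ k) i j : ℝ) : ℂ) := by
    intro k
    have := congrFun (congrFun (map_pow (Complex.ofRealHom.mapMatrix (m := ι)) A k) i) j
    exact this.symm
  simp only [hmap] at hij
  have := (Complex.continuous_re.tendsto 0).comp hij
  simpa [Function.comp_def] using this

/-- Cauchy–Schwarz in each column; the scalar is the squared Frobenius norm. -/
lemma mul_transpose_le_smul_one (B : Matrix ι ι ℝ) :
    B * Bᵀ ≤ (∑ i, ∑ j, B i j ^ 2) • (1 : Matrix ι ι ℝ) := by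
  refine le_of_dotProduct_mulVec_le (by simp) (by simp) fun t => ?_
  have h1 : t ⬝ᵥ ((B * Bᵀ) *ᵥ t) = ∑ j, (∑ i, B i j * t i) ^ 2 := by
    rw [← Matrix.mulVec_mulVec, Matrix.dotProduct_mulVec, Matrix.vecMul_eq_sum]
    simp only [dotProduct, Matrix.mulVec, Matrix.transpose_apply, Finset.sum_apply, Pi.smul_apply,
      smul_eq_mul, sq]
    exact Finset.sum_congr rfl fun j _ => by
      congr 1
      exact Finset.sum_congr rfl fun i _ => mul_comm _ _
  have h2 : t ⬝ᵥ (((∑ i, ∑ j, B i j ^ 2) • (1 : Matrix ι ι ℝ)) *ᵥ t)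
      = ∑ j, (∑ i, B i j ^ 2) * ∑ i, t i ^ 2 := by
    rw [Matrix.smul_mulVec, Matrix.one_mulVec, dotProduct_smul, Finset.sum_comm, ← Finset.sum_mul]
    simp [dotProduct, sq]
  rw [h1, h2]
  exact Finset.sum_le_sum fun j _ => Finset.sum_mul_sq_le_sq_mul_sq _ _ _

lemma exists_pow_mul_transpose_le {A : Matrix ι ι ℝ}
    (hA : spectralRadius ℂ (A.map Complex.ofReal) < 1) :
    ∃ N : ℕ, 0 < N ∧ A ^ N * (A ^ N)ᵀ ≤ (1 / 2 : ℝ) • (1 : Matrix ι ι ℝ) := by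
  have h : Tendsto (fun k : ℕ => ∑ i, ∑ j, ((A ^ k) i j) ^ 2) atTop (nhds 0) := by
    have := tendsto_finsetSum (Finset.univ : Finset ι) fun i _ =>
      tendsto_finsetSum (Finset.univ : Finset ι) fun j _ => (tendsto_pow_apply hA i j).pow 2
    simpa using this
  obtain ⟨N, hN, hN0⟩ := ((h.eventually (gt_mem_nhds (by norm_num : (0 : ℝ) < 1 / 2))).and
    (eventually_gt_atTop 0)).exists
  exact ⟨N, hN0, (mul_transpose_le_smul_one _).trans (smul_one_mono hN.le)⟩

/-- A truncated Lyapunov series suffices. With T the sum of A^j (A^j)' over j < N, A T A' + 1 = T +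
A^N (A^N)', and the last term is at most 1/2. Doubling T turns this defect into the required
inequality, since 2 · 1/2 - 1 ≤ 0. -/
lemma exists_lyapunov {A : Matrix ι ι ℝ} (hA : spectralRadius ℂ (A.map Complex.ofReal) < 1) :
    ∃ S : Matrix ι ι ℝ, 1 ≤ S ∧ A * S * Aᵀ + 1 ≤ S := by
  obtain ⟨N, hN0, hN⟩ := exists_pow_mul_transpose_le hA
  set T : Matrix ι ι ℝ := ∑ j ∈ Finset.range N, A ^ j * (A ^ j)ᵀ with hT
  have hpsd : ∀ j, 0 ≤ A ^ j * (A ^ j)ᵀ := fun j => by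
    rw [Matrix.nonneg_iff_posSemidef]
    simpa using (PosSemidef.one (n := ι) (R := ℝ)).mul_mul_transpose (A ^ j)
  have h1 : 1 ≤ T := by
    have := Finset.single_le_sum (f := fun j => A ^ j * (A ^ j)ᵀ) (fun j _ => hpsd j)
      (Finset.mem_range.2 hN0)
    rwa [pow_zero, transpose_one, Matrix.mul_one] at this
  have h2 : A * T * Aᵀ + 1 = T + A ^ N * (A ^ N)ᵀ := by
    have h3 : A * T * Aᵀ = ∑ j ∈ Finset.range N, A ^ (j + 1) * (A ^ (j + 1))ᵀ := by
      rw [hT, Matrix.mul_sum, Matrix.sum_mul]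
      refine Finset.sum_congr rfl fun j _ => ?_
      rw [pow_succ', Matrix.transpose_mul]
      simp only [Matrix.mul_assoc]
    have h4 := Finset.sum_range_succ (fun j => A ^ j * (A ^ j)ᵀ) N
    have h5 := Finset.sum_range_succ' (fun j => A ^ j * (A ^ j)ᵀ) N
    rw [h3, hT, ← h4, h5]
    simp
  refine ⟨(2 : ℝ) • T, ?_, ?_⟩
  · calc (1 : Matrix ι ι ℝ) ≤ T := h1
      _ ≤ T + T := le_add_of_nonneg_right ((PosSemidef.one.nonneg).trans h1)
      _ = (2 : ℝ) • T := (two_smul ℝ T).symm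
  · have h6 : A * ((2 : ℝ) • T) * Aᵀ + 1
        = (2 : ℝ) • T + ((2 : ℝ) • (A ^ N * (A ^ N)ᵀ) - 1) := by
      rw [Matrix.mul_smul, Matrix.smul_mul, eq_sub_of_add_eq h2, two_smul, two_smul, two_smul]
      abel
    rw [h6]
    have h7 := smul_mono_matrix (zero_le_two (α := ℝ)) hN
    rw [smul_smul, mul_one_div_cancel two_ne_zero, one_smul] at h7
    rw [add_le_iff_nonpos_right]
    exact sub_nonpos.2 h7

/-- Such an `M` is an upper barrier for every Riccati map with these `A` and `Q`, whatever the
measurement noise. The matrix `B` lets `M` dominate prescribed initial values. -/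
lemma exists_invariant {A : Matrix ι ι ℝ} (hA : spectralRadius ℂ (A.map Complex.ofReal) < 1)
    {Q B : Matrix ι ι ℝ} (hQ : Qᵀ = Q) (hB : Bᵀ = B) :
    ∃ M : Matrix ι ι ℝ, M.PosDef ∧ B ≤ M ∧ A * M * Aᵀ + Q ≤ M := by
  obtain ⟨S, hS1, hS⟩ := exists_lyapunov hA
  obtain ⟨q, hq, hq'⟩ := exists_le_smul_one hQ
  obtain ⟨b, hb, hb'⟩ := exists_le_smul_one hB
  have hS0 : S.PosDef := PosDef.one.of_le hS1
  set r := max q b with hr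
  have hr0 : 0 < r := lt_max_of_lt_left hq
  refine ⟨r • S, hS0.smul hr0, ?_, ?_⟩
  · calc B ≤ b • 1 := hb'
      _ ≤ r • 1 := smul_one_mono (le_max_right _ _)
      _ ≤ r • S := smul_mono_matrix hr0.le hS1
  · calc A * (r • S) * Aᵀ + Q ≤ A * (r • S) * Aᵀ + r • 1 := by
          gcongr
          exact hq'.trans (smul_one_mono (le_max_left _ _))
      _ = r • (A * S * Aᵀ + 1) := by rw [Matrix.mul_smul, Matrix.smul_mul, smul_add]
      _ ≤ r • S := smul_mono_matrix hr0.le hS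

end Stability

/-! ### Convergence of the Riccati iteration -/

section Convergence

variable {ι κ : Type*} [Fintype ι] [Fintype κ] [DecidableEq ι] [DecidableEq κ]

lemma _root_.Matrix.PosSemidef.of_le {X Y : Matrix ι ι ℝ} (hX : X.PosSemidef) (h : X ≤ Y) :
    Y.PosSemidef :=
  Matrix.nonneg_iff_posSemidef.1 (hX.nonneg.trans h)

lemma le_of_tendsto_smul {X Y : Matrix ι ι ℝ} (hX : X.PosSemidef) (hY : Y.PosSemidef)
    {a : ℕ → ℝ} (ha : Tendsto a atTop (nhds 1)) (h : ∀ k, X ≤ a k • Y) : X ≤ Y := by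
  refine le_of_dotProduct_mulVec_le hX.transpose_eq hY.transpose_eq fun t => ?_
  have h1 : Tendsto (fun k => a k * (t ⬝ᵥ (Y *ᵥ t))) atTop (nhds (t ⬝ᵥ (Y *ᵥ t))) := by
    simpa using ha.mul_const (t ⬝ᵥ (Y *ᵥ t))
  refine ge_of_tendsto h1 (Eventually.of_forall fun k => ?_)
  have := dotProduct_mulVec_mono (h k) t
  simpa [Matrix.smul_mulVec, dotProduct_smul] using this

lemma le_of_forall_le_add_smul_one {X Y : Matrix ι ι ℝ} (hX : X.PosSemidef) (hY : Y.PosSemidef)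
    (h : ∀ ε : ℝ, 0 < ε → X ≤ Y + ε • 1) : X ≤ Y := by
  refine le_of_dotProduct_mulVec_le hX.transpose_eq hY.transpose_eq fun t => ?_
  refine le_of_forall_pos_le_add fun e he => ?_
  have ht : 0 ≤ t ⬝ᵥ t := by simpa using dotProduct_star_self_nonneg t
  have := dotProduct_mulVec_mono (h (e / (t ⬝ᵥ t + 1)) (by positivity)) t
  simp only [Matrix.add_mulVec, Matrix.smul_mulVec, Matrix.one_mulVec, dotProduct_add,
    dotProduct_smul, smul_eq_mul] at this
  refine this.trans (add_le_add_right ?_ _)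
  rw [div_mul_eq_mul_div, div_le_iff₀ (by positivity)]
  nlinarith

/-- Each quadratic form is monotone and bounded, hence convergent. Polarization transfers
convergence to the entries, and the entrywise limit is the least upper bound. -/
lemma exists_isLUB_of_monotone {Y : ℕ → Matrix ι ι ℝ} (hmono : Monotone Y)
    (hY : ∀ k, (Y k).PosSemidef) {M : Matrix ι ι ℝ} (hM : ∀ k, Y k ≤ M) :
    ∃ L : Matrix ι ι ℝ, L.PosSemidef ∧ (∀ k, Y k ≤ L) ∧
      ∀ U : Matrix ι ι ℝ, (∀ k, Y k ≤ U) → L ≤ U := by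
  have hlim : ∀ t : ι → ℝ, ∃ l, Tendsto (fun k => t ⬝ᵥ (Y k *ᵥ t)) atTop (nhds l) := fun t =>
    ⟨_, tendsto_atTop_ciSup (fun i j hij => dotProduct_mulVec_mono (hmono hij) t)
      ⟨t ⬝ᵥ (M *ᵥ t), by rintro _ ⟨k, rfl⟩; exact dotProduct_mulVec_mono (hM k) t⟩⟩
  have hsymm : ∀ k i j, Y k i j = Y k j i := fun k i j =>
    congrFun (congrFun (hY k).transpose_eq j) i
  have hpol : ∀ k i j, Y k i j = ((Pi.single i 1 + Pi.single j 1) ⬝ᵥ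
      (Y k *ᵥ (Pi.single i 1 + Pi.single j 1)) - Pi.single i 1 ⬝ᵥ (Y k *ᵥ Pi.single i 1)
      - Pi.single j 1 ⬝ᵥ (Y k *ᵥ Pi.single j 1)) / 2 := by
    intro k i j
    simp only [Matrix.mulVec_add, dotProduct_add, add_dotProduct, Matrix.mulVec_single_one,
      single_one_dotProduct, Matrix.col_apply, hsymm k j i]
    ring
  have hent : ∀ i j, ∃ l, Tendsto (fun k => Y k i j) atTop (nhds l) := by
    intro i j
    obtain ⟨a, ha⟩ := hlim (Pi.single i 1 + Pi.single j 1)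
    obtain ⟨b, hb⟩ := hlim (Pi.single i 1)
    obtain ⟨c, hc⟩ := hlim (Pi.single j 1)
    refine ⟨(a - b - c) / 2, ?_⟩
    have := ((ha.sub hb).sub hc).div_const 2
    simpa only [← hpol] using this
  choose L hL using hent
  have hLt : ∀ t : ι → ℝ, Tendsto (fun k => t ⬝ᵥ (Y k *ᵥ t)) atTop
      (nhds (t ⬝ᵥ (Matrix.of L *ᵥ t))) := by
    intro t
    simp only [dotProduct, Matrix.mulVec, Matrix.of_apply]
    exact tendsto_finsetSum _ fun i _ => (tendsto_finsetSum _ fun j _ =>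
      (hL i j).mul_const _).const_mul _
  have hLs : (Matrix.of L)ᵀ = Matrix.of L := by
    ext i j
    simp only [Matrix.transpose_apply, Matrix.of_apply]
    refine tendsto_nhds_unique (hL j i) ?_
    simpa only [hsymm] using hL i j
  have hub : ∀ k, Y k ≤ Matrix.of L := fun k =>
    le_of_dotProduct_mulVec_le (hY k).transpose_eq hLs fun t =>
      Monotone.ge_of_tendsto (fun i j hij => dotProduct_mulVec_mono (hmono hij) t) (hLt t) k
  refine ⟨Matrix.of L, (hY 0).of_le (hub 0), hub, fun U hU => ?_⟩
  refine le_of_dotProduct_mulVec_le hLs ((hY 0).of_le (hU 0)).transpose_eq fun t => ?_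
  exact le_of_tendsto (hLt t) (Eventually.of_forall fun k => dotProduct_mulVec_mono (hU k) t)

variable {A Q : Matrix ι ι ℝ} {C : Matrix κ ι ℝ} {W : Matrix κ κ ℝ}

lemma riccati_iterate_posSemidef (hQ : Q.PosDef) (hW : W.PosDef) {X : Matrix ι ι ℝ}
    (hX : X.PosSemidef) (k : ℕ) : ((riccati A Q C W)^[k] X).PosSemidef := by
  induction k with
  | zero => exact hX
  | succ k ih =>
    rw [Function.iterate_succ_apply']
    exact (riccati_posDef A C hQ ih hW).posSemidef

lemma riccati_le_invariant (hW : W.PosDef) {X M : Matrix ι ι ℝ} (hX : X.PosSemidef) (hXM : X ≤ M)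
    (hM : A * M * Aᵀ + Q ≤ M) : riccati A Q C W X ≤ M :=
  ((riccati_le A Q C hX hW).trans (by gcongr; exact mul_mul_transpose_mono hXM A)).trans hM

lemma riccati_iterate_le_invariant (hQ : Q.PosDef) (hW : W.PosDef) {X M : Matrix ι ι ℝ}
    (hX : X.PosSemidef) (hXM : X ≤ M) (hM : A * M * Aᵀ + Q ≤ M) (k : ℕ) :
    (riccati A Q C W)^[k] X ≤ M := by
  induction k with
  | zero => exact hXM
  | succ k ih =>
    rw [Function.iterate_succ_apply']
    exact riccati_le_invariant hW (riccati_iterate_posSemidef hQ hW hX k) ih hM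

lemma riccati_iterate_mono (hQ : Q.PosDef) (hW : W.PosDef) {X Y : Matrix ι ι ℝ}
    (hX : X.PosSemidef) (h : X ≤ Y) (k : ℕ) :
    (riccati A Q C W)^[k] X ≤ (riccati A Q C W)^[k] Y := by
  induction k with
  | zero => exact h
  | succ k ih =>
    rw [Function.iterate_succ_apply', Function.iterate_succ_apply']
    exact riccati_mono A Q C (riccati_iterate_posSemidef hQ hW hX k) ih hW le_rfl

/-- Two orbits below the barrier `M` are compared multiplicatively. After one step, one value is at
most M ≤ δ⁻¹ Q and the other at least Q, which gives the initial factor δ⁻¹ = 1 + (δ⁻¹ - 1). Each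
further step shrinks the excess over 1 by the factor 1 - δ. -/
lemma riccati_iterate_le_smul (hQ : Q.PosDef) (hW : W.PosDef) {X Y M : Matrix ι ι ℝ}
    (hX : X.PosSemidef) (hY : Y.PosSemidef) (hXM : X ≤ M) (hYM : Y ≤ M)
    (hM : A * M * Aᵀ + Q ≤ M) {δ : ℝ} (hδ0 : 0 < δ) (hδ1 : δ ≤ 1) (hδ : δ • M ≤ Q) (k : ℕ) :
    (riccati A Q C W)^[k + 1] X
      ≤ (1 + (δ⁻¹ - 1) * (1 - δ) ^ k) • (riccati A Q C W)^[k + 1] Y := by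
  induction k with
  | zero =>
    simp only [zero_add, Function.iterate_one, pow_zero, mul_one, add_sub_cancel]
    refine (riccati_le_invariant hW hX hXM hM).trans ?_
    calc M = δ⁻¹ • δ • M := by rw [smul_smul, inv_mul_cancel₀ hδ0.ne', one_smul]
      _ ≤ δ⁻¹ • Q := smul_mono_matrix (by positivity) hδ
      _ ≤ _ := smul_mono_matrix (by positivity) (le_riccati A Q C hY hW)
  | succ k ih =>
    have hc : 0 ≤ δ⁻¹ - 1 := sub_nonneg.2 ((one_le_inv₀ hδ0).2 hδ1)
    set b := (δ⁻¹ - 1) * (1 - δ) ^ k with hb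
    have hb0 : 0 ≤ b := mul_nonneg hc (pow_nonneg (by linarith) _)
    have hYk := riccati_iterate_posSemidef (A := A) (C := C) hQ hW hY (k + 1)
    have h1 := riccati_le_of_le_smul A Q C
      (riccati_iterate_posSemidef (A := A) (C := C) hQ hW hX (k + 1)) hYk (by linarith) ih hW
    rw [Function.iterate_succ_apply' _ (k + 1) X, Function.iterate_succ_apply' _ (k + 1) Y]
    refine h1.trans ?_
    set V := riccati A Q C W ((riccati A Q C W)^[k + 1] Y) with hV
    have hVM : V ≤ M := riccati_le_invariant hW hYk
      (riccati_iterate_le_invariant hQ hW hY hYM hM (k + 1)) hM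
    -- Subhomogeneity gives the bound (1 + b) V - b Q; since Q ≥ δ M ≥ δ V, the excess `b` drops to
    -- b (1 - δ).
    have h2 : b • δ • V ≤ b • Q :=
      smul_mono_matrix hb0 ((smul_mono_matrix hδ0.le hVM).trans hδ)
    have h3 : (1 + (δ⁻¹ - 1) * (1 - δ) ^ (k + 1)) • V = (1 + b) • V - b • δ • V := by
      rw [smul_smul, ← sub_smul, hb]
      congr 1
      ring
    have h4 : (1 + b) • (V - Q) + Q = (1 + b) • V - b • Q := by
      rw [smul_sub, add_smul 1 b Q, one_smul]
      abel
    rw [h3, h4]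
    exact sub_le_sub_left h2 _

lemma exists_smul_le {Q : Matrix ι ι ℝ} (hQ : Q.PosDef) {M : Matrix ι ι ℝ} (hM : Mᵀ = M) :
    ∃ δ : ℝ, 0 < δ ∧ δ ≤ 1 ∧ δ • M ≤ Q := by
  obtain ⟨q, hq, hq'⟩ := exists_pos_smul_one_le hQ
  obtain ⟨r, hr, hr'⟩ := exists_le_smul_one hM
  refine ⟨min 1 (q / r), lt_min one_pos (by positivity), min_le_left _ _, ?_⟩
  calc min 1 (q / r) • M ≤ min 1 (q / r) • (r • 1) :=
        smul_mono_matrix (le_min zero_le_one (by positivity)) hr'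
    _ = (min 1 (q / r) * r) • (1 : Matrix ι ι ℝ) := by rw [smul_smul]
    _ ≤ q • 1 := smul_one_mono (by
        calc _ ≤ q / r * r := by gcongr; exact min_le_right _ _
          _ = q := by field_simp)
    _ ≤ Q := hq'

lemma tendsto_contraction_factor {δ : ℝ} (hδ0 : 0 < δ) (hδ1 : δ ≤ 1) :
    Tendsto (fun k : ℕ => (δ⁻¹ - 1) * (1 - δ) ^ k) atTop (nhds 0) := by
  simpa using (tendsto_pow_atTop_nhds_zero_of_lt_one (sub_nonneg.2 hδ1)
    (by linarith)).const_mul (δ⁻¹ - 1)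

/-- For a stable system, the Riccati iteration converges to a positive definite fixed point, from
every positive semidefinite initial value. -/
theorem exists_riccati_limit (hA : spectralRadius ℂ (A.map Complex.ofReal) < 1)
    (hQ : Q.PosDef) (hW : W.PosDef) :
    ∃ L : Matrix ι ι ℝ, L.PosDef ∧ L = riccati A Q C W L ∧
      ∀ X : Matrix ι ι ℝ, X.PosSemidef → ∀ ε : ℝ, 0 < ε → ∃ N, ∀ k ≥ N,
        L - ε • 1 ≤ (riccati A Q C W)^[k] X ∧ (riccati A Q C W)^[k] X ≤ L + ε • 1 := by
  have hQt := hQ.posSemidef.transpose_eq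
  -- The fixed point is the least upper bound of the increasing orbit of 0. Continuity of the
  -- Riccati map is not used: `L ≤ riccati L` follows from monotonicity, the converse from the
  -- multiplicative comparison.
  obtain ⟨L, hL, hfix⟩ : ∃ L : Matrix ι ι ℝ, L.PosSemidef ∧ L = riccati A Q C W L := by
    obtain ⟨M, hMp, hM0, hM⟩ := exists_invariant hA hQt (B := 0) (by simp)
    obtain ⟨δ, hδ0, hδ1, hδ⟩ := exists_smul_le hQ hMp.posSemidef.transpose_eq
    have h0 : (0 : Matrix ι ι ℝ).PosSemidef := PosSemidef.zero
    set Y : ℕ → Matrix ι ι ℝ := fun k => (riccati A Q C W)^[k] 0 with hY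
    have hYp : ∀ k, (Y k).PosSemidef := riccati_iterate_posSemidef hQ hW h0
    have hYM : ∀ k, Y k ≤ M := riccati_iterate_le_invariant hQ hW h0 hM0 hM
    have hYg : ∀ k, riccati A Q C W (Y k) = Y (k + 1) := fun k =>
      (Function.iterate_succ_apply' _ _ _).symm
    have hmono : Monotone Y := monotone_nat_of_le_succ fun k => by
      change _ ≤ (riccati A Q C W)^[k + 1] 0
      rw [Function.iterate_succ_apply]
      exact riccati_iterate_mono hQ hW h0 (riccati_posDef A C hQ h0 hW).posSemidef.nonneg k
    obtain ⟨L, hL, hub, hlub⟩ := exists_isLUB_of_monotone hmono hYp hYM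
    have hb0 : ∀ k : ℕ, 0 ≤ (δ⁻¹ - 1) * (1 - δ) ^ k := fun k =>
      mul_nonneg (sub_nonneg.2 ((one_le_inv₀ hδ0).2 hδ1)) (pow_nonneg (by linarith) _)
    refine ⟨L, hL, le_antisymm ?_ ?_⟩
    · refine hlub _ fun k => (hmono (Nat.le_succ k)).trans ?_
      rw [← hYg]
      exact riccati_mono A Q C (hYp k) (hub k) hW le_rfl
    · refine le_of_tendsto_smul (riccati_posDef A C hQ hL hW).posSemidef hL
        (a := fun k => 1 + (δ⁻¹ - 1) * (1 - δ) ^ k)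
        (by simpa using (tendsto_contraction_factor hδ0 hδ1).const_add 1) fun k => ?_
      -- The orbit of 0 is compared with itself started `j` steps later, uniformly in `j`; this
      -- bounds all its values, hence `L`, by a multiple close to 1 of one iterate.
      have h1 : L ≤ (1 + (δ⁻¹ - 1) * (1 - δ) ^ k) • Y (k + 1) := hlub _ fun j => by
        refine le_trans ?_ (riccati_iterate_le_smul (C := C) hQ hW (hYp j) h0 (hYM j) hM0 hM
          hδ0 hδ1 hδ k)
        have : (riccati A Q C W)^[k + 1] (Y j) = Y (k + 1 + j) :=
          (Function.iterate_add_apply _ _ _ _).symm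
        rw [this]
        exact hmono (by omega)
      have h2 := riccati_le_of_le_smul A Q C hL (hYp (k + 1)) (by linarith [hb0 k]) h1 hW
      rw [hYg] at h2
      have h3 : (1 + (δ⁻¹ - 1) * (1 - δ) ^ k) • (Y (k + 1 + 1) - Q) + Q
          ≤ (1 + (δ⁻¹ - 1) * (1 - δ) ^ k) • Y (k + 1 + 1) := by
        rw [smul_sub, sub_add, sub_le_self_iff, sub_nonneg]
        simpa using smul_mono_left_matrix (le_add_of_nonneg_right (hb0 k) :
          (1 : ℝ) ≤ 1 + (δ⁻¹ - 1) * (1 - δ) ^ k) hQ.posSemidef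
      exact (h2.trans h3).trans (smul_mono_matrix (by linarith [hb0 k]) (hub _))
  have hLd : L.PosDef := hfix ▸ riccati_posDef A C hQ hL hW
  refine ⟨L, hLd, hfix, fun X hX ε hε => ?_⟩
  -- One barrier above both `X` and `L`, so that their orbits can be compared in both directions.
  obtain ⟨M, hMp, hM0, hM⟩ := exists_invariant hA hQt (B := X + L)
    (by rw [transpose_add, hX.transpose_eq, hL.transpose_eq])
  have hXM : X ≤ M := (le_add_of_nonneg_right hL.nonneg).trans hM0
  have hLM : L ≤ M := (le_add_of_nonneg_left hX.nonneg).trans hM0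
  obtain ⟨δ, hδ0, hδ1, hδ⟩ := exists_smul_le hQ hMp.posSemidef.transpose_eq
  obtain ⟨r, hr, hMr⟩ := exists_le_smul_one hMp.posSemidef.transpose_eq
  have hb0 : ∀ k : ℕ, 0 ≤ (δ⁻¹ - 1) * (1 - δ) ^ k := fun k =>
    mul_nonneg (sub_nonneg.2 ((one_le_inv₀ hδ0).2 hδ1)) (pow_nonneg (by linarith) _)
  obtain ⟨N, hN⟩ := eventually_atTop.1 ((tendsto_contraction_factor hδ0 hδ1).eventually
    (gt_mem_nhds (div_pos hε hr)))
  refine ⟨N + 1, fun k hk => ?_⟩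
  obtain ⟨j, rfl⟩ : ∃ j, k = j + 1 := ⟨k - 1, by omega⟩
  have hLfix : (riccati A Q C W)^[j + 1] L = L := Function.iterate_fixed hfix.symm _
  have hXkM := riccati_iterate_le_invariant (C := C) hQ hW hX hXM hM (j + 1)
  have hsmall : ((δ⁻¹ - 1) * (1 - δ) ^ j) • M ≤ ε • (1 : Matrix ι ι ℝ) := by
    refine (smul_mono_matrix (hb0 j) hMr).trans ?_
    rw [smul_smul]
    exact smul_one_mono ((le_div_iff₀ hr).1 (hN j (by omega)).le)
  constructor
  · have h1 := riccati_iterate_le_smul (C := C) hQ hW hL hX hLM hXM hM hδ0 hδ1 hδ j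
    rw [hLfix, add_smul, one_smul] at h1
    rw [sub_le_iff_le_add]
    exact h1.trans (add_le_add_right ((smul_mono_matrix (hb0 j) hXkM).trans hsmall) _)
  · have h1 := riccati_iterate_le_smul (C := C) hQ hW hX hL hXM hLM hM hδ0 hδ1 hδ j
    rw [hLfix, add_smul, one_smul] at h1
    exact h1.trans (add_le_add_right ((smul_mono_matrix (hb0 j) hLM).trans hsmall) _)

/-- The orbit of a fixed point is constant, so attraction to `L` forces equality. -/
lemma eq_riccati_limit {L : Matrix ι ι ℝ} (hL : L.PosSemidef)
    (hlim : ∀ X : Matrix ι ι ℝ, X.PosSemidef → ∀ ε : ℝ, 0 < ε → ∃ N, ∀ k ≥ N,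
        L - ε • 1 ≤ (riccati A Q C W)^[k] X ∧ (riccati A Q C W)^[k] X ≤ L + ε • 1)
    {X : Matrix ι ι ℝ} (hX : X.PosSemidef) (hfix : X = riccati A Q C W X) : X = L := by
  have hfix' : ∀ k, (riccati A Q C W)^[k] X = X := fun k => Function.iterate_fixed hfix.symm k
  refine le_antisymm (le_of_forall_le_add_smul_one hX hL fun ε hε => ?_)
    (le_of_forall_le_add_smul_one hL hX fun ε hε => ?_)
  · obtain ⟨N, hN⟩ := hlim X hX ε hε
    simpa only [hfix'] using (hN N le_rfl).2
  · obtain ⟨N, hN⟩ := hlim X hX ε hε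
    simpa only [hfix', sub_le_iff_le_add] using (hN N le_rfl).1

end Convergence

/-! ### Error covariances driven by a transmission pattern -/

section Pattern

variable {n m : ℕ} {s : Fin m → ℕ}

/-- The diagonal projection onto the coordinates of the silent sensors of a transmission pattern,
where `d i = true` means that sensor `i` transmits. -/
noncomputable def silentMask (s : Fin m → ℕ) (d : Fin m → Bool) : Matrix (Coord s) (Coord s) ℝ :=
  Matrix.diagonal fun p => if d p.1 then 0 else 1

lemma silentMask_transpose (d : Fin m → Bool) : (silentMask s d)ᵀ = silentMask s d :=
  Matrix.diagonal_transpose _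

lemma silentMask_mul_self (d : Fin m → Bool) :
    silentMask s d * silentMask s d = silentMask s d := by
  rw [silentMask, Matrix.diagonal_mul_diagonal]
  congr 1
  ext p
  split_ifs <;> simp

lemma silentMask_nonneg (d : Fin m → Bool) : 0 ≤ silentMask s d := by
  rw [Matrix.nonneg_iff_posSemidef]
  refine PosSemidef.diagonal fun p => ?_
  simp only [Pi.zero_apply]
  split_ifs <;> simp

lemma silentMask_le_one (d : Fin m → Bool) : silentMask s d ≤ 1 := by
  rw [Matrix.le_iff, ← Matrix.diagonal_one, silentMask, Matrix.diagonal_sub]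
  refine PosSemidef.diagonal fun p => ?_
  simp only [Pi.zero_apply]
  split_ifs <;> simp

/-- The hypothesis runs over coordinates, not over sensors. A sensor with `s i = 0` has trigger
value 1 and so is almost surely silent; it can never be forced to transmit, but it does not enter
the mask either. -/
lemma silentMask_eq_one {d : Fin m → Bool} (h : ∀ p : Coord s, d p.1 = false) :
    silentMask s d = 1 := by
  rw [silentMask, ← Matrix.diagonal_one]
  congr 1
  ext p
  simp [h p]

lemma silentMask_eq_zero {d : Fin m → Bool} (h : ∀ p : Coord s, d p.1 = true) :
    silentMask s d = 0 := by
  rw [silentMask, ← Matrix.diagonal_zero]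
  congr 1
  ext p
  simp [h p]

/-- The effective measurement noise covariance: silent sensors are equivalent to measurements
with the additional noise `F D F'`. -/
noncomputable def effNoise (R F : Matrix (Coord s) (Coord s) ℝ) (d : Fin m → Bool) :
    Matrix (Coord s) (Coord s) ℝ :=
  R + F * silentMask s d * Fᵀ

/-- The error covariance determined by a sequence of transmission patterns. -/
noncomputable def errCov (A Q Sigma₀ : Matrix (Fin n) (Fin n) ℝ) (C : Matrix (Coord s) (Fin n) ℝ)
    (R F : Matrix (Coord s) (Coord s) ℝ) (d : ℕ → Fin m → Bool) : ℕ → Matrix (Fin n) (Fin n) ℝ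
  | 0 => Sigma₀
  | k + 1 => riccati A Q C (effNoise R F (d k)) (errCov A Q Sigma₀ C R F d k)

variable {A Q Sigma₀ : Matrix (Fin n) (Fin n) ℝ} {C : Matrix (Coord s) (Fin n) ℝ}
  {R F : Matrix (Coord s) (Coord s) ℝ}

lemma le_effNoise (d : Fin m → Bool) : R ≤ effNoise R F d := by
  rw [effNoise]
  refine le_add_of_nonneg_right ?_
  simpa using mul_mul_transpose_mono (silentMask_nonneg (s := s) d) F

lemma effNoise_le (d : Fin m → Bool) : effNoise R F d ≤ R + F * Fᵀ := by
  rw [effNoise]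
  gcongr
  simpa using mul_mul_transpose_mono (silentMask_le_one (s := s) d) F

lemma effNoise_posDef (hR : R.PosDef) (d : Fin m → Bool) : (effNoise R F d).PosDef :=
  hR.of_le (le_effNoise d)

lemma effNoise_of_silent {d : Fin m → Bool} (h : ∀ p : Coord s, d p.1 = false) :
    effNoise R F d = R + F * Fᵀ := by
  rw [effNoise, silentMask_eq_one h, Matrix.mul_one]

lemma effNoise_of_transmit {d : Fin m → Bool} (h : ∀ p : Coord s, d p.1 = true) :
    effNoise R F d = R := by
  rw [effNoise, silentMask_eq_zero h, Matrix.mul_zero, Matrix.zero_mul, add_zero]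

lemma errCov_congr {d d' : ℕ → Fin m → Bool} {k : ℕ} (h : ∀ j < k, d j = d' j) :
    errCov A Q Sigma₀ C R F d k = errCov A Q Sigma₀ C R F d' k := by
  induction k with
  | zero => rfl
  | succ k ih =>
    rw [errCov, errCov, ih fun j hj => h j (hj.trans (Nat.lt_succ_self k)),
      h k (Nat.lt_succ_self k)]

lemma errCov_posSemidef (hQ : Q.PosDef) (hR : R.PosDef) (hS : Sigma₀.PosDef)
    (d : ℕ → Fin m → Bool) (k : ℕ) : (errCov A Q Sigma₀ C R F d k).PosSemidef := by
  induction k with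
  | zero => exact hS.posSemidef
  | succ k ih => exact (riccati_posDef A C hQ ih (effNoise_posDef hR _)).posSemidef

lemma le_errCov (hQ : Q.PosDef) (hR : R.PosDef) (hS : Sigma₀.PosDef)
    (d : ℕ → Fin m → Bool) (k : ℕ) :
    (riccati A Q C R)^[k] Sigma₀ ≤ errCov A Q Sigma₀ C R F d k := by
  induction k with
  | zero => exact le_rfl
  | succ k ih =>
    rw [Function.iterate_succ_apply']
    exact riccati_mono A Q C (riccati_iterate_posSemidef hQ hR hS.posSemidef k) ih hR
      (le_effNoise _)

lemma errCov_le (hQ : Q.PosDef) (hR : R.PosDef) (hS : Sigma₀.PosDef)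
    (d : ℕ → Fin m → Bool) (k : ℕ) :
    errCov A Q Sigma₀ C R F d k ≤ (riccati A Q C (R + F * Fᵀ))^[k] Sigma₀ := by
  induction k with
  | zero => exact le_rfl
  | succ k ih =>
    rw [Function.iterate_succ_apply']
    exact riccati_mono A Q C (errCov_posSemidef hQ hR hS d k) ih (effNoise_posDef hR _)
      (effNoise_le _)

lemma errCov_le_invariant (hQ : Q.PosDef) (hR : R.PosDef) (hS : Sigma₀.PosDef)
    {M : Matrix (Fin n) (Fin n) ℝ} (hSM : Sigma₀ ≤ M) (hM : A * M * Aᵀ + Q ≤ M)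
    (d : ℕ → Fin m → Bool) (k : ℕ) : errCov A Q Sigma₀ C R F d k ≤ M := by
  induction k with
  | zero => exact hSM
  | succ k ih =>
    exact riccati_le_invariant (effNoise_posDef hR _) (errCov_posSemidef hQ hR hS d k) ih hM

lemma errCov_add {W : Matrix (Coord s) (Coord s) ℝ} {d : ℕ → Fin m → Bool} (k L : ℕ)
    (h : ∀ j < L, effNoise R F (d (k + j)) = W) :
    errCov A Q Sigma₀ C R F d (k + L) = (riccati A Q C W)^[L] (errCov A Q Sigma₀ C R F d k) := by
  induction L with
  | zero => rfl
  | succ L ih =>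
    rw [Function.iterate_succ_apply', ← ih fun j hj => h j (hj.trans (Nat.lt_succ_self L)),
      ← add_assoc, errCov, h L (Nat.lt_succ_self L)]

end Pattern

/-! ### Factorization of the trigger weights -/

section Blocks

variable {m : ℕ} {s : Fin m → ℕ}

/-- Blockwise factorization keeps `B`, and hence `F = B⁻¹`, compatible with the sensor masks. -/
lemma exists_block_factor (Y : (i : Fin m) → Matrix (Fin (s i)) (Fin (s i)) ℝ)
    (hY : ∀ i, (Y i).PosDef) :
    ∃ B : (i : Fin m) → Matrix (Fin (s i)) (Fin (s i)) ℝ, (∀ i, (B i)ᵀ * B i = Y i) ∧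
      IsUnit (Matrix.blockDiagonal' B).det := by
  have h : ∀ i, ∃ B : Matrix (Fin (s i)) (Fin (s i)) ℝ, Bᵀ * B = Y i := fun i => by
    obtain ⟨B, hB⟩ := CStarAlgebra.nonneg_iff_eq_star_mul_self.mp (hY i).posSemidef.nonneg
    exact ⟨B, by rw [hB, star_eq_conjTranspose, conjTranspose_eq_transpose_of_trivial]⟩
  choose B hB using h
  refine ⟨B, hB, ?_⟩
  have hu : ∀ i, IsUnit (B i).det := fun i => by
    have h1 := (hY i).isUnit
    rw [Matrix.isUnit_iff_isUnit_det, ← hB i, Matrix.det_mul] at h1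
    exact isUnit_of_mul_isUnit_right h1
  refine Matrix.isUnit_det_of_right_inverse (B := Matrix.blockDiagonal' fun i => (B i)⁻¹) ?_
  rw [← Matrix.blockDiagonal'_mul]
  simp only [fun i => Matrix.mul_nonsing_inv (B i) (hu i)]
  exact Matrix.blockDiagonal'_one

variable {Y B : (i : Fin m) → Matrix (Fin (s i)) (Fin (s i)) ℝ}

lemma inv_blockDiagonal_mul_transpose (hB : ∀ i, (B i)ᵀ * B i = Y i) :
    (Matrix.blockDiagonal' B)⁻¹ * ((Matrix.blockDiagonal' B)⁻¹)ᵀ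
      = (Matrix.blockDiagonal' Y)⁻¹ := by
  have : Matrix.blockDiagonal' Y = (Matrix.blockDiagonal' B)ᵀ * Matrix.blockDiagonal' B := by
    rw [Matrix.blockDiagonal'_transpose, ← Matrix.blockDiagonal'_mul]
    simp only [hB]
  rw [this, Matrix.mul_inv_rev, Matrix.transpose_nonsing_inv]

/-- The mask is a scalar on each sensor block, so it commutes with every block diagonal matrix. -/
lemma silentMask_mul_blockDiagonal (B : (i : Fin m) → Matrix (Fin (s i)) (Fin (s i)) ℝ)
    (d : Fin m → Bool) :
    silentMask s d * Matrix.blockDiagonal' B = Matrix.blockDiagonal' B * silentMask s d := by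
  ext ⟨i, a⟩ ⟨j, b⟩
  rw [silentMask, Matrix.diagonal_mul, Matrix.mul_diagonal]
  by_cases h : i = j
  · subst h; ring
  · rw [Matrix.blockDiagonal'_apply_ne _ _ _ h]; simp

end Blocks

/-! ### The conclusions from the Riccati recursion and recurrent windows -/

section Conclusion

variable {Ω : Type*} {n m : ℕ} {s : Fin m → ℕ}

/-- The transmission pattern of the sensors: `true` means that the sensor transmits. -/
noncomputable def pattern (A : Matrix (Fin n) (Fin n) ℝ) (C : Matrix (Coord s) (Fin n) ℝ)
    (Y : (i : Fin m) → Matrix (Fin (s i)) (Fin (s i)) ℝ)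
    (x₀ : Ω → EuclideanSpace ℝ (Fin n)) (w : ℕ → Ω → EuclideanSpace ℝ (Fin n))
    (v : ℕ → Ω → EuclideanSpace ℝ (Coord s)) (ζ : ℕ → Fin m → Ω → ℝ) (ω : Ω)
    (k : ℕ) (i : Fin m) : Bool :=
  decide (¬ ζ k i ω ≤ trigger (Y i) (fun j => meas A C x₀ w v k ω ⟨i, j⟩))

variable [MeasurableSpace Ω]

/-- Isolates what probability theory must supply: the covariance follows `errCov` along the pattern,
and both uniform patterns fill arbitrarily long windows infinitely often. The rest is deterministic.
-/
lemma conclusion_of_errCov (μ : Measure Ω)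
    {A Q Sigma₀ : Matrix (Fin n) (Fin n) ℝ} {C : Matrix (Coord s) (Fin n) ℝ}
    {R F Yinv : Matrix (Coord s) (Coord s) ℝ}
    (hA : spectralRadius ℂ (A.map Complex.ofReal) < 1)
    (hQ : Q.PosDef) (hR : R.PosDef) (hSigma₀ : Sigma₀.PosDef) (hF : F * Fᵀ = Yinv)
    (P : ℕ → Ω → Matrix (Fin n) (Fin n) ℝ) (γ : Ω → ℕ → Fin m → Bool)
    (hP : ∀ᵐ ω ∂μ, ∀ k, P k ω = errCov A Q Sigma₀ C R F (γ ω) k)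
    (hsilent : ∀ L : ℕ, ∀ᵐ ω ∂μ, ∃ᶠ k in atTop, ∀ j < L, ∀ p : Coord s, γ ω (k + j) p.1 = false)
    (htransmit : ∀ L : ℕ, ∀ᵐ ω ∂μ, ∃ᶠ k in atTop, ∀ j < L, ∀ p : Coord s,
      γ ω (k + j) p.1 = true) :
    (∃ M : Matrix (Fin n) (Fin n) ℝ, M.PosDef ∧ ∀ᵐ ω ∂μ, ∀ k, P k ω ≤ M) ∧
    ∃ Xlow Xup : Matrix (Fin n) (Fin n) ℝ,
      (Xlow.PosDef ∧ Xlow = riccati A Q C R Xlow ∧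
        ∀ X : Matrix (Fin n) (Fin n) ℝ, X.PosSemidef → X = riccati A Q C R X → X = Xlow) ∧
      (Xup.PosDef ∧ Xup = riccati A Q C (R + Yinv) Xup ∧
        ∀ X : Matrix (Fin n) (Fin n) ℝ, X.PosSemidef →
          X = riccati A Q C (R + Yinv) X → X = Xup) ∧
      (∀ ε : ℝ, 0 < ε → ∃ N : ℕ, ∀ᵐ ω ∂μ, ∀ k ≥ N,
        Xlow - ε • (1 : Matrix (Fin n) (Fin n) ℝ) ≤ P k ω ∧
          P k ω ≤ Xup + ε • (1 : Matrix (Fin n) (Fin n) ℝ)) ∧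
      (∀ ε : ℝ, 0 < ε →
        (∀ᵐ ω ∂μ, ∃ᶠ k in atTop, Xup - ε • (1 : Matrix (Fin n) (Fin n) ℝ) ≤ P k ω) ∧
        (∀ᵐ ω ∂μ, ∃ᶠ k in atTop, P k ω ≤ Xlow + ε • (1 : Matrix (Fin n) (Fin n) ℝ))) := by
  subst hF
  obtain ⟨M, hMp, hSM, hM⟩ := exists_invariant hA hQ.posSemidef.transpose_eq
    hSigma₀.posSemidef.transpose_eq
  have hRF : (R + F * Fᵀ).PosDef :=
    hR.add_posSemidef (by simpa using (PosSemidef.one (n := Coord s) (R := ℝ)).mul_mul_transpose F)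
  obtain ⟨Xlow, hl, hlfix, hllim⟩ := exists_riccati_limit (C := C) hA hQ hR
  obtain ⟨Xup, hu, hufix, hulim⟩ := exists_riccati_limit (C := C) hA hQ hRF
  have hshift : ∀ (p : ℕ → Prop) (q : ℕ → Prop) (L : ℕ), (∀ k, p k → q (k + L)) →
      (∃ᶠ k in atTop, p k) → ∃ᶠ k in atTop, q k := by
    intro p q L hpq hp
    rw [frequently_atTop] at hp ⊢
    intro a
    obtain ⟨b, hb, hpb⟩ := hp a
    exact ⟨b + L, by omega, hpq b hpb⟩
  refine ⟨⟨M, hMp, ?_⟩, Xlow, Xup, ⟨hl, hlfix, fun X hX hfix =>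
    eq_riccati_limit hl.posSemidef hllim hX hfix⟩, ⟨hu, hufix, fun X hX hfix =>
    eq_riccati_limit hu.posSemidef hulim hX hfix⟩, fun ε hε => ?_, fun ε hε => ⟨?_, ?_⟩⟩
  · filter_upwards [hP] with ω hω k
    rw [hω k]
    exact errCov_le_invariant hQ hR hSigma₀ hSM hM _ _
  · obtain ⟨N₁, hN₁⟩ := hllim Sigma₀ hSigma₀.posSemidef ε hε
    obtain ⟨N₂, hN₂⟩ := hulim Sigma₀ hSigma₀.posSemidef ε hε
    refine ⟨max N₁ N₂, ?_⟩
    filter_upwards [hP] with ω hω k hk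
    rw [hω k]
    exact ⟨(hN₁ k (le_of_max_le_left hk)).1.trans (le_errCov hQ hR hSigma₀ _ _),
      (errCov_le hQ hR hSigma₀ _ _).trans (hN₂ k (le_of_max_le_right hk)).2⟩
  -- The covariance at the start of the window is random but at least 0. Starting the comparison
  -- orbit at 0 gives a window length `L` that serves all windows.
  · obtain ⟨L, hL⟩ := hulim 0 PosSemidef.zero ε hε
    filter_upwards [hP, hsilent L] with ω hω hfreq
    refine hshift _ _ L (fun k hk => ?_) hfreq
    rw [hω, errCov_add k L fun j hj => effNoise_of_silent (hk j hj)]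
    exact (hL L le_rfl).1.trans (riccati_iterate_mono hQ hRF PosSemidef.zero
      (errCov_posSemidef hQ hR hSigma₀ _ _).nonneg L)
  -- Dually, `M` dominates the covariance at the start of any window.
  · obtain ⟨L, hL⟩ := hllim M hMp.posSemidef ε hε
    filter_upwards [hP, htransmit L] with ω hω hfreq
    refine hshift _ _ L (fun k hk => ?_) hfreq
    rw [hω, errCov_add k L fun j hj => effNoise_of_transmit (hk j hj)]
    exact (riccati_iterate_mono hQ hR (errCov_posSemidef hQ hR hSigma₀ _ _)
      (errCov_le_invariant hQ hR hSigma₀ hSM hM _ _) L).trans (hL L le_rfl).2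

end Conclusion

/-! ### Linear maps, characteristic functions and one Kalman step -/

section Lin

variable {ι κ τ : Type*} [Fintype ι] [Fintype κ] [Fintype τ] [DecidableEq ι] [DecidableEq κ]
  [DecidableEq τ]

/-- The continuous linear map of a real matrix between Euclidean spaces. -/
noncomputable def lin (M : Matrix κ ι ℝ) : EuclideanSpace ℝ ι →L[ℝ] EuclideanSpace ℝ κ :=
  LinearMap.toContinuousLinearMap (Matrix.toEuclideanLin M)

lemma lin_apply (M : Matrix κ ι ℝ) (x : EuclideanSpace ℝ ι) :
    lin M x = WithLp.toLp 2 (M *ᵥ x.ofLp) := rfl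

lemma lin_mul (M : Matrix κ ι ℝ) (N : Matrix ι τ ℝ) (x : EuclideanSpace ℝ τ) :
    lin (M * N) x = lin M (lin N x) := by
  simp [lin_apply, Matrix.mulVec_mulVec]

lemma lin_one (x : EuclideanSpace ℝ ι) : lin (1 : Matrix ι ι ℝ) x = x := by
  simp [lin_apply]

lemma lin_sub (M N : Matrix κ ι ℝ) (x : EuclideanSpace ℝ ι) :
    lin (M - N) x = lin M x - lin N x := by
  simp [lin_apply, Matrix.sub_mulVec]

lemma lin_add (M N : Matrix κ ι ℝ) (x : EuclideanSpace ℝ ι) :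
    lin (M + N) x = lin M x + lin N x := by
  simp [lin_apply, Matrix.add_mulVec]

lemma inner_eq_dotProduct (x y : EuclideanSpace ℝ ι) : inner ℝ x y = x.ofLp ⬝ᵥ y.ofLp := by
  rw [PiLp.inner_apply]
  simp [dotProduct, mul_comm]

lemma inner_lin (M : Matrix κ ι ℝ) (x : EuclideanSpace ℝ ι) (y : EuclideanSpace ℝ κ) :
    inner ℝ (lin M x) y = inner ℝ x (lin Mᵀ y) := by
  rw [inner_eq_dotProduct, inner_eq_dotProduct, lin_apply, lin_apply]
  simp only [Matrix.mulVec_transpose]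
  rw [dotProduct_comm, Matrix.dotProduct_mulVec, dotProduct_comm]

end Lin

section Independence

variable {Ω α β δ : Type*} [MeasurableSpace Ω] [MeasurableSpace α] [MeasurableSpace β]
  [MeasurableSpace δ] {μ : Measure Ω} [IsProbabilityMeasure μ]

/-- The joint law factors as ((X ⊗ Y) ⊗ Z); reassociate the product measure. -/
lemma indepFun_prodMk_right {X : Ω → α} {Y : Ω → β} {Z : Ω → δ} (hX : Measurable X)
    (hY : Measurable Y) (hZ : Measurable Z) (h : IndepFun X Y μ)
    (h' : IndepFun (fun ω => (X ω, Y ω)) Z μ) : IndepFun X (fun ω => (Y ω, Z ω)) μ := by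
  have hYZ : IndepFun Y Z μ := h'.comp measurable_snd measurable_id
  rw [indepFun_iff_map_prod_eq_prod_map_map (by fun_prop) (by fun_prop)] at h h' hYZ ⊢
  have h1 := congrArg (Measure.map MeasurableEquiv.prodAssoc) h'
  rw [Measure.map_map (by fun_prop) (by fun_prop), h] at h1
  have : IsProbabilityMeasure (μ.map X) := Measure.isProbabilityMeasure_map hX.aemeasurable
  have : IsProbabilityMeasure (μ.map Y) := Measure.isProbabilityMeasure_map hY.aemeasurable
  have : IsProbabilityMeasure (μ.map Z) := Measure.isProbabilityMeasure_map hZ.aemeasurable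
  rw [Measure.prodAssoc_prod, ← hYZ] at h1
  exact h1

end Independence

section OneStep

variable {Ω 𝒵 ι κ : Type*} [MeasurableSpace Ω] [MeasurableSpace 𝒵] [Fintype ι] [Fintype κ]
  [DecidableEq ι] [DecidableEq κ] {μ : Measure Ω} [IsProbabilityMeasure μ]

/-- `X` is a centered Gaussian vector with covariance matrix `S`, in terms of its characteristic
function. -/
def IsCenteredGaussian (X : Ω → EuclideanSpace ℝ ι) (S : Matrix ι ι ℝ) (μ : Measure Ω) : Prop :=
  ∀ t : EuclideanSpace ℝ ι, charFun (μ.map X) t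
    = Complex.exp ((-(t.ofLp ⬝ᵥ (S *ᵥ t.ofLp)) / 2 : ℝ) : ℂ)

lemma charFun_map_eq_integral {E : Type*} [NormedAddCommGroup E] [InnerProductSpace ℝ E]
    [MeasurableSpace E] [BorelSpace E] [SecondCountableTopology E] {X : Ω → E} (hX : Measurable X)
    (t : E) :
    charFun (μ.map X) t = ∫ ω, Complex.exp ((inner ℝ (X ω) t : ℝ) * Complex.I) ∂μ := by
  rw [charFun_apply, integral_map hX.aemeasurable (by fun_prop)]

/-- The nested independence hypotheses peel off `e`, then `w`, then separate `v` from `ξ`, so the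
joint characteristic function is the product of four Gaussian ones. -/
lemma integral_exp_inner_four {e w : Ω → EuclideanSpace ℝ ι} {v ξ : Ω → EuclideanSpace ℝ κ}
    (he : Measurable e) (hw : Measurable w) (hv : Measurable v) (hξ : Measurable ξ)
    {P Q : Matrix ι ι ℝ} {R S : Matrix κ κ ℝ}
    (hP : IsCenteredGaussian e P μ) (hQ : IsCenteredGaussian w Q μ)
    (hR : IsCenteredGaussian v R μ) (hS : IsCenteredGaussian ξ S μ)
    (h1 : IndepFun (fun ω => (w ω, v ω, ξ ω)) e μ) (h2 : IndepFun w (fun ω => (v ω, ξ ω)) μ)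
    (h3 : IndepFun v ξ μ) (a b : EuclideanSpace ℝ ι) (c d : EuclideanSpace ℝ κ) :
    ∫ ω, Complex.exp ((inner ℝ (e ω) a + inner ℝ (w ω) b + inner ℝ (v ω) c
        + inner ℝ (ξ ω) d : ℝ) * Complex.I) ∂μ
      = Complex.exp ((-(a.ofLp ⬝ᵥ (P *ᵥ a.ofLp) + b.ofLp ⬝ᵥ (Q *ᵥ b.ofLp)
        + c.ofLp ⬝ᵥ (R *ᵥ c.ofLp) + d.ofLp ⬝ᵥ (S *ᵥ d.ofLp)) / 2 : ℝ) : ℂ) := by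
  have hE : ∀ ω, Complex.exp ((inner ℝ (e ω) a + inner ℝ (w ω) b + inner ℝ (v ω) c
      + inner ℝ (ξ ω) d : ℝ) * Complex.I)
      = Complex.exp ((inner ℝ (w ω) b : ℝ) * Complex.I) *
        (Complex.exp ((inner ℝ (v ω) c : ℝ) * Complex.I) *
          Complex.exp ((inner ℝ (ξ ω) d : ℝ) * Complex.I)) *
        Complex.exp ((inner ℝ (e ω) a : ℝ) * Complex.I) := by
    intro ω
    simp only [← Complex.exp_add]
    congr 1
    push_cast
    ring
  simp_rw [hE]
  have i1 := h1.integral_fun_comp_mul_comp (𝕜 := ℂ) (by fun_prop) (by fun_prop)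
    (f := fun p => Complex.exp ((inner ℝ p.1 b : ℝ) * Complex.I) *
        (Complex.exp ((inner ℝ p.2.1 c : ℝ) * Complex.I) *
          Complex.exp ((inner ℝ p.2.2 d : ℝ) * Complex.I)))
    (g := fun p => Complex.exp ((inner ℝ p a : ℝ) * Complex.I)) (by fun_prop) (by fun_prop)
  have i2 := h2.integral_fun_comp_mul_comp (𝕜 := ℂ) (by fun_prop) (by fun_prop)
    (f := fun p => Complex.exp ((inner ℝ p b : ℝ) * Complex.I))
    (g := fun p => Complex.exp ((inner ℝ p.1 c : ℝ) * Complex.I) *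
          Complex.exp ((inner ℝ p.2 d : ℝ) * Complex.I)) (by fun_prop) (by fun_prop)
  have i3 := h3.integral_fun_comp_mul_comp (𝕜 := ℂ) (by fun_prop) (by fun_prop)
    (f := fun p => Complex.exp ((inner ℝ p c : ℝ) * Complex.I))
    (g := fun p => Complex.exp ((inner ℝ p d : ℝ) * Complex.I)) (by fun_prop) (by fun_prop)
  rw [i1, i2, i3, ← charFun_map_eq_integral he, ← charFun_map_eq_integral hw,
    ← charFun_map_eq_integral hv, ← charFun_map_eq_integral hξ, hP a, hQ b, hR c, hS d]
  simp only [← Complex.exp_add]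
  congr 1
  push_cast
  ring

end OneStep

section QuadraticForm

variable {ι κ : Type*} [Fintype ι] [Fintype κ] [DecidableEq ι] [DecidableEq κ]

lemma transpose_mulVec_dotProduct (N : Matrix ι κ ℝ) (x : ι → ℝ) (y : κ → ℝ) :
    (Nᵀ *ᵥ x) ⬝ᵥ y = x ⬝ᵥ (N *ᵥ y) := by
  rw [Matrix.mulVec_transpose, Matrix.dotProduct_mulVec]

lemma dotProduct_mulVec_comm {M : Matrix ι ι ℝ} (hM : Mᵀ = M) (x y : ι → ℝ) :
    x ⬝ᵥ (M *ᵥ y) = y ⬝ᵥ (M *ᵥ x) := by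
  rw [← transpose_mulVec_dotProduct, hM, dotProduct_comm]

lemma quadForm_add {M : Matrix ι ι ℝ} (hM : Mᵀ = M) (x y : ι → ℝ) :
    (x + y) ⬝ᵥ (M *ᵥ (x + y)) = x ⬝ᵥ (M *ᵥ x) + 2 * (x ⬝ᵥ (M *ᵥ y)) + y ⬝ᵥ (M *ᵥ y) := by
  rw [Matrix.mulVec_add, add_dotProduct, dotProduct_add, dotProduct_add,
    dotProduct_mulVec_comm hM y x]
  ring

/-- This is the exponent of the joint characteristic function of the new error, the innovation and
the unused noise. Substituting ρ = r - K' t completes the square, so the cross terms in `t` and `r`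
cancel exactly for the Kalman gain. Those with `u` cancel because D (1 - D) = 0. -/
lemma quadForm_kalman {A P Q : Matrix ι ι ℝ} {C : Matrix κ ι ℝ} {R F D : Matrix κ κ ℝ}
    (hP : P.PosSemidef) (hW : (R + F * D * Fᵀ).PosDef) (hDt : Dᵀ = D) (hDD : D * D = D)
    (t : ι → ℝ) (r u ρ : κ → ℝ) (hρ : ρ = r - (kalmanGain A C (R + F * D * Fᵀ) P)ᵀ *ᵥ t) :
    (Aᵀ *ᵥ t + Cᵀ *ᵥ ρ) ⬝ᵥ (P *ᵥ (Aᵀ *ᵥ t + Cᵀ *ᵥ ρ)) + t ⬝ᵥ (Q *ᵥ t) + ρ ⬝ᵥ (R *ᵥ ρ)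
      + (D *ᵥ (Fᵀ *ᵥ ρ) + (1 - D) *ᵥ u) ⬝ᵥ
        ((1 : Matrix κ κ ℝ) *ᵥ (D *ᵥ (Fᵀ *ᵥ ρ) + (1 - D) *ᵥ u))
      = t ⬝ᵥ (riccati A Q C (R + F * D * Fᵀ) P *ᵥ t)
        + r ⬝ᵥ ((C * P * Cᵀ + (R + F * D * Fᵀ)) *ᵥ r)
        + ((1 - D) *ᵥ u) ⬝ᵥ ((1 - D) *ᵥ u) := by
  set W := R + F * D * Fᵀ with hWdef
  set K := kalmanGain A C W P with hK
  set V := C * P * Cᵀ + W with hV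
  have hKV : K * V = A * P * Cᵀ := kalmanGain_mul A C hP hW
  have hVt : Vᵀ = V := (innovation_posDef hP hW C).posSemidef.transpose_eq
  have hVK : V * Kᵀ = C * P * Aᵀ := by
    have := congrArg Matrix.transpose hKV
    simpa [Matrix.transpose_mul, hVt, hP.transpose_eq, Matrix.mul_assoc] using this
  have hric : riccati A Q C W P = A * P * Aᵀ + Q - K * V * Kᵀ := by
    rw [riccati, Matrix.mul_assoc K V, hVK, hK, kalmanGain]
    simp only [Matrix.mul_assoc]
  have e1 : (Aᵀ *ᵥ t + Cᵀ *ᵥ ρ) ⬝ᵥ (P *ᵥ (Aᵀ *ᵥ t + Cᵀ *ᵥ ρ))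
      = t ⬝ᵥ ((A * P * Aᵀ) *ᵥ t) + 2 * (t ⬝ᵥ ((K * V) *ᵥ ρ)) + ρ ⬝ᵥ ((C * P * Cᵀ) *ᵥ ρ) := by
    rw [quadForm_add hP.transpose_eq, hKV]
    simp only [transpose_mulVec_dotProduct, Matrix.mulVec_mulVec, Matrix.mul_assoc]
  have e2 : (D *ᵥ (Fᵀ *ᵥ ρ) + (1 - D) *ᵥ u) ⬝ᵥ
        ((1 : Matrix κ κ ℝ) *ᵥ (D *ᵥ (Fᵀ *ᵥ ρ) + (1 - D) *ᵥ u))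
      = ρ ⬝ᵥ ((F * D * Fᵀ) *ᵥ ρ) + ((1 - D) *ᵥ u) ⬝ᵥ ((1 - D) *ᵥ u) := by
    have h0 : D * (1 - D) = 0 := by rw [Matrix.mul_sub, Matrix.mul_one, hDD, sub_self]
    have h1 : (D *ᵥ (Fᵀ *ᵥ ρ)) ⬝ᵥ (D *ᵥ (Fᵀ *ᵥ ρ)) = ρ ⬝ᵥ ((F * D * Fᵀ) *ᵥ ρ) := by
      conv_lhs => enter [1]; rw [← hDt]
      rw [transpose_mulVec_dotProduct, transpose_mulVec_dotProduct]
      simp only [Matrix.mulVec_mulVec]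
      rw [← Matrix.mul_assoc D D, hDD, Matrix.mul_assoc]
    have h2 : (D *ᵥ (Fᵀ *ᵥ ρ)) ⬝ᵥ ((1 - D) *ᵥ u) = 0 := by
      conv_lhs => enter [1]; rw [← hDt]
      rw [transpose_mulVec_dotProduct, Matrix.mulVec_mulVec, h0]
      simp
    rw [quadForm_add Matrix.transpose_one]
    simp only [Matrix.one_mulVec]
    rw [h1, h2]
    ring
  have e3 : ρ ⬝ᵥ (V *ᵥ ρ) = r ⬝ᵥ (V *ᵥ r) - 2 * (t ⬝ᵥ ((K * V) *ᵥ r))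
      + t ⬝ᵥ ((K * V * Kᵀ) *ᵥ t) := by
    rw [hρ, sub_eq_add_neg, quadForm_add hVt, Matrix.mulVec_neg, dotProduct_neg, dotProduct_neg,
      neg_dotProduct, neg_neg, dotProduct_mulVec_comm hVt r (Kᵀ *ᵥ t)]
    simp only [transpose_mulVec_dotProduct, Matrix.mulVec_mulVec, Matrix.mul_assoc]
    ring
  have e4 : t ⬝ᵥ ((K * V) *ᵥ ρ) = t ⬝ᵥ ((K * V) *ᵥ r) - t ⬝ᵥ ((K * V * Kᵀ) *ᵥ t) := by
    rw [hρ, Matrix.mulVec_sub, dotProduct_sub, Matrix.mulVec_mulVec]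
  have e5 : ρ ⬝ᵥ (V *ᵥ ρ) = ρ ⬝ᵥ ((C * P * Cᵀ) *ᵥ ρ) + ρ ⬝ᵥ (R *ᵥ ρ)
      + ρ ⬝ᵥ ((F * D * Fᵀ) *ᵥ ρ) := by
    rw [hV, hWdef]
    simp only [Matrix.add_mulVec, dotProduct_add]
    ring
  rw [e1, e2, hric]
  simp only [Matrix.add_mulVec, Matrix.sub_mulVec, dotProduct_add, dotProduct_sub]
  linarith

end QuadraticForm

section OneStep

variable {Ω 𝒵 ι κ : Type*} [MeasurableSpace Ω] [MeasurableSpace 𝒵] [Fintype ι] [Fintype κ]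
  [DecidableEq ι] [DecidableEq κ] {μ : Measure Ω} [IsProbabilityMeasure μ]

/-- One step of the Kalman filter: the new estimation error is a centered Gaussian vector with
covariance given by the Riccati map, and it is independent of the innovation `i`, of the part of
the auxiliary noise `ξ` that does not enter the measurement, and of the past `Z`. -/
theorem kalman_step {A P Q : Matrix ι ι ℝ} {C : Matrix κ ι ℝ} {R F D : Matrix κ κ ℝ}
    (hP : P.PosSemidef) (hW : (R + F * D * Fᵀ).PosDef) (hDt : Dᵀ = D) (hDD : D * D = D)
    {e w : Ω → EuclideanSpace ℝ ι} {v ξ : Ω → EuclideanSpace ℝ κ} {Z : Ω → 𝒵}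
    (he : Measurable e) (hw : Measurable w) (hv : Measurable v) (hξ : Measurable ξ)
    (hZ : Measurable Z)
    (ge : IsCenteredGaussian e P μ) (gw : IsCenteredGaussian w Q μ)
    (gv : IsCenteredGaussian v R μ) (gξ : IsCenteredGaussian ξ 1 μ)
    (h1 : IndepFun (fun ω => (w ω, v ω, ξ ω)) (fun ω => (e ω, Z ω)) μ)
    (h2 : IndepFun w (fun ω => (v ω, ξ ω)) μ) (h3 : IndepFun v ξ μ) (h4 : IndepFun e Z μ)
    {i : Ω → EuclideanSpace ℝ κ} (hi : ∀ ω, i ω = lin C (e ω) + v ω + lin F (lin D (ξ ω)))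
    {e' : Ω → EuclideanSpace ℝ ι}
    (he' : ∀ ω, e' ω = lin A (e ω) + w ω
      - lin (kalmanGain A C (R + F * D * Fᵀ) P) (i ω)) :
    IsCenteredGaussian e' (riccati A Q C (R + F * D * Fᵀ) P) μ ∧
      IndepFun e' (fun ω => ((i ω, lin (1 - D) (ξ ω)), Z ω)) μ := by
  have him : Measurable i := by
    rw [funext hi]
    fun_prop
  have hem' : Measurable e' := by
    rw [funext he']
    fun_prop
  set K := kalmanGain A C (R + F * D * Fᵀ) P with hK
  have hDt' : (1 - D)ᵀ = 1 - D := by rw [transpose_sub, transpose_one, hDt]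
  -- The joint characteristic function splits into a factor in `t` and a factor in `(r, u)`. This
  -- yields both the law of the new error and its independence of the innovation and the unused
  -- noise.
  have key : ∀ (t : EuclideanSpace ℝ ι) (r u : EuclideanSpace ℝ κ),
      ∫ ω, Complex.exp ((inner ℝ (e' ω) t + (inner ℝ (i ω) r
        + inner ℝ (lin (1 - D) (ξ ω)) u) : ℝ) * Complex.I) ∂μ
      = Complex.exp ((-(t.ofLp ⬝ᵥ (riccati A Q C (R + F * D * Fᵀ) P *ᵥ t.ofLp)) / 2 : ℝ) : ℂ) *
        Complex.exp ((-(r.ofLp ⬝ᵥ ((C * P * Cᵀ + (R + F * D * Fᵀ)) *ᵥ r.ofLp)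
        + ((1 - D) *ᵥ u.ofLp) ⬝ᵥ ((1 - D) *ᵥ u.ofLp)) / 2 : ℝ) : ℂ) := by
    intro t r u
    set ρ : EuclideanSpace ℝ κ := r - lin Kᵀ t with hρ
    have hin : ∀ ω, inner ℝ (e' ω) t + (inner ℝ (i ω) r + inner ℝ (lin (1 - D) (ξ ω)) u)
        = inner ℝ (e ω) (lin Aᵀ t + lin Cᵀ ρ) + inner ℝ (w ω) t + inner ℝ (v ω) ρ
          + inner ℝ (ξ ω) (lin D (lin Fᵀ ρ) + lin (1 - D) u) := by
      intro ω
      have ha : inner ℝ (e' ω) t + inner ℝ (i ω) r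
          = inner ℝ (lin A (e ω)) t + inner ℝ (w ω) t + inner ℝ (i ω) ρ := by
        rw [he', hρ, inner_sub_left, inner_add_left, inner_sub_right, inner_lin K]
        ring
      rw [← add_assoc, ha, hi, inner_add_left, inner_add_left, inner_lin A, inner_lin C,
        inner_lin F, inner_lin D, hDt, inner_lin (1 - D), hDt', inner_add_right, inner_add_right]
      ring
    simp_rw [hin]
    rw [integral_exp_inner_four he hw hv hξ ge gw gv gξ
      (h1.comp measurable_id measurable_fst) h2 h3, ← Complex.exp_add]
    congr 1
    have hq := quadForm_kalman (A := A) (Q := Q) (C := C) hP hW hDt hDD t.ofLp r.ofLp u.ofLp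
      ρ.ofLp rfl
    simp only [lin_apply, WithLp.ofLp_add]
    rw [hq]
    push_cast
    ring
  have hcf : IsCenteredGaussian e' (riccati A Q C (R + F * D * Fᵀ) P) μ := by
    intro t
    rw [charFun_map_eq_integral hem']
    have := key t 0 0
    simpa using this
  refine ⟨hcf, ?_⟩
  have hind : IndepFun e' (fun ω => (i ω, lin (1 - D) (ξ ω))) μ := by
    have h : IndepFun e' (fun ω => WithLp.toLp 2 (i ω, lin (1 - D) (ξ ω))) μ := by
      rw [indepFun_iff_charFun_prod (by fun_prop) (by fun_prop)]
      intro t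
      rw [charFun_map_eq_integral (by fun_prop), charFun_map_eq_integral (by fun_prop),
        charFun_map_eq_integral (by fun_prop)]
      have k1 := key t.ofLp.1 t.ofLp.2.ofLp.1 t.ofLp.2.ofLp.2
      have k2 := key t.ofLp.1 0 0
      have k3 := key 0 t.ofLp.2.ofLp.1 t.ofLp.2.ofLp.2
      simp only [inner_zero_right, add_zero, zero_add, WithLp.ofLp_zero, Matrix.mulVec_zero,
        dotProduct_zero, neg_zero, zero_div, Complex.ofReal_zero,
        Complex.exp_zero, mul_one, one_mul] at k2 k3
      simp only [WithLp.prod_inner_apply]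
      rw [k1, k2, k3]
    exact h.comp measurable_id (MeasurableEquiv.toLp 2 _).symm.measurable
  -- The past is independent of all the ingredients of the new error, the innovation and the unused
  -- noise, jointly; this upgrades independence of the innovation to independence of innovation and
  -- past.
  have hZe : IndepFun Z (fun ω => (e ω, (w ω, v ω, ξ ω))) μ := by
    refine indepFun_prodMk_right hZ he (by fun_prop) h4.symm ?_
    exact h1.symm.comp measurable_swap measurable_id
  refine indepFun_prodMk_right hem' (by fun_prop) hZ hind ?_
  have hi_eq : i = fun ω => lin C (e ω) + v ω + lin F (lin D (ξ ω)) := funext hi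
  have he_eq : e' = fun ω => lin A (e ω) + w ω
      - lin K (lin C (e ω) + v ω + lin F (lin D (ξ ω))) := by
    funext ω
    rw [he', hi]
  rw [he_eq, hi_eq]
  exact hZe.symm.comp (φ := fun q : EuclideanSpace ℝ ι × EuclideanSpace ℝ ι ×
      EuclideanSpace ℝ κ × EuclideanSpace ℝ κ =>
    (lin A q.1 + q.2.1 - lin K (lin C q.1 + q.2.2.1 + lin F (lin D q.2.2.2)),
      (lin C q.1 + q.2.2.1 + lin F (lin D q.2.2.2), lin (1 - D) q.2.2.2)))
    (by fun_prop) measurable_id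

end OneStep

/-! ### Conditioning on a null event by continuity -/

section Shift

variable {Ω E : Type*} [MeasurableSpace Ω] [NormedAddCommGroup E] [NormedSpace ℝ E]
  [FiniteDimensional ℝ E] [MeasurableSpace E] [BorelSpace E]

/-- Let `η` be independent of `(u, Y)` with a bounded continuous density `p`. If the weighted
integrals of `u(·, Y + η)` against test functions of `Y + η` vanish, then so does the integral of
`u(·, 0)` against the conditional density `p(-Y)` of `Y + η` at the point `0`. -/
theorem integral_density_eq_zero {μ : Measure Ω} [IsProbabilityMeasure μ] {lam : Measure E}
    [lam.IsAddHaarMeasure] {ν : Measure E} [IsProbabilityMeasure ν] {p : E → ℝ}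
    (hp : Continuous p) (hp0 : ∀ z, 0 ≤ p z) {B : ℝ} (hpB : ∀ z, p z ≤ B)
    (hν : ν = lam.withDensity fun z => ENNReal.ofReal (p z))
    {u : Ω → E → ℝ} (hu : Measurable fun x : Ω × E => u x.1 x.2) (huc : ∀ ω, Continuous (u ω))
    {U : Ω → ℝ} (hU : Integrable U μ) {κ : E → ℝ} (hκ : Continuous κ)
    (hbound : ∀ ω z, |u ω z| ≤ U ω * κ z) {Y : Ω → E} (hY : Measurable Y)
    (hzero : ∀ h : E → ℝ, Continuous h → HasCompactSupport h →
      ∫ x : Ω × E, u x.1 (Y x.1 + x.2) * h (Y x.1 + x.2) ∂(μ.prod ν) = 0) :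
    ∫ ω, u ω 0 * p (-Y ω) ∂μ = 0 := by
  set G : E → ℝ := fun z => ∫ ω, u ω z * p (z - Y ω) ∂μ with hG
  have hUκ : ∀ ω z, 0 ≤ U ω * κ z := fun ω z => (abs_nonneg _).trans (hbound ω z)
  have hUκ' : ∀ ω z, U ω * κ z ≤ |U ω| * |κ z| := fun ω z => by
    rw [← abs_mul]; exact le_abs_self _
  have hB0 : 0 ≤ B := (hp0 0).trans (hpB 0)
  -- Dominated convergence; the product form of the bound on `u` gives a dominating function locally
  -- uniform in `z`.
  have hGc : Continuous G := by
    rw [continuous_iff_continuousAt]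
    intro z₀
    have hev : ∀ᶠ z in nhds z₀, |κ z| < |κ z₀| + 1 :=
      (hκ.abs.continuousAt).eventually (gt_mem_nhds (by linarith))
    refine continuousAt_of_dominated (bound := fun ω => |U ω| * (|κ z₀| + 1) * B) ?_ ?_ ?_ ?_
    · refine Eventually.of_forall fun z => Measurable.aestronglyMeasurable ?_
      exact (hu.comp (measurable_id.prodMk measurable_const)).mul
        (hp.measurable.comp (measurable_const.sub hY))
    · filter_upwards [hev] with z hz
      refine Eventually.of_forall fun ω => ?_
      rw [Real.norm_eq_abs, abs_mul, abs_of_nonneg (hp0 _)]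
      refine mul_le_mul ?_ (hpB _) (hp0 _) (by positivity)
      exact ((hbound ω z).trans (hUκ' ω z)).trans
        (mul_le_mul_of_nonneg_left hz.le (abs_nonneg _))
    · exact (hU.abs.mul_const _).mul_const _
    · refine Eventually.of_forall fun ω => ?_
      exact ((huc ω).mul (hp.comp (continuous_id.sub continuous_const))).continuousAt
  have htest : ∀ h : E → ℝ, Continuous h → HasCompactSupport h → ∫ z, h z * G z ∂lam = 0 := by
    intro h hh hhs
    have hκh : Continuous fun z => |κ z| * |h z| := hκ.abs.mul hh.abs
    have hκhs : HasCompactSupport fun z => |κ z| * |h z| :=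
      HasCompactSupport.mul_left hhs.abs
    obtain ⟨b, hb⟩ := hκhs.exists_bound_of_continuous hκh
    have hshift : Measurable fun x : Ω × E => (x.1, Y x.1 + x.2) :=
      measurable_fst.prodMk ((hY.comp measurable_fst).add measurable_snd)
    have hI1 : Integrable (fun x : Ω × E => u x.1 (Y x.1 + x.2) * h (Y x.1 + x.2))
        (μ.prod ν) := by
      have hUb : Integrable (fun x : Ω × E => |U x.1| * b) (μ.prod ν) :=
        (hU.abs.comp_fst ν).mul_const b
      refine hUb.mono' (Measurable.aestronglyMeasurable ?_) (Eventually.of_forall fun x => ?_)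
      · exact (hu.comp hshift).mul (hh.measurable.comp (measurable_snd.comp hshift))
      · rw [Real.norm_eq_abs, abs_mul]
        calc |u x.1 (Y x.1 + x.2)| * |h (Y x.1 + x.2)|
            ≤ |U x.1| * |κ (Y x.1 + x.2)| * |h (Y x.1 + x.2)| :=
              mul_le_mul_of_nonneg_right ((hbound _ _).trans (hUκ' _ _)) (abs_nonneg _)
          _ ≤ |U x.1| * b := by
              rw [mul_assoc]
              exact mul_le_mul_of_nonneg_left ((le_abs_self _).trans (hb _)) (abs_nonneg _)
    have hI2 : Integrable (fun x : Ω × E => u x.1 x.2 * h x.2 * p (x.2 - Y x.1))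
        (μ.prod lam) := by
      have hUb : Integrable (fun x : Ω × E => |U x.1| * (|κ x.2| * |h x.2|)) (μ.prod lam) :=
        hU.abs.mul_prod (hκh.integrable_of_hasCompactSupport hκhs)
      refine (hUb.mul_const B).mono' (Measurable.aestronglyMeasurable ?_)
        (Eventually.of_forall fun x => ?_)
      · exact (hu.mul (hh.measurable.comp measurable_snd)).mul
          (hp.measurable.comp (measurable_snd.sub (hY.comp measurable_fst)))
      · rw [Real.norm_eq_abs, abs_mul, abs_mul, abs_of_nonneg (hp0 _), ← mul_assoc]
        refine mul_le_mul ?_ (hpB _) (hp0 _) (by positivity)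
        exact mul_le_mul_of_nonneg_right ((hbound _ _).trans (hUκ' _ _)) (abs_nonneg _)
    have h1 := hzero h hh hhs
    rw [integral_prod _ hI1] at h1
    have h2 : ∀ ω, ∫ η, u ω (Y ω + η) * h (Y ω + η) ∂ν
        = ∫ z, u ω z * h z * p (z - Y ω) ∂lam := by
      intro ω
      rw [hν, integral_withDensity_eq_integral_toReal_smul
        (hp.measurable.ennreal_ofReal) (Eventually.of_forall fun _ => ENNReal.ofReal_lt_top)]
      rw [← integral_add_left_eq_self (μ := lam) (fun z => u ω z * h z * p (z - Y ω)) (Y ω)]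
      refine integral_congr_ae (Eventually.of_forall fun η => ?_)
      simp only [ENNReal.toReal_ofReal (hp0 η), smul_eq_mul, add_sub_cancel_left]
      ring
    simp_rw [h2] at h1
    rw [← integral_prod _ hI2, integral_prod_symm _ hI2] at h1
    rw [← h1]
    refine integral_congr_ae (Eventually.of_forall fun z => ?_)
    simp only [hG]
    rw [← integral_const_mul]
    refine integral_congr_ae (Eventually.of_forall fun ω => ?_)
    simp only
    ring
  -- `G` integrates to zero against all test functions, so it vanishes almost everywhere. By
  -- continuity it vanishes everywhere, in particular at 0.
  have hae : ∀ᵐ z ∂lam, G z = 0 :=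
    ae_eq_zero_of_integral_contDiff_smul_eq_zero hGc.locallyIntegrable fun h hh hhs => by
      simpa using htest h hh.continuous hhs
  have h0 : G = fun _ => 0 := (hGc.ae_eq_iff_eq lam continuous_const).1 hae
  have := congrFun h0 0
  simpa [hG] using this

end Shift

/-! ### Density of the auxiliary Gaussian noise -/

section Density

/-- It is enough to compare boxes, where the integral of the product of densities factors. -/
lemma pi_withDensity_ofReal {ι : Type*} [Fintype ι] {α : ι → Type*}
    [∀ i, MeasurableSpace (α i)] {μ : ∀ i, Measure (α i)} [∀ i, SigmaFinite (μ i)]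
    {g : ∀ i, α i → ℝ} (hg0 : ∀ i x, 0 ≤ g i x)
    (hgi : ∀ i, Integrable (g i) (μ i)) :
    Measure.pi (fun i => (μ i).withDensity fun x => ENNReal.ofReal (g i x))
      = (Measure.pi μ).withDensity fun x => ENNReal.ofReal (∏ i, g i (x i)) := by
  have : ∀ i, IsFiniteMeasure ((μ i).withDensity fun x => ENNReal.ofReal (g i x)) := fun i =>
    isFiniteMeasure_withDensity_ofReal (hgi i).2
  refine Measure.pi_eq fun S hS => ?_
  have hind : ∀ i, Integrable ((S i).indicator (g i)) (μ i) := fun i => (hgi i).indicator (hS i)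
  have hind0 : ∀ i x, 0 ≤ (S i).indicator (g i) x := fun i x =>
    Set.indicator_nonneg (fun y _ => hg0 i y) x
  have hcoord : ∀ i, (μ i).withDensity (fun x => ENNReal.ofReal (g i x)) (S i)
      = ENNReal.ofReal (∫ x, (S i).indicator (g i) x ∂μ i) := by
    intro i
    rw [withDensity_apply _ (hS i), ofReal_integral_eq_lintegral_ofReal (hind i)
      (Eventually.of_forall (hind0 i)), ← lintegral_indicator (hS i)]
    refine lintegral_congr fun x => ?_
    by_cases hx : x ∈ S i <;> simp [hx]
  have hprod : ∀ x : ∀ i, α i, (Set.univ.pi S).indicator (fun x => ∏ i, g i (x i)) x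
      = ∏ i, (S i).indicator (g i) (x i) := by
    intro x
    by_cases hx : x ∈ Set.univ.pi S
    · rw [Set.indicator_of_mem hx]
      exact Finset.prod_congr rfl fun i _ => (Set.indicator_of_mem (hx i (Set.mem_univ i)) _).symm
    · rw [Set.indicator_of_notMem hx]
      simp only [Set.mem_univ_pi, not_forall] at hx
      obtain ⟨i, hi⟩ := hx
      exact (Finset.prod_eq_zero (Finset.mem_univ i) (Set.indicator_of_notMem hi _)).symm
  have hSm : MeasurableSet (Set.univ.pi S) := MeasurableSet.univ_pi hS
  rw [withDensity_apply _ hSm, ← lintegral_indicator hSm]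
  have h1 : ∀ x : ∀ i, α i, (Set.univ.pi S).indicator
      (fun x => ENNReal.ofReal (∏ i, g i (x i))) x
      = ENNReal.ofReal (∏ i, (S i).indicator (g i) (x i)) := by
    intro x
    rw [← hprod]
    by_cases hx : x ∈ Set.univ.pi S <;> simp [hx]
  rw [lintegral_congr h1, ← ofReal_integral_eq_lintegral_ofReal
    (Integrable.fintype_prod_dep hind)
    (Eventually.of_forall fun x => Finset.prod_nonneg fun i _ => hind0 i _),
    integral_fintype_prod_eq_prod, ENNReal.ofReal_prod_of_nonneg
      fun i _ => integral_nonneg (hind0 i)]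
  exact Finset.prod_congr rfl fun i _ => (hcoord i).symm

lemma gaussianPDFReal_std (x : ℝ) :
    gaussianPDFReal 0 1 x = (√(2 * Real.pi))⁻¹ * Real.exp (-(1 / 2) * x ^ 2) := by
  rw [gaussianPDFReal]
  simp only [NNReal.coe_one, mul_one, sub_zero]
  congr 2
  ring

lemma gaussianPDFReal_std_le_one (x : ℝ) : gaussianPDFReal 0 1 x ≤ 1 := by
  rw [gaussianPDFReal_std]
  refine mul_le_one₀ (inv_le_one_of_one_le₀ ?_) (Real.exp_pos _).le (Real.exp_le_one_iff.2 ?_)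
  · rw [Real.one_le_sqrt]
    linarith [Real.pi_gt_three]
  · nlinarith [sq_nonneg x]

lemma continuous_gaussianPDFReal_std : Continuous (gaussianPDFReal 0 1) := by
  have : gaussianPDFReal 0 1 = fun x => (√(2 * Real.pi))⁻¹ * Real.exp (-(1 / 2) * x ^ 2) :=
    funext gaussianPDFReal_std
  rw [this]
  fun_prop

variable (N : ℕ) (ι : Type*) [Fintype ι]

/-- The law of a family of `N` independent standard Gaussian vectors. -/
noncomputable def auxMeasure : Measure (Fin N → ι → ℝ) :=
  Measure.pi fun _ => Measure.pi fun _ => gaussianReal 0 1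

instance : IsProbabilityMeasure (auxMeasure N ι) := by
  unfold auxMeasure
  infer_instance

variable {N ι}

/-- The density of `auxMeasure`. -/
noncomputable def auxDensity (z : Fin N → ι → ℝ) : ℝ :=
  ∏ j, ∏ q, gaussianPDFReal 0 1 (z j q)

lemma continuous_auxDensity : Continuous (auxDensity : (Fin N → ι → ℝ) → ℝ) :=
  continuous_finsetProd _ fun j _ => continuous_finsetProd _ fun q _ =>
    continuous_gaussianPDFReal_std.comp (by fun_prop)

lemma auxDensity_nonneg (z : Fin N → ι → ℝ) : 0 ≤ auxDensity z :=
  Finset.prod_nonneg fun _ _ => Finset.prod_nonneg fun _ _ => gaussianPDFReal_nonneg _ _ _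

lemma auxDensity_le_one (z : Fin N → ι → ℝ) : auxDensity z ≤ 1 :=
  Finset.prod_le_one (fun _ _ => Finset.prod_nonneg fun _ _ => gaussianPDFReal_nonneg _ _ _)
    fun _ _ => Finset.prod_le_one (fun _ _ => gaussianPDFReal_nonneg _ _ _)
      fun _ _ => gaussianPDFReal_std_le_one _

lemma auxMeasure_eq_withDensity :
    auxMeasure N ι = (volume : Measure (Fin N → ι → ℝ)).withDensity
      fun z => ENNReal.ofReal (auxDensity z) := by
  have h1 : (gaussianReal 0 1 : Measure ℝ)
      = volume.withDensity fun x => ENNReal.ofReal (gaussianPDFReal 0 1 x) :=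
    gaussianReal_of_var_ne_zero 0 one_ne_zero
  have h2 : Measure.pi (fun _ : ι => gaussianReal 0 1)
      = (volume : Measure (ι → ℝ)).withDensity
        fun x => ENNReal.ofReal (∏ q, gaussianPDFReal 0 1 (x q)) := by
    rw [h1]
    exact pi_withDensity_ofReal (μ := fun _ : ι => (volume : Measure ℝ))
      (g := fun _ => gaussianPDFReal 0 1)
      (fun _ _ => gaussianPDFReal_nonneg _ _ _) fun _ => integrable_gaussianPDFReal _ _
  have h3 := pi_withDensity_ofReal (μ := fun _ : Fin N => (volume : Measure (ι → ℝ)))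
    (g := fun _ x => ∏ q, gaussianPDFReal 0 1 (x q))
    (fun _ _ => Finset.prod_nonneg fun _ _ => gaussianPDFReal_nonneg _ _ _)
    (fun _ => Integrable.fintype_prod (f := fun _ : ι => gaussianPDFReal 0 1)
      fun _ => integrable_gaussianPDFReal _ _)
  rw [auxMeasure, h2, h3, ← volume_pi]
  rfl

end Density

/-! ### The trigger as a Gaussian density -/

section MaskedDensity

variable {N m : ℕ} {s : Fin m → ℕ}

lemma lin_silentMask_lin_blockDiagonal_apply
    (B : (i : Fin m) → Matrix (Fin (s i)) (Fin (s i)) ℝ) (d : Fin m → Bool)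
    (y : EuclideanSpace ℝ (Coord s)) (i : Fin m) (a : Fin (s i)) :
    (lin (silentMask s d) (lin (Matrix.blockDiagonal' B) y)) ⟨i, a⟩
      = if d i then 0 else (B i *ᵥ fun b => y ⟨i, b⟩) a := by
  have h : (Matrix.blockDiagonal' B *ᵥ y.ofLp) ⟨i, a⟩ = (B i *ᵥ fun b => y ⟨i, b⟩) a := by
    simp only [Matrix.mulVec, dotProduct]
    rw [Fintype.sum_sigma, Finset.sum_eq_single i]
    · simp [Matrix.blockDiagonal'_apply_eq]
    · intro j _ hj
      exact Finset.sum_eq_zero fun b _ => by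
        rw [Matrix.blockDiagonal'_apply_ne _ _ _ hj.symm, zero_mul]
    · simp
  rw [lin_apply, lin_apply]
  simp only [silentMask, Matrix.mulVec_diagonal, h]
  split_ifs <;> simp

/-- The central identity. On a silent block the exponent -½ |B y|² equals -½ y'Yy; on a transmitting
block the argument is 0, so the density contributes only its normalizing constant. -/
lemma prod_gaussianPDFReal_mask {B Y : (i : Fin m) → Matrix (Fin (s i)) (Fin (s i)) ℝ}
    (hB : ∀ i, (B i)ᵀ * B i = Y i) (d : Fin m → Bool) (y : EuclideanSpace ℝ (Coord s)) :
    ∏ q, gaussianPDFReal 0 1 (-(lin (silentMask s d) (lin (Matrix.blockDiagonal' B) y)) q)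
      = ((√(2 * Real.pi))⁻¹) ^ Fintype.card (Coord s) *
        ∏ i, if d i then 1 else trigger (Y i) fun j => y ⟨i, j⟩ := by
  simp only [gaussianPDFReal_std, Finset.prod_mul_distrib, Finset.prod_const, Finset.card_univ,
    neg_sq]
  congr 1
  rw [Fintype.prod_sigma]
  refine Finset.prod_congr rfl fun i _ => ?_
  simp only [lin_silentMask_lin_blockDiagonal_apply]
  split_ifs with h
  · simp
  · rw [← Real.exp_sum, trigger, ← Finset.mul_sum]
    congr 2
    rw [← hB i, ← Matrix.mulVec_mulVec, ← transpose_mulVec_dotProduct, Matrix.transpose_transpose]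
    simp [dotProduct, sq]

lemma auxDensity_mask {B Y : (i : Fin m) → Matrix (Fin (s i)) (Fin (s i)) ℝ}
    (hB : ∀ i, (B i)ᵀ * B i = Y i) (d : Fin N → Fin m → Bool) :
    ∃ c : ℝ, c ≠ 0 ∧ ∀ y : Fin N → EuclideanSpace ℝ (Coord s),
      auxDensity (-fun j q => (lin (silentMask s (d j)) (lin (Matrix.blockDiagonal' B) (y j))) q)
        = c * ∏ j, ∏ i, if d j i then 1 else trigger (Y i) fun a => y j ⟨i, a⟩ := by
  refine ⟨∏ _j : Fin N, ((√(2 * Real.pi))⁻¹) ^ Fintype.card (Coord s), ?_, fun y => ?_⟩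
  · have : (0 : ℝ) < 2 * Real.pi := by positivity
    positivity
  · rw [← Finset.prod_mul_distrib]
    exact Finset.prod_congr rfl fun j _ => prod_gaussianPDFReal_mask hB (d j) (y j)

end MaskedDensity

/-! ### Independence and Gaussian laws on the product with the auxiliary noise -/

section ProductIndependence

/-- Rectangles form generating π-systems on which the measure multiplies. This separates past from
present sources when the model and the auxiliary noise are considered together. -/
lemma indep_prod {Ω H : Type*} {m₁ m₂ : MeasurableSpace Ω} {h₁ h₂ : MeasurableSpace H}
    [mΩ : MeasurableSpace Ω] [mH : MeasurableSpace H] {μ : Measure Ω} {ν : Measure H}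
    [IsProbabilityMeasure μ] [IsProbabilityMeasure ν]
    (hm₁ : m₁ ≤ mΩ) (hm₂ : m₂ ≤ mΩ) (hh₁ : h₁ ≤ mH) (hh₂ : h₂ ≤ mH)
    (hm : Indep m₁ m₂ μ) (hh : Indep h₁ h₂ ν) :
    Indep (m₁.prod h₁) (m₂.prod h₂) (μ.prod ν) := by
  have hle : ∀ {m' : MeasurableSpace Ω} {h' : MeasurableSpace H}, m' ≤ mΩ → h' ≤ mH →
      m'.prod h' ≤ mΩ.prod mH := fun h1 h2 =>
    sup_le_sup (MeasurableSpace.comap_mono h1) (MeasurableSpace.comap_mono h2)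
  refine IndepSets.indep (hle hm₁ hh₁) (hle hm₂ hh₂) (@isPiSystem_prod _ _ m₁ h₁)
    (@isPiSystem_prod _ _ m₂ h₂) (@generateFrom_prod _ _ m₁ h₁).symm
    (@generateFrom_prod _ _ m₂ h₂).symm ?_
  rw [IndepSets_iff]
  rintro _ _ ⟨a, ha, b, hb, rfl⟩ ⟨c, hc, d, hd, rfl⟩
  rw [Set.prod_inter_prod, Measure.prod_prod, Measure.prod_prod, Measure.prod_prod,
    (Indep_iff _ _ _).1 hm a c ha hc, (Indep_iff _ _ _).1 hh b d hb hd]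
  ring

variable {Ω H : Type*} [mΩ : MeasurableSpace Ω] [mH : MeasurableSpace H] {μ : Measure Ω}
  {ν : Measure H} [IsProbabilityMeasure μ] [IsProbabilityMeasure ν]

lemma IsCenteredGaussian.comp_fst {ι : Type*} [Fintype ι] [DecidableEq ι]
    {X : Ω → EuclideanSpace ℝ ι} {S : Matrix ι ι ℝ} (h : IsCenteredGaussian X S μ)
    (hX : Measurable X) : IsCenteredGaussian (fun x : Ω × H => X x.1) S (μ.prod ν) := by
  intro t
  have hmap : (μ.prod ν).map (fun x : Ω × H => X x.1) = μ.map X := by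
    have := Measure.map_map (μ := μ.prod ν) hX measurable_fst
    rw [Measure.map_fst_prod, measure_univ, one_smul] at this
    exact this.symm
  rw [← h t, hmap]

lemma IsCenteredGaussian.comp_snd {ι : Type*} [Fintype ι] [DecidableEq ι]
    {X : H → EuclideanSpace ℝ ι} {S : Matrix ι ι ℝ} (h : IsCenteredGaussian X S ν)
    (hX : Measurable X) : IsCenteredGaussian (fun x : Ω × H => X x.2) S (μ.prod ν) := by
  intro t
  have hmap : (μ.prod ν).map (fun x : Ω × H => X x.2) = ν.map X := by
    have := Measure.map_map (μ := μ.prod ν) hX measurable_snd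
    rw [Measure.map_snd_prod, measure_univ, one_smul] at this
    exact this.symm
  rw [← h t, hmap]

lemma isCenteredGaussian_of_hasLaw {ι : Type*} [Fintype ι] [DecidableEq ι]
    {X : Ω → EuclideanSpace ℝ ι} {S : Matrix ι ι ℝ} (hS : S.PosSemidef)
    (h : HasLaw X (multivariateGaussian 0 S) μ) : IsCenteredGaussian X S μ := by
  intro t
  rw [h.map_eq, charFun_multivariateGaussian hS]
  congr 1
  simp only [inner_zero_right, Complex.ofReal_zero, zero_mul, zero_sub]
  push_cast
  ring

end ProductIndependence

section AuxNoise

variable {N : ℕ} {ι : Type*} [Fintype ι] [DecidableEq ι]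

/-- The auxiliary standard Gaussian noise at time `j`. -/
noncomputable def auxNoise (j : ℕ) (z : Fin N → ι → ℝ) : EuclideanSpace ℝ ι :=
  if h : j < N then WithLp.toLp 2 (z ⟨j, h⟩) else 0

lemma measurable_auxNoise (j : ℕ) : Measurable (auxNoise (N := N) (ι := ι) j) := by
  unfold auxNoise
  split_ifs with h
  · exact (MeasurableEquiv.toLp 2 _).measurable.comp (measurable_pi_apply _)
  · exact measurable_const

lemma isCenteredGaussian_auxNoise {j : ℕ} (hj : j < N) :
    IsCenteredGaussian (auxNoise (N := N) (ι := ι) j) 1 (auxMeasure N ι) := by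
  intro t
  have h1 : auxNoise (N := N) (ι := ι) j = WithLp.toLp 2 ∘ fun z => z ⟨j, hj⟩ := by
    funext z
    simp [auxNoise, hj]
  have h2 : (auxMeasure N ι).map (auxNoise j) = stdGaussian (EuclideanSpace ℝ ι) := by
    have h3 := Measure.map_map (μ := auxMeasure N ι) (g := WithLp.toLp 2)
      (f := fun z : Fin N → ι → ℝ => z ⟨j, hj⟩) (by fun_prop) (measurable_pi_apply _)
    have h4 : (auxMeasure N ι).map (fun z : Fin N → ι → ℝ => z ⟨j, hj⟩)
        = Measure.pi fun _ => gaussianReal 0 1 :=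
      (measurePreserving_eval (fun _ : Fin N => Measure.pi fun _ : ι => gaussianReal 0 1)
        ⟨j, hj⟩).map_eq
    rw [h1, ← h3, h4, map_pi_eq_stdGaussian]
  rw [h2, charFun_stdGaussian, Matrix.one_mulVec]
  congr 1
  rw [← inner_eq_dotProduct, real_inner_self_eq_norm_sq]
  push_cast
  ring

/-- The σ-algebra of the auxiliary noise before time `k`. -/
@[reducible] def auxHistory (N : ℕ) (ι : Type*) (k : ℕ) : MeasurableSpace (Fin N → ι → ℝ) :=
  ⨆ j ∈ {j : Fin N | (j : ℕ) < k}, MeasurableSpace.comap (fun z : Fin N → ι → ℝ => z j) inferInstance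

/-- The σ-algebra of the auxiliary noise at time `k`. -/
@[reducible] def auxNow (N : ℕ) (ι : Type*) (k : ℕ) : MeasurableSpace (Fin N → ι → ℝ) :=
  ⨆ j ∈ {j : Fin N | (j : ℕ) = k}, MeasurableSpace.comap (fun z : Fin N → ι → ℝ => z j) inferInstance

lemma auxHistory_le (k : ℕ) : auxHistory N ι k ≤ MeasurableSpace.pi :=
  iSup₂_le fun j _ => (measurable_pi_apply j).comap_le

lemma auxNow_le (k : ℕ) : auxNow N ι k ≤ MeasurableSpace.pi :=
  iSup₂_le fun j _ => (measurable_pi_apply j).comap_le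

lemma indep_auxNow_auxHistory (k : ℕ) :
    Indep (auxNow N ι k) (auxHistory N ι k) (auxMeasure N ι) := by
  have h : iIndepFun (fun (j : Fin N) (z : Fin N → ι → ℝ) => z j) (auxMeasure N ι) :=
    iIndepFun_pi (X := fun _ => id) fun _ => aemeasurable_id
  refine indep_iSup_of_disjoint (fun j => (measurable_pi_apply j).comap_le) h.iIndep ?_
  rw [Set.disjoint_left]
  intro j (hj : (j : ℕ) = k) (hj' : (j : ℕ) < k)
  omega

lemma measurable_auxNoise_of_comap_le {m : MeasurableSpace (Fin N → ι → ℝ)} {j : ℕ}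
    (h : ∀ hj : j < N, MeasurableSpace.comap (fun z : Fin N → ι → ℝ => z ⟨j, hj⟩) inferInstance ≤ m) :
    Measurable[m] (auxNoise (N := N) (ι := ι) j) := by
  unfold auxNoise
  split_ifs with hj
  · exact (MeasurableEquiv.toLp 2 _).measurable.comp (measurable_iff_comap_le.2 (h hj))
  · exact measurable_const

lemma measurable_auxNoise_history {j k : ℕ} (hjk : j < k) :
    Measurable[auxHistory N ι k] (auxNoise (N := N) (ι := ι) j) :=
  measurable_auxNoise_of_comap_le fun hj =>
    le_iSup₂ (f := fun (j : Fin N) (_ : j ∈ {j : Fin N | (j : ℕ) < k}) =>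
      MeasurableSpace.comap (fun z : Fin N → ι → ℝ => z j) inferInstance) ⟨j, hj⟩ hjk

lemma measurable_auxNoise_now (k : ℕ) :
    Measurable[auxNow N ι k] (auxNoise (N := N) (ι := ι) k) :=
  measurable_auxNoise_of_comap_le fun hj =>
    le_iSup₂ (f := fun (j : Fin N) (_ : j ∈ {j : Fin N | (j : ℕ) = k}) =>
      MeasurableSpace.comap (fun z : Fin N → ι → ℝ => z j) inferInstance) ⟨k, hj⟩ rfl

end AuxNoise

/-! ### Past and present random sources -/

section History

variable {Ω : Type*} {n m : ℕ} {s : Fin m → ℕ}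

/-- The sources that act before time `k`. -/
def Source.before (m k : ℕ) : Set (Source m) :=
  {a | match a with
    | .init => True
    | .process j => j < k
    | .measurement j => j < k
    | .uniform j _ => j < k}

/-- The σ-algebra of all random sources acting before time `k`. -/
@[reducible] def history (x₀ : Ω → EuclideanSpace ℝ (Fin n))
    (w : ℕ → Ω → EuclideanSpace ℝ (Fin n)) (v : ℕ → Ω → EuclideanSpace ℝ (Coord s))
    (ζ : ℕ → Fin m → Ω → ℝ) (k : ℕ) : MeasurableSpace Ω :=
  ⨆ a ∈ Source.before m k, sourceSigma x₀ w v ζ a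

variable {A : Matrix (Fin n) (Fin n) ℝ} {C : Matrix (Coord s) (Fin n) ℝ}
  {Y : (i : Fin m) → Matrix (Fin (s i)) (Fin (s i)) ℝ}
  {x₀ : Ω → EuclideanSpace ℝ (Fin n)} {w : ℕ → Ω → EuclideanSpace ℝ (Fin n)}
  {v : ℕ → Ω → EuclideanSpace ℝ (Coord s)} {ζ : ℕ → Fin m → Ω → ℝ}

lemma measurable_sourceSigma_le {S : Set (Source m)} {a : Source m} (ha : a ∈ S) :
    sourceSigma x₀ w v ζ a ≤ ⨆ a ∈ S, sourceSigma x₀ w v ζ a :=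
  le_iSup₂ (f := fun a (_ : a ∈ S) => sourceSigma x₀ w v ζ a) a ha

lemma measurable_init_iSup {S : Set (Source m)} (h : .init ∈ S) :
    Measurable[⨆ a ∈ S, sourceSigma x₀ w v ζ a] x₀ :=
  measurable_iff_comap_le.2 (measurable_sourceSigma_le (x₀ := x₀) (w := w) (v := v) (ζ := ζ) h)

lemma measurable_process_iSup {S : Set (Source m)} {k : ℕ} (h : .process k ∈ S) :
    Measurable[⨆ a ∈ S, sourceSigma x₀ w v ζ a] (w k) :=
  measurable_iff_comap_le.2 (measurable_sourceSigma_le (x₀ := x₀) (w := w) (v := v) (ζ := ζ) h)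

lemma measurable_measurement_iSup {S : Set (Source m)} {k : ℕ} (h : .measurement k ∈ S) :
    Measurable[⨆ a ∈ S, sourceSigma x₀ w v ζ a] (v k) :=
  measurable_iff_comap_le.2 (measurable_sourceSigma_le (x₀ := x₀) (w := w) (v := v) (ζ := ζ) h)

lemma measurable_uniform_iSup {S : Set (Source m)} {k : ℕ} {i : Fin m} (h : .uniform k i ∈ S) :
    Measurable[⨆ a ∈ S, sourceSigma x₀ w v ζ a] (ζ k i) :=
  measurable_iff_comap_le.2 (measurable_sourceSigma_le (x₀ := x₀) (w := w) (v := v) (ζ := ζ) h)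

lemma state_succ (k : ℕ) (ω : Ω) :
    state A x₀ w (k + 1) ω = lin A (state A x₀ w k ω) + w k ω := rfl

lemma meas_eq (k : ℕ) (ω : Ω) :
    meas A C x₀ w v k ω = lin C (state A x₀ w k ω) + v k ω := rfl

lemma measurable_state_of {mS : MeasurableSpace Ω} (h0 : Measurable[mS] x₀) {k : ℕ}
    (hw : ∀ j < k, Measurable[mS] (w j)) : Measurable[mS] (state A x₀ w k) := by
  induction k with
  | zero => exact h0
  | succ k ih =>
    exact ((lin A).measurable.comp (ih fun j hj => hw j (by omega))).add (hw k (by omega))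

lemma measurable_meas_of {mS : MeasurableSpace Ω} (h0 : Measurable[mS] x₀) {k : ℕ}
    (hw : ∀ j < k, Measurable[mS] (w j)) (hv : Measurable[mS] (v k)) :
    Measurable[mS] (meas A C x₀ w v k) :=
  ((lin C).measurable.comp (measurable_state_of h0 hw)).add hv

lemma init_mem_before (k : ℕ) : (.init : Source m) ∈ Source.before m k := trivial

lemma measurable_state_history (k : ℕ) : Measurable[history x₀ w v ζ k] (state A x₀ w k) :=
  measurable_state_of (measurable_init_iSup (init_mem_before k)) fun _ hj => measurable_process_iSup hj

lemma measurable_meas_history {j k : ℕ} (hjk : j < k) :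
    Measurable[history x₀ w v ζ k] (meas A C x₀ w v j) :=
  measurable_meas_of (measurable_init_iSup (init_mem_before k))
    (fun _ hj => measurable_process_iSup (lt_trans hj hjk)) (measurable_measurement_iSup hjk)

variable [mΩ : MeasurableSpace Ω] {μ : Measure Ω} {Q Sigma₀ : Matrix (Fin n) (Fin n) ℝ}
  {R : Matrix (Coord s) (Coord s) ℝ}

lemma IsNoiseModel.sourceSigma_le (h : IsNoiseModel μ Q Sigma₀ R x₀ w v ζ) (a : Source m) :
    sourceSigma x₀ w v ζ a ≤ mΩ := by
  cases a with
  | init => exact h.measurable_init.comap_le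
  | process k => exact (h.measurable_process k).comap_le
  | measurement k => exact (h.measurable_measurement k).comap_le
  | uniform k i => exact (h.measurable_uniform k i).comap_le

lemma IsNoiseModel.iSup_sourceSigma_le (h : IsNoiseModel μ Q Sigma₀ R x₀ w v ζ)
    (S : Set (Source m)) : ⨆ a ∈ S, sourceSigma x₀ w v ζ a ≤ mΩ :=
  iSup₂_le fun a _ => h.sourceSigma_le a

lemma IsNoiseModel.indep_iSup (h : IsNoiseModel μ Q Sigma₀ R x₀ w v ζ)
    {S T : Set (Source m)} (hST : Disjoint S T) :
    Indep (⨆ a ∈ S, sourceSigma x₀ w v ζ a) (⨆ a ∈ T, sourceSigma x₀ w v ζ a) μ :=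
  indep_iSup_of_disjoint h.sourceSigma_le h.indep hST

lemma IsNoiseModel.measurable_state (h : IsNoiseModel μ Q Sigma₀ R x₀ w v ζ) (k : ℕ) :
    Measurable (state A x₀ w k) :=
  measurable_state_of h.measurable_init fun j _ => h.measurable_process j

lemma IsNoiseModel.measurable_meas (h : IsNoiseModel μ Q Sigma₀ R x₀ w v ζ) (k : ℕ) :
    Measurable (meas A C x₀ w v k) :=
  measurable_meas_of h.measurable_init (fun j _ => h.measurable_process j)
    (h.measurable_measurement k)

end History

/-! ### The Kalman filter with virtual observations -/

section Kalman

variable {Ω : Type*} {n m : ℕ} {s : Fin m → ℕ}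

/-- The Kalman predictor for the observation sequence `o`, with the gains given by the
transmission patterns `d`. -/
noncomputable def predictor (A Q Sigma₀ : Matrix (Fin n) (Fin n) ℝ)
    (C : Matrix (Coord s) (Fin n) ℝ) (R F : Matrix (Coord s) (Coord s) ℝ)
    (d : ℕ → Fin m → Bool) : ℕ → (ℕ → EuclideanSpace ℝ (Coord s)) → EuclideanSpace ℝ (Fin n)
  | 0, _ => 0
  | k + 1, o => lin A (predictor A Q Sigma₀ C R F d k o)
      + lin (kalmanGain A C (effNoise R F (d k)) (errCov A Q Sigma₀ C R F d k))
        (o k - lin C (predictor A Q Sigma₀ C R F d k o))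

variable {A Q Sigma₀ : Matrix (Fin n) (Fin n) ℝ} {C : Matrix (Coord s) (Fin n) ℝ}
  {R F : Matrix (Coord s) (Coord s) ℝ}

lemma predictor_congr {d d' : ℕ → Fin m → Bool} {o o' : ℕ → EuclideanSpace ℝ (Coord s)} {k : ℕ}
    (hd : ∀ j < k, d j = d' j) (ho : ∀ j < k, o j = o' j) :
    predictor A Q Sigma₀ C R F d k o = predictor A Q Sigma₀ C R F d' k o' := by
  induction k with
  | zero => rfl
  | succ k ih =>
    have hd' : ∀ j < k, d j = d' j := fun j hj => hd j (by omega)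
    rw [predictor, predictor, ih hd' fun j hj => ho j (by omega), hd k (by omega), ho k (by omega),
      errCov_congr hd']

lemma continuous_predictor (d : ℕ → Fin m → Bool) (k : ℕ) :
    Continuous (predictor A Q Sigma₀ C R F d k) := by
  induction k with
  | zero => exact continuous_const
  | succ k ih =>
    change Continuous fun o => lin A (predictor A Q Sigma₀ C R F d k o)
      + lin (kalmanGain A C (effNoise R F (d k)) (errCov A Q Sigma₀ C R F d k))
        (o k - lin C (predictor A Q Sigma₀ C R F d k o))
    fun_prop

/-- The virtual observations: the measurements, where those of the silent sensors are perturbed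
by the auxiliary noise. -/
noncomputable def virtualObs {N : ℕ} (A : Matrix (Fin n) (Fin n) ℝ) (C : Matrix (Coord s) (Fin n) ℝ)
    (F : Matrix (Coord s) (Coord s) ℝ) (d : ℕ → Fin m → Bool)
    (x₀ : Ω → EuclideanSpace ℝ (Fin n)) (w : ℕ → Ω → EuclideanSpace ℝ (Fin n))
    (v : ℕ → Ω → EuclideanSpace ℝ (Coord s)) (j : ℕ) (x : Ω × (Fin N → Coord s → ℝ)) :
    EuclideanSpace ℝ (Coord s) :=
  meas A C x₀ w v j x.1 + lin F (lin (silentMask s (d j)) (auxNoise j x.2))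

/-- The virtual observations and the unused auxiliary noise before time `k`. -/
noncomputable def virtualPast {N : ℕ} (A : Matrix (Fin n) (Fin n) ℝ)
    (C : Matrix (Coord s) (Fin n) ℝ)
    (F : Matrix (Coord s) (Coord s) ℝ) (d : ℕ → Fin m → Bool)
    (x₀ : Ω → EuclideanSpace ℝ (Fin n)) (w : ℕ → Ω → EuclideanSpace ℝ (Fin n))
    (v : ℕ → Ω → EuclideanSpace ℝ (Coord s)) (k : ℕ) (x : Ω × (Fin N → Coord s → ℝ)) (j : ℕ) :
    EuclideanSpace ℝ (Coord s) × EuclideanSpace ℝ (Coord s) :=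
  if j < k then (virtualObs A C F d x₀ w v j x, lin (1 - silentMask s (d j)) (auxNoise j x.2))
  else 0

variable [mΩ : MeasurableSpace Ω] {μ : Measure Ω} [IsProbabilityMeasure μ]
  {x₀ : Ω → EuclideanSpace ℝ (Fin n)} {w : ℕ → Ω → EuclideanSpace ℝ (Fin n)}
  {v : ℕ → Ω → EuclideanSpace ℝ (Coord s)} {ζ : ℕ → Fin m → Ω → ℝ}

lemma measurable_virtualObs_of {N : ℕ} {m₁ : MeasurableSpace Ω}
    {m₂ : MeasurableSpace (Fin N → Coord s → ℝ)} {d : ℕ → Fin m → Bool} {j : ℕ}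
    (h1 : Measurable[m₁] (meas A C x₀ w v j))
    (h2 : Measurable[m₂] (auxNoise (N := N) (ι := Coord s) j)) :
    Measurable[m₁.prod m₂] (virtualObs (N := N) A C F d x₀ w v j) :=
  (h1.comp measurable_fst).add
    ((lin F).measurable.comp ((lin (silentMask s (d j))).measurable.comp (h2.comp measurable_snd)))

lemma measurable_virtualPast_of {N : ℕ} {m₁ : MeasurableSpace Ω}
    {m₂ : MeasurableSpace (Fin N → Coord s → ℝ)} {d : ℕ → Fin m → Bool} {k : ℕ}
    (h1 : ∀ j < k, Measurable[m₁] (meas A C x₀ w v j))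
    (h2 : ∀ j < k, Measurable[m₂] (auxNoise (N := N) (ι := Coord s) j)) :
    Measurable[m₁.prod m₂] (virtualPast (N := N) A C F d x₀ w v k) := by
  refine measurable_pi_iff.2 fun j => ?_
  unfold virtualPast
  split_ifs with hj
  · exact (measurable_virtualObs_of (h1 j hj) (h2 j hj)).prodMk
      ((lin (1 - silentMask s (d j))).measurable.comp ((h2 j hj).comp measurable_snd))
  · exact measurable_const

/-- The predictor at time `k` is a function of the recorded past, which allows passing between
innovations and observations inside independence statements. -/
lemma predictor_virtualPast {N : ℕ} {d : ℕ → Fin m → Bool} (k : ℕ)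
    (x : Ω × (Fin N → Coord s → ℝ)) :
    predictor A Q Sigma₀ C R F d k (fun j => virtualObs A C F d x₀ w v j x)
      = predictor A Q Sigma₀ C R F d k fun j => (virtualPast A C F d x₀ w v k x j).1 :=
  predictor_congr (fun _ _ => rfl) fun j hj => by simp [virtualPast, hj]

/-- The error of the Kalman predictor is a centered Gaussian vector whose covariance is given by
the Riccati recursion, and it is independent of the virtual observations and of the unused
auxiliary noise. -/
theorem kalman_filter (hmodel : IsNoiseModel μ Q Sigma₀ R x₀ w v ζ)
    (hQ : Q.PosDef) (hR : R.PosDef) (hSigma₀ : Sigma₀.PosDef) {N : ℕ} (d : ℕ → Fin m → Bool)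
    {k : ℕ} (hk : k ≤ N) :
    IsCenteredGaussian (fun x : Ω × (Fin N → Coord s → ℝ) => state A x₀ w k x.1
        - predictor A Q Sigma₀ C R F d k fun j => virtualObs A C F d x₀ w v j x)
      (errCov A Q Sigma₀ C R F d k) (μ.prod (auxMeasure N (Coord s))) ∧
    IndepFun (fun x : Ω × (Fin N → Coord s → ℝ) => state A x₀ w k x.1
        - predictor A Q Sigma₀ C R F d k fun j => virtualObs A C F d x₀ w v j x)
      (virtualPast A C F d x₀ w v k) (μ.prod (auxMeasure N (Coord s))) := by
  induction k with
  | zero =>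
    constructor
    · have h := (isCenteredGaussian_of_hasLaw hSigma₀.posSemidef hmodel.law_init).comp_fst
        (ν := auxMeasure N (Coord s)) hmodel.measurable_init
      simpa [predictor, state, errCov] using h
    · have h : virtualPast (N := N) A C F d x₀ w v 0 = fun _ => 0 := by
        funext x j
        simp [virtualPast]
      rw [h]
      exact indepFun_const_right _ _
  | succ k ih =>
    obtain ⟨ihg, ihi⟩ := ih (by omega)
    set ν := auxMeasure N (Coord s) with hν
    set e : Ω × (Fin N → Coord s → ℝ) → EuclideanSpace ℝ (Fin n) := fun x => state A x₀ w k x.1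
        - predictor A Q Sigma₀ C R F d k fun j => virtualObs A C F d x₀ w v j x with he
    have hstate : Measurable[(history x₀ w v ζ k).prod (auxHistory N (Coord s) k)]
        (fun x : Ω × (Fin N → Coord s → ℝ) => state A x₀ w k x.1) :=
      (measurable_state_history k).comp measurable_fst
    have hpast : Measurable[(history x₀ w v ζ k).prod (auxHistory N (Coord s) k)]
        (virtualPast (N := N) A C F d x₀ w v k) :=
      measurable_virtualPast_of (fun j hj => measurable_meas_history hj)
        fun j hj => measurable_auxNoise_history hj
    -- Rewriting the predictor through the recorded past shows that the error uses only sources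
    -- before time `k`.
    have he_past : Measurable[(history x₀ w v ζ k).prod (auxHistory N (Coord s) k)] e := by
      have : e = fun x => state A x₀ w k x.1
          - predictor A Q Sigma₀ C R F d k fun j => (virtualPast A C F d x₀ w v k x j).1 := by
        funext x
        simp only [he, predictor_virtualPast]
      rw [this]
      exact hstate.sub ((continuous_predictor d k).measurable.comp
        ((measurable_pi_iff.2 fun j => measurable_fst.comp (measurable_pi_apply j)).comp hpast))
    have hle : (history x₀ w v ζ k).prod (auxHistory N (Coord s) k)
        ≤ mΩ.prod (MeasurableSpace.pi : MeasurableSpace (Fin N → Coord s → ℝ)) :=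
      sup_le_sup (MeasurableSpace.comap_mono (hmodel.iSup_sourceSigma_le _))
        (MeasurableSpace.comap_mono (auxHistory_le k))
    have hem : Measurable e := he_past.mono hle le_rfl
    have hZm : Measurable (virtualPast (N := N) A C F d x₀ w v k) := hpast.mono hle le_rfl
    have hw := hmodel.measurable_process k
    have hv := hmodel.measurable_measurement k
    have hξ := measurable_auxNoise (N := N) (ι := Coord s) k
    -- The fresh sources at time `k`; they are disjoint from those of the history, which gives the
    -- independence required for one step.
    set T : Set (Source m) := {.process k, .measurement k} with hT
    have hdisj : Disjoint T (Source.before m k) := by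
      rw [Set.disjoint_left]
      rintro a (rfl | rfl) (h : k < k) <;> omega
    have hnow : Measurable[(⨆ a ∈ T, sourceSigma x₀ w v ζ a).prod (auxNow N (Coord s) k)]
        (fun x : Ω × (Fin N → Coord s → ℝ) => (w k x.1, v k x.1, auxNoise k x.2)) :=
      ((measurable_process_iSup (by simp [hT])).comp measurable_fst).prodMk
        (((measurable_measurement_iSup (by simp [hT])).comp measurable_fst).prodMk
          ((measurable_auxNoise_now k).comp measurable_snd))
    have h1 : IndepFun (fun x : Ω × (Fin N → Coord s → ℝ) => (w k x.1, v k x.1, auxNoise k x.2))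
        (fun x => (e x, virtualPast A C F d x₀ w v k x)) (μ.prod ν) := by
      rw [IndepFun_iff_Indep]
      refine indep_of_indep_of_le_left (indep_of_indep_of_le_right
        (indep_prod (hmodel.iSup_sourceSigma_le T) (hmodel.iSup_sourceSigma_le _) (auxNow_le k)
          (auxHistory_le k) (hmodel.indep_iSup hdisj) (indep_auxNow_auxHistory k)) ?_) ?_
      · exact (he_past.prodMk hpast).comap_le
      · exact hnow.comap_le
    have hwv : IndepFun (w k) (v k) μ :=
      hmodel.indep.indep (i := .process k) (j := .measurement k) (by simp)
    have h2 : IndepFun (fun x : Ω × (Fin N → Coord s → ℝ) => w k x.1)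
        (fun x => (v k x.1, auxNoise k x.2)) (μ.prod ν) := by
      have hwv' : IndepFun (fun x : Ω × (Fin N → Coord s → ℝ) => w k x.1) (fun x => v k x.1)
          (μ.prod ν) := by
        rw [IndepFun_iff_Indep, Indep_iff]
        rintro _ _ ⟨a, ha, rfl⟩ ⟨b, hb, rfl⟩
        have h := (hwv.measure_inter_preimage_eq_mul a b ha hb)
        have hfst : ∀ S : Set Ω, (μ.prod ν) (Prod.fst ⁻¹' S) = μ S := fun S => by
          rw [← Set.prod_univ, Measure.prod_prod, measure_univ, mul_one]
        have e1 : (fun x : Ω × (Fin N → Coord s → ℝ) => w k x.1) ⁻¹' a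
            = Prod.fst ⁻¹' (w k ⁻¹' a) := rfl
        have e2 : (fun x : Ω × (Fin N → Coord s → ℝ) => v k x.1) ⁻¹' b
            = Prod.fst ⁻¹' (v k ⁻¹' b) := rfl
        rw [e1, e2, ← Set.preimage_inter, hfst, hfst, hfst, h]
      refine indepFun_prodMk_right (hw.comp measurable_fst) (hv.comp measurable_fst)
        (hξ.comp measurable_snd) hwv' ?_
      exact indepFun_prod (X := fun ω => (w k ω, v k ω)) (hw.prodMk hv) hξ
    have h3 : IndepFun (fun x : Ω × (Fin N → Coord s → ℝ) => v k x.1)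
        (fun x => auxNoise k x.2) (μ.prod ν) := indepFun_prod hv hξ
    obtain ⟨hg, hi⟩ := kalman_step (A := A) (C := C) (P := errCov A Q Sigma₀ C R F d k) (Q := Q)
      (R := R) (F := F) (D := silentMask s (d k)) (errCov_posSemidef hQ hR hSigma₀ d k)
      (effNoise_posDef hR (d k)) (silentMask_transpose _) (silentMask_mul_self _)
      hem (hw.comp measurable_fst) (hv.comp measurable_fst) (hξ.comp measurable_snd) hZm ihg
      ((isCenteredGaussian_of_hasLaw hQ.posSemidef (hmodel.law_process k)).comp_fst hw)
      ((isCenteredGaussian_of_hasLaw hR.posSemidef (hmodel.law_measurement k)).comp_fst hv)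
      ((isCenteredGaussian_auxNoise (by omega)).comp_snd hξ) h1 h2 h3 ihi
      (i := fun x => lin C (e x) + v k x.1 + lin F (lin (silentMask s (d k)) (auxNoise k x.2)))
      (fun _ => rfl)
      (e' := fun x => state A x₀ w (k + 1) x.1
        - predictor A Q Sigma₀ C R F d (k + 1) fun j => virtualObs A C F d x₀ w v j x)
      (fun x => by
        simp only [state_succ, predictor, virtualObs, meas_eq, he, map_sub, map_add, effNoise,
          Function.comp_apply]
        abel)
    refine ⟨hg, ?_⟩
    -- One step gives independence of the innovation and the old past. The new past is recovered
    -- from these measurably, by adding the predicted measurement to the innovation.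
    have hφ : Measurable fun q : (EuclideanSpace ℝ (Coord s) × EuclideanSpace ℝ (Coord s)) ×
        (ℕ → EuclideanSpace ℝ (Coord s) × EuclideanSpace ℝ (Coord s)) => fun j : ℕ =>
        if j = k then (q.1.1 + lin C (predictor A Q Sigma₀ C R F d k fun l => (q.2 l).1), q.1.2)
        else q.2 j := by
      refine measurable_pi_iff.2 fun j => ?_
      have := (continuous_predictor (A := A) (Q := Q) (Sigma₀ := Sigma₀) (C := C) (R := R) (F := F)
        d k).measurable
      split_ifs with hj <;> fun_prop
    have := hi.comp measurable_id hφ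
    convert! this using 1
    funext x j
    simp only [Function.comp_apply]
    rw [← predictor_virtualPast]
    by_cases hj : j = k
    · subst hj
      simp only [virtualPast, lt_add_iff_pos_right, zero_lt_one, if_true, he, map_sub]
      congr 1
      simp only [virtualObs, meas_eq]
      abel
    · have : j < k + 1 ↔ j < k := by omega
      simp [virtualPast, hj, this]

end Kalman

/-! ### Moments and growth bounds -/

section Moments

variable {Ω ι : Type*} [MeasurableSpace Ω] [Fintype ι] [DecidableEq ι] {μ : Measure Ω}
  [IsProbabilityMeasure μ]

lemma IsCenteredGaussian.map_eq {X : Ω → EuclideanSpace ℝ ι} {S : Matrix ι ι ℝ}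
    (hS : S.PosSemidef) (hX : Measurable X) (h : IsCenteredGaussian X S μ) :
    μ.map X = multivariateGaussian 0 S := by
  have : IsProbabilityMeasure (μ.map X) := Measure.isProbabilityMeasure_map hX.aemeasurable
  refine Measure.ext_of_charFun (funext fun t => ?_)
  rw [h t, charFun_multivariateGaussian hS]
  congr 1
  simp only [inner_zero_right, Complex.ofReal_zero, zero_mul, zero_sub]
  push_cast
  ring

lemma memLp_eval_multivariateGaussian (S : Matrix ι ι ℝ) (a : ι) :
    MemLp (fun x : EuclideanSpace ℝ ι => x a) 2 (multivariateGaussian 0 S) :=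
  (EuclideanSpace.proj a : EuclideanSpace ℝ ι →L[ℝ] ℝ).comp_memLp' IsGaussian.memLp_two_id

lemma integral_eval_multivariateGaussian (S : Matrix ι ι ℝ) (a : ι) :
    ∫ x : EuclideanSpace ℝ ι, x a ∂(multivariateGaussian 0 S) = 0 := by
  have h := (EuclideanSpace.proj a : EuclideanSpace ℝ ι →L[ℝ] ℝ).integral_comp_comm
    (IsGaussian.integrable_id (μ := multivariateGaussian 0 S))
  simp only [id, integral_id_multivariateGaussian] at h
  simpa using h

lemma integral_eval_mul_eval_multivariateGaussian {S : Matrix ι ι ℝ} (hS : S.PosSemidef)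
    (a b : ι) :
    ∫ x : EuclideanSpace ℝ ι, (x a * x b - S a b) ∂(multivariateGaussian 0 S) = 0 := by
  have h := covariance_eval_multivariateGaussian (μ := 0) hS a b
  rw [covariance_eq_sub (memLp_eval_multivariateGaussian S a)
    (memLp_eval_multivariateGaussian S b), integral_eval_multivariateGaussian, zero_mul,
    sub_zero] at h
  have hi : Integrable (fun x : EuclideanSpace ℝ ι => x a * x b) (multivariateGaussian 0 S) :=
    (memLp_eval_multivariateGaussian S a).integrable_mul (memLp_eval_multivariateGaussian S b)
  rw [integral_sub hi (integrable_const _), integral_const, probReal_univ, one_smul, sub_eq_zero]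
  exact h

end Moments

section AuxNoiseContinuity

variable {N : ℕ} {ι : Type*} [Fintype ι] [DecidableEq ι]

lemma auxNoise_add (j : ℕ) (y z : Fin N → ι → ℝ) :
    auxNoise j (y + z) = auxNoise j y + auxNoise j z := by
  unfold auxNoise
  split_ifs
  · rfl
  · simp

lemma auxNoise_zero (j : ℕ) : auxNoise j (0 : Fin N → ι → ℝ) = 0 := by
  unfold auxNoise
  split_ifs <;> rfl

lemma continuous_auxNoise (j : ℕ) : Continuous (auxNoise (N := N) (ι := ι) j) := by
  unfold auxNoise
  split_ifs with h
  · exact (PiLp.continuous_toLp 2 _).comp (continuous_apply _)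
  · exact continuous_const

end AuxNoiseContinuity

section SecondMoments

variable {Ω : Type*} {n m : ℕ} {s : Fin m → ℕ}
  {A Q Sigma₀ : Matrix (Fin n) (Fin n) ℝ} {C : Matrix (Coord s) (Fin n) ℝ}
  {R F : Matrix (Coord s) (Coord s) ℝ}
  [mΩ : MeasurableSpace Ω] {μ : Measure Ω} [IsProbabilityMeasure μ]
  {x₀ : Ω → EuclideanSpace ℝ (Fin n)} {w : ℕ → Ω → EuclideanSpace ℝ (Fin n)}
  {v : ℕ → Ω → EuclideanSpace ℝ (Coord s)} {ζ : ℕ → Fin m → Ω → ℝ}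

lemma memLp_two_of_hasLaw {ι : Type*} [Fintype ι] [DecidableEq ι] {X : Ω → EuclideanSpace ℝ ι}
    {S : Matrix ι ι ℝ} (hX : HasLaw X (multivariateGaussian 0 S) μ) : MemLp X 2 μ := by
  have h : MemLp id 2 (μ.map X) := by
    rw [hX.map_eq]
    exact IsGaussian.memLp_two_id
  exact (memLp_map_measure_iff aestronglyMeasurable_id hX.aemeasurable).1 h

lemma IsNoiseModel.memLp_state (h : IsNoiseModel μ Q Sigma₀ R x₀ w v ζ) (k : ℕ) :
    MemLp (state A x₀ w k) 2 μ := by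
  induction k with
  | zero => exact memLp_two_of_hasLaw h.law_init
  | succ k ih => exact ((lin A).comp_memLp' ih).add (memLp_two_of_hasLaw (h.law_process k))

lemma IsNoiseModel.memLp_meas (h : IsNoiseModel μ Q Sigma₀ R x₀ w v ζ) (k : ℕ) :
    MemLp (meas A C x₀ w v k) 2 μ :=
  ((lin C).comp_memLp' (h.memLp_state k)).add (memLp_two_of_hasLaw (h.law_measurement k))

/-- Linear growth in the observations makes quadratic functions of the error integrable and supplies
the dominating functions below. -/
lemma exists_norm_predictor_le (d : ℕ → Fin m → Bool) (k : ℕ) :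
    ∃ c : ℝ, 0 ≤ c ∧ ∀ o : ℕ → EuclideanSpace ℝ (Coord s),
      ‖predictor A Q Sigma₀ C R F d k o‖ ≤ c * ∑ j ∈ Finset.range k, ‖o j‖ := by
  induction k with
  | zero => exact ⟨0, le_rfl, fun o => by simp [predictor]⟩
  | succ k ih =>
    obtain ⟨c, hc, hb⟩ := ih
    set K := kalmanGain A C (effNoise R F (d k)) (errCov A Q Sigma₀ C R F d k)
    refine ⟨‖lin A‖ * c + ‖lin K‖ * (1 + ‖lin C‖ * c), by positivity, fun o => ?_⟩
    have h1 := hb o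
    set p := predictor A Q Sigma₀ C R F d k o
    have h2 : ‖predictor A Q Sigma₀ C R F d (k + 1) o‖
        ≤ ‖lin A‖ * ‖p‖ + ‖lin K‖ * (‖o k‖ + ‖lin C‖ * ‖p‖) := by
      refine (norm_add_le _ _).trans (add_le_add ((lin A).le_opNorm _) ?_)
      refine ((lin K).le_opNorm _).trans (mul_le_mul_of_nonneg_left ?_ (norm_nonneg _))
      exact (norm_sub_le _ _).trans (add_le_add le_rfl ((lin C).le_opNorm _))
    refine h2.trans ?_
    rw [Finset.sum_range_succ]
    set S := ∑ j ∈ Finset.range k, ‖o j‖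
    have hS : 0 ≤ S := Finset.sum_nonneg fun _ _ => norm_nonneg _
    have h3 : ‖p‖ ≤ c * (S + ‖o k‖) :=
      h1.trans (mul_le_mul_of_nonneg_left (by linarith [norm_nonneg (o k)]) hc)
    have h4 : ‖o k‖ ≤ S + ‖o k‖ := by linarith
    calc ‖lin A‖ * ‖p‖ + ‖lin K‖ * (‖o k‖ + ‖lin C‖ * ‖p‖)
        ≤ ‖lin A‖ * (c * (S + ‖o k‖)) + ‖lin K‖ * ((S + ‖o k‖) + ‖lin C‖ * (c * (S + ‖o k‖))) := by
          gcongr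
      _ = _ := by ring

end SecondMoments

/-! ### Moments of the error given silence -/

section Innovation

variable {Ω : Type*} {n m : ℕ} {s : Fin m → ℕ}
  {A Q Sigma₀ : Matrix (Fin n) (Fin n) ℝ} {C : Matrix (Coord s) (Fin n) ℝ}
  {R : Matrix (Coord s) (Coord s) ℝ}
  [mΩ : MeasurableSpace Ω] {μ : Measure Ω} [IsProbabilityMeasure μ]
  {x₀ : Ω → EuclideanSpace ℝ (Fin n)} {w : ℕ → Ω → EuclideanSpace ℝ (Fin n)}
  {v : ℕ → Ω → EuclideanSpace ℝ (Coord s)} {ζ : ℕ → Fin m → Ω → ℝ}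
  {B Y : (i : Fin m) → Matrix (Fin (s i)) (Fin (s i)) ℝ}

/-- The measurements, with those of the silent sensors replaced by zero. -/
noncomputable def maskedMeas (A : Matrix (Fin n) (Fin n) ℝ) (C : Matrix (Coord s) (Fin n) ℝ)
    (d : ℕ → Fin m → Bool)
    (x₀ : Ω → EuclideanSpace ℝ (Fin n)) (w : ℕ → Ω → EuclideanSpace ℝ (Fin n))
    (v : ℕ → Ω → EuclideanSpace ℝ (Coord s)) (j : ℕ) (ω : Ω) : EuclideanSpace ℝ (Coord s) :=
  lin (1 - silentMask s (d j)) (meas A C x₀ w v j ω)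

lemma IsNoiseModel.measurable_maskedMeas (h : IsNoiseModel μ Q Sigma₀ R x₀ w v ζ)
    (d : ℕ → Fin m → Bool) (j : ℕ) : Measurable (maskedMeas A C d x₀ w v j) := by
  have := h.measurable_meas (A := A) (C := C) j
  unfold maskedMeas
  fun_prop

lemma IsNoiseModel.memLp_maskedMeas (h : IsNoiseModel μ Q Sigma₀ R x₀ w v ζ)
    (d : ℕ → Fin m → Bool) (j : ℕ) : MemLp (maskedMeas A C d x₀ w v j) 2 μ := by
  have h1 := h.memLp_meas (A := A) (C := C) j
  have h2 := (lin (1 - silentMask s (d j)) : EuclideanSpace ℝ (Coord s) →L[ℝ]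
    EuclideanSpace ℝ (Coord s)).comp_memLp' h1
  exact h2

lemma silentMask_mul_inv_blockDiagonal (hu : IsUnit (Matrix.blockDiagonal' B).det)
    (d : Fin m → Bool) :
    silentMask s d * (Matrix.blockDiagonal' B)⁻¹ = (Matrix.blockDiagonal' B)⁻¹ * silentMask s d := by
  have h := silentMask_mul_blockDiagonal B d
  calc silentMask s d * (Matrix.blockDiagonal' B)⁻¹
      = (Matrix.blockDiagonal' B)⁻¹ * (Matrix.blockDiagonal' B * silentMask s d)
          * (Matrix.blockDiagonal' B)⁻¹ := by
        rw [← Matrix.mul_assoc, Matrix.nonsing_inv_mul _ hu, Matrix.one_mul]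
    _ = _ := by
        rw [← h, Matrix.mul_assoc, Matrix.mul_assoc, Matrix.mul_nonsing_inv _ hu, Matrix.mul_one]

/-- Separates quadratic growth in a sum into a product of a function of the sample point and a
function of the auxiliary value, as `integral_density_eq_zero` requires. -/
lemma sq_add_bound {K a b : ℝ} (hK : 0 ≤ K) :
    K * (1 + (a + b) ^ 2) ≤ 2 * K * (1 + a ^ 2) * (1 + b ^ 2) := by
  have : 1 + (a + b) ^ 2 ≤ 2 * (1 + a ^ 2) * (1 + b ^ 2) := by
    nlinarith [sq_nonneg (a - b), mul_nonneg (sq_nonneg a) (sq_nonneg b)]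
  nlinarith [mul_le_mul_of_nonneg_left this hK]

set_option maxHeartbeats 1000000 in
/-- Conditionally on the silence of the sensors that do not transmit in the pattern `d`, the
innovation of the Kalman predictor has the moments of a centered Gaussian vector. -/
theorem integral_innovation_eq_zero (hmodel : IsNoiseModel μ Q Sigma₀ R x₀ w v ζ)
    (hQ : Q.PosDef) (hR : R.PosDef) (hSigma₀ : Sigma₀.PosDef)
    (hB : ∀ i, (B i)ᵀ * B i = Y i) (hu : IsUnit (Matrix.blockDiagonal' B).det)
    (d : ℕ → Fin m → Bool) (N : ℕ) {f : EuclideanSpace ℝ (Fin n) → ℝ} (hf : Continuous f)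
    {K : ℝ} (hK : 0 ≤ K) (hfK : ∀ x, |f x| ≤ K * (1 + ‖x‖ ^ 2))
    (hf0 : ∫ x, f x ∂(multivariateGaussian 0
      (errCov A Q Sigma₀ C R (Matrix.blockDiagonal' B)⁻¹ d N)) = 0)
    {H : (Fin N → EuclideanSpace ℝ (Coord s)) → ℝ} (hH : Measurable H)
    {b : ℝ} (hHb : ∀ y, |H y| ≤ b) :
    ∫ ω, f (state A x₀ w N ω - predictor A Q Sigma₀ C R (Matrix.blockDiagonal' B)⁻¹ d N
          fun j => maskedMeas A C d x₀ w v j ω)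
        * H (fun j => maskedMeas A C d x₀ w v j ω)
        * ∏ j : Fin N, ∏ i, (if d j i then 1 else
            trigger (Y i) fun a => meas A C x₀ w v j ω ⟨i, a⟩) ∂μ = 0 := by
  set BB := Matrix.blockDiagonal' B with hBB
  set F := BB⁻¹ with hF
  set pred := predictor A Q Sigma₀ C R F d N with hpred
  have hpredc : Continuous pred := continuous_predictor d N
  have hFD : ∀ j, silentMask s (d j) * F = F * silentMask s (d j) := fun j =>
    silentMask_mul_inv_blockDiagonal hu (d j)
  have hBD : ∀ j, silentMask s (d j) * BB = BB * silentMask s (d j) := fun j =>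
    silentMask_mul_blockDiagonal B (d j)
  have hDD : ∀ j, silentMask s (d j) * silentMask s (d j) = silentMask s (d j) := fun j =>
    silentMask_mul_self (d j)
  have lDD : ∀ j y, lin (silentMask s (d j)) (lin (silentMask s (d j)) y)
      = lin (silentMask s (d j)) y := fun j y => by rw [← lin_mul, hDD]
  have lDB : ∀ j y, lin (silentMask s (d j)) (lin BB y)
      = lin BB (lin (silentMask s (d j)) y) := fun j y => by rw [← lin_mul, hBD, lin_mul]
  have hFB : F * BB = 1 := Matrix.nonsing_inv_mul _ hu
  have hBF : BB * F = 1 := Matrix.mul_nonsing_inv _ hu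
  obtain ⟨c, hc, hcb⟩ := exists_norm_predictor_le (A := A) (Q := Q) (Sigma₀ := Sigma₀) (C := C)
    (R := R) (F := F) d N
  have hb0 : 0 ≤ b := (abs_nonneg _).trans (hHb 0)
  -- `z` stands for the value of the masked By + ξ. Inserting `Yc + η` reproduces the virtual
  -- observations, while z = 0 leaves the masked measurements, with zeros for the silent sensors.
  set u : Ω → (Fin N → Coord s → ℝ) → ℝ := fun ω z =>
    f (state A x₀ w N ω - pred fun j => maskedMeas A C d x₀ w v j ω
      + lin F (lin (silentMask s (d j)) (auxNoise j z)))
      * H (fun j => maskedMeas A C d x₀ w v j ω) with hu_def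
  set Yc : Ω → (Fin N → Coord s → ℝ) := fun ω j q =>
    (lin (silentMask s (d j)) (lin BB (meas A C x₀ w v j ω))) q with hYc
  have hshift : ∀ (ω : Ω) (η : Fin N → Coord s → ℝ) (j : ℕ), j < N →
      maskedMeas A C d x₀ w v j ω + lin F (lin (silentMask s (d j)) (auxNoise j (Yc ω + η)))
        = virtualObs A C F d x₀ w v j (ω, η) := by
    intro ω η j hj
    have h1 : auxNoise j (Yc ω) = lin (silentMask s (d j)) (lin BB (meas A C x₀ w v j ω)) := by
      simp [auxNoise, hj, hYc]
    rw [auxNoise_add, h1, map_add, map_add, virtualObs, maskedMeas, lin_sub, lin_one, lDD,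
      lDB, ← lin_mul F, hFB, lin_one]
    simp only
    abel
  have hmask : ∀ (x : Ω × (Fin N → Coord s → ℝ)) (j : ℕ),
      lin (1 - silentMask s (d j)) (virtualObs A C F d x₀ w v j x)
        = maskedMeas A C d x₀ w v j x.1 := by
    intro x j
    have h : (1 - silentMask s (d j)) * (F * silentMask s (d j)) = 0 := by
      rw [← hFD, ← Matrix.mul_assoc, Matrix.sub_mul, Matrix.one_mul, hDD, sub_self,
        Matrix.zero_mul]
    rw [virtualObs, map_add, ← lin_mul F, ← lin_mul, h, maskedMeas]
    simp [lin_apply]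
  have haux : ∀ (x : Ω × (Fin N → Coord s → ℝ)) (j : Fin N),
      (Yc x.1 + x.2) j = (lin (silentMask s (d j)) (lin BB (virtualObs A C F d x₀ w v j x))
        + lin (1 - silentMask s (d j)) (auxNoise j x.2)).ofLp := by
    intro x j
    have h : lin (silentMask s (d j)) (lin BB (virtualObs A C F d x₀ w v j x))
        = lin (silentMask s (d j)) (lin BB (meas A C x₀ w v j x.1))
          + lin (silentMask s (d j)) (auxNoise j x.2) := by
      rw [virtualObs, map_add, map_add, ← lin_mul BB, hBF, lin_one, lDD]
    rw [h, add_assoc, ← lin_add, add_sub_cancel, lin_one]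
    funext q
    simp [hYc, auxNoise]
  have hYm : Measurable Yc := by
    refine measurable_pi_iff.2 fun j => ?_
    exact (MeasurableEquiv.toLp 2 (Coord s → ℝ)).symm.measurable.comp
      ((lin (silentMask s (d j))).measurable.comp ((lin BB).measurable.comp (hmodel.measurable_meas j)))
  have hHm : Measurable fun ω => H fun j : Fin N => maskedMeas A C d x₀ w v j ω :=
    hH.comp (measurable_pi_iff.2 fun j => hmodel.measurable_maskedMeas d j)
  have hum : Measurable fun x : Ω × (Fin N → Coord s → ℝ) => u x.1 x.2 := by
    refine Measurable.mul (hf.measurable.comp (((hmodel.measurable_state N).comp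
      measurable_fst).sub (hpredc.measurable.comp (measurable_pi_iff.2 fun j => ?_))))
      (hHm.comp measurable_fst)
    exact ((hmodel.measurable_maskedMeas d j).comp measurable_fst).add
      ((lin F).measurable.comp ((lin (silentMask s (d j))).measurable.comp ((measurable_auxNoise j).comp
        measurable_snd)))
  have huc : ∀ ω, Continuous (u ω) := by
    intro ω
    refine (hf.comp (continuous_const.sub (hpredc.comp (continuous_pi fun j => ?_)))).mul
      continuous_const
    exact continuous_const.add ((lin F).continuous.comp ((lin (silentMask s (d j))).continuous.comp
      (continuous_auxNoise j)))
  set α : Ω → ℝ := fun ω => ‖state A x₀ w N ω‖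
    + c * ∑ j ∈ Finset.range N, ‖maskedMeas A C d x₀ w v j ω‖ with hα
  set β : (Fin N → Coord s → ℝ) → ℝ := fun z =>
    c * ∑ j ∈ Finset.range N, ‖lin F (lin (silentMask s (d j)) (auxNoise j z))‖ with hβ
  have hαL : MemLp α 2 μ := by
    refine (hmodel.memLp_state N).norm.add (MemLp.const_mul ?_ c)
    exact memLp_finsetSum _ fun j _ => (hmodel.memLp_maskedMeas d j).norm
  have hU : Integrable (fun ω => b * (2 * K * (1 + α ω ^ 2))) μ :=
    (((integrable_const (1 : ℝ)).add hαL.integrable_sq).const_mul _).const_mul _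
  have hβc : Continuous fun z => 1 + β z ^ 2 := by
    refine continuous_const.add (Continuous.pow (continuous_const.mul ?_) 2)
    exact continuous_finsetSum _ fun j _ => ((lin F).continuous.comp ((lin (silentMask s (d j))).continuous.comp
      (continuous_auxNoise j))).norm
  have hbound : ∀ ω z, |u ω z| ≤ b * (2 * K * (1 + α ω ^ 2)) * (1 + β z ^ 2) := by
    intro ω z
    have h1 : ‖state A x₀ w N ω - pred fun j => maskedMeas A C d x₀ w v j ω
        + lin F (lin (silentMask s (d j)) (auxNoise j z))‖ ≤ α ω + β z := by
      refine (norm_sub_le _ _).trans ?_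
      have h2 := hcb fun j => maskedMeas A C d x₀ w v j ω
        + lin F (lin (silentMask s (d j)) (auxNoise j z))
      have h3 : ∑ j ∈ Finset.range N, ‖maskedMeas A C d x₀ w v j ω
          + lin F (lin (silentMask s (d j)) (auxNoise j z))‖
          ≤ ∑ j ∈ Finset.range N, ‖maskedMeas A C d x₀ w v j ω‖
            + ∑ j ∈ Finset.range N, ‖lin F (lin (silentMask s (d j)) (auxNoise j z))‖ := by
        rw [← Finset.sum_add_distrib]
        exact Finset.sum_le_sum fun j _ => norm_add_le _ _
      have h4 := mul_le_mul_of_nonneg_left h3 hc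
      rw [mul_add] at h4
      simp only [hα, hβ]
      linarith
    have h2 : |f (state A x₀ w N ω - pred fun j => maskedMeas A C d x₀ w v j ω
        + lin F (lin (silentMask s (d j)) (auxNoise j z)))|
        ≤ 2 * K * (1 + α ω ^ 2) * (1 + β z ^ 2) := by
      refine (hfK _).trans (le_trans ?_ (sq_add_bound hK))
      gcongr
    simp only [hu_def, abs_mul]
    calc _ ≤ 2 * K * (1 + α ω ^ 2) * (1 + β z ^ 2) * b :=
          mul_le_mul h2 (hHb _) (abs_nonneg _) (by positivity)
      _ = _ := by ring
  obtain ⟨hg, hi⟩ := kalman_filter (A := A) (C := C) (F := F) hmodel hQ hR hSigma₀ d (le_refl N)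
  set e : Ω × (Fin N → Coord s → ℝ) → EuclideanSpace ℝ (Fin n) := fun x => state A x₀ w N x.1
        - predictor A Q Sigma₀ C R F d N fun j => virtualObs A C F d x₀ w v j x with he
  have hobs : ∀ j, Measurable (virtualObs (N := N) A C F d x₀ w v j) := fun j =>
    measurable_virtualObs_of (hmodel.measurable_meas j) (measurable_auxNoise j)
  have hem : Measurable e := ((hmodel.measurable_state N).comp measurable_fst).sub
    (hpredc.measurable.comp (measurable_pi_iff.2 hobs))
  have hpm : Measurable (virtualPast (N := N) A C F d x₀ w v N) :=
    measurable_virtualPast_of (fun j _ => hmodel.measurable_meas j)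
      fun j _ => measurable_auxNoise j
  have hfe : ∫ x, f (e x) ∂(μ.prod (auxMeasure N (Coord s))) = 0 := by
    rw [← integral_map hem.aemeasurable hf.aestronglyMeasurable,
      hg.map_eq (errCov_posSemidef hQ hR hSigma₀ d N) hem, hf0]
  -- At z = Yc + η both `H` and the test function become functions of the virtual past, which is
  -- independent of the error; the mean of `f` of the error is zero.
  have hzero : ∀ h : (Fin N → Coord s → ℝ) → ℝ, Continuous h → HasCompactSupport h →
      ∫ x : Ω × (Fin N → Coord s → ℝ), u x.1 (Yc x.1 + x.2) * h (Yc x.1 + x.2)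
        ∂(μ.prod (auxMeasure N (Coord s))) = 0 := by
    intro h hh _
    -- The shifted noise `Yc + η` equals D B o + (1 - D) η with `o` the virtual observation. This is
    -- why the unused noise is kept in the past.
    set Ψ : (ℕ → EuclideanSpace ℝ (Coord s) × EuclideanSpace ℝ (Coord s)) → ℝ := fun π =>
      H (fun j => lin (1 - silentMask s (d j)) (π j).1) *
        h (fun j => (lin (silentMask s (d j)) (lin BB (π j).1) + (π j).2).ofLp) with hΨ
    have hΨm : Measurable Ψ := by
      refine (hH.comp (measurable_pi_iff.2 fun j => ?_)).mul
        (hh.measurable.comp (measurable_pi_iff.2 fun j => ?_))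
      · fun_prop
      · fun_prop
    have hprod := hi.integral_fun_comp_mul_comp (𝕜 := ℝ) (f := f) (g := Ψ) hem.aemeasurable
      hpm.aemeasurable hf.aestronglyMeasurable hΨm.aestronglyMeasurable
    rw [hfe, zero_mul] at hprod
    rw [← hprod]
    refine integral_congr_ae (Eventually.of_forall fun x => ?_)
    have e1 : (pred fun j => maskedMeas A C d x₀ w v j x.1
        + lin F (lin (silentMask s (d j)) (auxNoise j (Yc x.1 + x.2))))
        = pred fun j => virtualObs A C F d x₀ w v j x :=
      predictor_congr (fun _ _ => rfl) fun j hj => hshift x.1 x.2 j hj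
    have e2 : (fun j : Fin N => maskedMeas A C d x₀ w v j x.1)
        = fun j : Fin N => lin (1 - silentMask s (d j)) (virtualPast A C F d x₀ w v N x j).1 := by
      funext j
      simp [virtualPast, hmask]
    have e3 : Yc x.1 + x.2 = fun j : Fin N => (lin (silentMask s (d j))
        (lin BB (virtualPast A C F d x₀ w v N x j).1)
          + (virtualPast A C F d x₀ w v N x j).2).ofLp := by
      funext j
      rw [haux]
      simp [virtualPast]
    simp only [hu_def, hΨ, he, ← e2, ← e3, mul_assoc]
    rw [e1]
  -- The density at `-Yc` is, up to a nonzero constant, the product of the silence probabilities.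
  obtain ⟨c', hc', hdens⟩ := auxDensity_mask (N := N) hB fun j => d j
  have hmain := integral_density_eq_zero (μ := μ) continuous_auxDensity auxDensity_nonneg
    auxDensity_le_one auxMeasure_eq_withDensity hum huc hU hβc hbound hYm hzero
  have hmain' : c' * ∫ ω, u ω 0 * ∏ j : Fin N, ∏ i, (if d j i then 1 else
      trigger (Y i) fun a => meas A C x₀ w v j ω ⟨i, a⟩) ∂μ = 0 := by
    rw [← hmain, ← integral_const_mul]
    refine integral_congr_ae (Eventually.of_forall fun ω => ?_)
    have h1 := hdens fun j => meas A C x₀ w v j ω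
    simp only [hYc]
    rw [h1]
    ring
  have := (mul_eq_zero.1 hmain').resolve_left hc'
  rw [← this]
  refine integral_congr_ae (Eventually.of_forall fun ω => ?_)
  simp only [hu_def, auxNoise_zero, map_zero, add_zero]

end Innovation

/-! ### Integrating out the trigger variables -/

section Uniform

lemma trigger_pos {r : ℕ} (Y : Matrix (Fin r) (Fin r) ℝ) (α : Fin r → ℝ) : 0 < trigger Y α :=
  Real.exp_pos _

lemma trigger_le_one {r : ℕ} {Y : Matrix (Fin r) (Fin r) ℝ} (hY : Y.PosSemidef)
    (α : Fin r → ℝ) : trigger Y α ≤ 1 := by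
  refine Real.exp_le_one_iff.2 ?_
  have := hY.dotProduct_mulVec_nonneg α
  simp only [star_trivial] at this
  linarith

lemma measurable_trigger {r : ℕ} (Y : Matrix (Fin r) (Fin r) ℝ) : Measurable (trigger Y) := by
  unfold trigger
  refine Continuous.measurable ?_
  fun_prop

lemma integral_uniform_decide {t : ℝ} (h0 : 0 ≤ t) (h1 : t ≤ 1) (b : Bool) :
    ∫ z, (if decide (¬ z ≤ t) = b then (1 : ℝ) else 0) ∂(volume.restrict (Set.Icc (0 : ℝ) 1))
      = if b then 1 - t else t := by
  cases b with
  | true =>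
    have h : (fun z : ℝ => if decide (¬ z ≤ t) = true then (1 : ℝ) else 0)
        = (Set.Ioi t).indicator fun _ => 1 := by
      funext z
      simp [Set.indicator]
    rw [h, integral_indicator measurableSet_Ioi, Measure.restrict_restrict measurableSet_Ioi]
    have h2 : Set.Ioi t ∩ Set.Icc 0 1 = Set.Ioc t 1 := by
      ext z
      simp only [Set.mem_inter_iff, Set.mem_Ioi, Set.mem_Icc, Set.mem_Ioc]
      constructor
      · rintro ⟨a, _, c⟩; exact ⟨a, c⟩
      · rintro ⟨a, c⟩; exact ⟨a, by linarith, c⟩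
    rw [h2]
    simp [h1]
  | false =>
    have h : (fun z : ℝ => if decide (¬ z ≤ t) = false then (1 : ℝ) else 0)
        = (Set.Iic t).indicator fun _ => 1 := by
      funext z
      simp [Set.indicator]
    rw [h, integral_indicator measurableSet_Iic, Measure.restrict_restrict measurableSet_Iic]
    have h2 : Set.Iic t ∩ Set.Icc 0 1 = Set.Icc 0 t := by
      ext z
      simp only [Set.mem_inter_iff, Set.mem_Iic, Set.mem_Icc]
      constructor
      · rintro ⟨a, b, _⟩; exact ⟨b, a⟩
      · rintro ⟨a, c⟩; exact ⟨c, a, by linarith⟩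
    rw [h2]
    simp [h0]

end Uniform

section Masking

variable {Ω : Type*} {n m : ℕ} {s : Fin m → ℕ}
  {A : Matrix (Fin n) (Fin n) ℝ} {C : Matrix (Coord s) (Fin n) ℝ}
  {x₀ : Ω → EuclideanSpace ℝ (Fin n)} {w : ℕ → Ω → EuclideanSpace ℝ (Fin n)}
  {v : ℕ → Ω → EuclideanSpace ℝ (Coord s)}

lemma maskedMeas_of_transmit {d : ℕ → Fin m → Bool} {j : ℕ} {i : Fin m} (h : d j i = true) (ω : Ω)
    (a : Fin (s i)) :
    (maskedMeas A C d x₀ w v j ω) ⟨i, a⟩ = meas A C x₀ w v j ω ⟨i, a⟩ := by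
  rw [maskedMeas, lin_sub, lin_one, lin_apply, silentMask]
  simp [Matrix.mulVec_diagonal, h]

lemma maskedMeas_of_silent {d : ℕ → Fin m → Bool} {j : ℕ} {i : Fin m} (h : d j i = false) (ω : Ω)
    (a : Fin (s i)) :
    (maskedMeas A C d x₀ w v j ω) ⟨i, a⟩ = 0 := by
  rw [maskedMeas, lin_sub, lin_one, lin_apply, silentMask]
  simp [Matrix.mulVec_diagonal, h]

end Masking

/-! ### Restriction to the event of a transmission pattern -/

section Conditioning

variable {Ω : Type*} {n m : ℕ} {s : Fin m → ℕ}
  {A Q Sigma₀ : Matrix (Fin n) (Fin n) ℝ} {C : Matrix (Coord s) (Fin n) ℝ}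
  {R : Matrix (Coord s) (Coord s) ℝ}
  [mΩ : MeasurableSpace Ω] {μ : Measure Ω} [IsProbabilityMeasure μ]
  {x₀ : Ω → EuclideanSpace ℝ (Fin n)} {w : ℕ → Ω → EuclideanSpace ℝ (Fin n)}
  {v : ℕ → Ω → EuclideanSpace ℝ (Coord s)} {ζ : ℕ → Fin m → Ω → ℝ}
  {B Y : (i : Fin m) → Matrix (Fin (s i)) (Fin (s i)) ℝ}

lemma IsNoiseModel.map_uniform (h : IsNoiseModel μ Q Sigma₀ R x₀ w v ζ) (N : ℕ) :
    μ.map (fun ω (q : Fin N × Fin m) => ζ q.1 q.2 ω)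
      = Measure.pi fun _ => volume.restrict (Set.Icc (0 : ℝ) 1) := by
  have hinj : Function.Injective fun q : Fin N × Fin m => (Source.uniform q.1 q.2 : Source m) := by
    rintro ⟨j, i⟩ ⟨j', i'⟩ hq
    simp only [Source.uniform.injEq] at hq
    exact Prod.ext (Fin.ext hq.1) hq.2
  have h1 := h.indep.precomp hinj
  have h2 : iIndepFun (fun (q : Fin N × Fin m) ω => ζ q.1 q.2 ω) μ := h1
  rw [iIndepFun_iff_map_fun_eq_pi_map fun q => (h.measurable_uniform _ _).aemeasurable] at h2
  rw [h2]
  congr 1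
  funext q
  exact (h.law_uniform q.1 q.2).map_eq

/-- States and measurements use no uniform source, so the sources split into two disjoint groups. -/
lemma IsNoiseModel.indepFun_uniform (h : IsNoiseModel μ Q Sigma₀ R x₀ w v ζ) (N : ℕ) :
    IndepFun (fun ω => (state A x₀ w N ω, fun j : Fin N => meas A C x₀ w v j ω))
      (fun ω (q : Fin N × Fin m) => ζ q.1 q.2 ω) μ := by
  set S : Set (Source m) := {a | ∀ k i, a ≠ .uniform k i} with hS
  set T : Set (Source m) := {a | ∃ k i, a = .uniform k i} with hT
  have hdisj : Disjoint S T := by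
    rw [Set.disjoint_left]
    rintro a ha ⟨k, i, rfl⟩
    exact ha k i rfl
  have h0 : Measurable[⨆ a ∈ S, sourceSigma x₀ w v ζ a] x₀ := measurable_init_iSup (by simp [hS])
  have hw : ∀ j, Measurable[⨆ a ∈ S, sourceSigma x₀ w v ζ a] (w j) := fun j =>
    measurable_process_iSup (by simp [hS])
  have hv : ∀ j, Measurable[⨆ a ∈ S, sourceSigma x₀ w v ζ a] (v j) := fun j =>
    measurable_measurement_iSup (by simp [hS])
  have hζ : ∀ j i, Measurable[⨆ a ∈ T, sourceSigma x₀ w v ζ a] (ζ j i) := fun j i =>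
    measurable_uniform_iSup ⟨j, i, rfl⟩
  rw [IndepFun_iff_Indep]
  refine indep_of_indep_of_le_left (indep_of_indep_of_le_right (h.indep_iSup hdisj) ?_) ?_
  · exact (@measurable_pi_lambda Ω _ _ (⨆ a ∈ T, sourceSigma x₀ w v ζ a) _ _
      fun q : Fin N × Fin m => hζ q.1 q.2).comap_le
  · exact ((measurable_state_of h0 fun j _ => hw j).prodMk
      (@measurable_pi_lambda Ω _ _ (⨆ a ∈ S, sourceSigma x₀ w v ζ a) _ _ fun j : Fin N =>
      measurable_meas_of h0 (fun j _ => hw j) (hv j))).comap_le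

/-- Integrating out the uniform variables of the trigger. -/
lemma integral_mul_pattern (hmodel : IsNoiseModel μ Q Sigma₀ R x₀ w v ζ)
    (hY : ∀ i, (Y i).PosSemidef) {N : ℕ} (d : Fin N → Fin m → Bool)
    {X : EuclideanSpace ℝ (Fin n) × (Fin N → EuclideanSpace ℝ (Coord s)) → ℝ}
    (hX : Measurable X)
    (hXi : Integrable (fun ω => X (state A x₀ w N ω, fun j : Fin N => meas A C x₀ w v j ω)) μ) :
    ∫ ω, X (state A x₀ w N ω, fun j : Fin N => meas A C x₀ w v j ω) *
        (if (fun j : Fin N => pattern A C Y x₀ w v ζ ω j) = d then 1 else 0) ∂μ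
      = ∫ ω, X (state A x₀ w N ω, fun j : Fin N => meas A C x₀ w v j ω) *
        ∏ j : Fin N, ∏ i, (if d j i then 1 - trigger (Y i) fun a => meas A C x₀ w v j ω ⟨i, a⟩
          else trigger (Y i) fun a => meas A C x₀ w v j ω ⟨i, a⟩) ∂μ := by
  set V : Ω → EuclideanSpace ℝ (Fin n) × (Fin N → EuclideanSpace ℝ (Coord s)) := fun ω =>
    (state A x₀ w N ω, fun j : Fin N => meas A C x₀ w v j ω) with hV
  set Z : Ω → (Fin N × Fin m → ℝ) := fun ω q => ζ q.1 q.2 ω with hZ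
  set lam : Measure (Fin N × Fin m → ℝ) :=
    Measure.pi fun _ => volume.restrict (Set.Icc (0 : ℝ) 1) with hlam
  have hVm : Measurable V := (hmodel.measurable_state N).prodMk
    (measurable_pi_iff.2 fun j => hmodel.measurable_meas j)
  have hZm : Measurable Z := measurable_pi_iff.2 fun q => hmodel.measurable_uniform _ _
  have hind : IndepFun V Z μ := hmodel.indepFun_uniform N
  have hmap : μ.map (fun ω => (V ω, Z ω)) = (μ.map V).prod lam := by
    rw [(indepFun_iff_map_prod_eq_prod_map_map hVm.aemeasurable hZm.aemeasurable).1 hind,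
      hmodel.map_uniform N]
  have : IsProbabilityMeasure (μ.map V) := Measure.isProbabilityMeasure_map hVm.aemeasurable
  have : IsProbabilityMeasure (volume.restrict (Set.Icc (0 : ℝ) 1)) := ⟨by simp⟩
  set t : EuclideanSpace ℝ (Fin n) × (Fin N → EuclideanSpace ℝ (Coord s)) → Fin N × Fin m → ℝ :=
    fun x q => trigger (Y q.2) fun a => x.2 q.1 ⟨q.2, a⟩ with ht
  have htm : ∀ q, Measurable fun x => t x q := fun q =>
    (measurable_trigger _).comp (measurable_pi_iff.2 fun a => by fun_prop)
  -- The pattern indicator is a product over times and sensors, so for fixed states and measurements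
  -- its integral over the uniform variables factors.
  set g : (EuclideanSpace ℝ (Fin n) × (Fin N → EuclideanSpace ℝ (Coord s))) ×
      (Fin N × Fin m → ℝ) → ℝ := fun x => X x.1 *
    ∏ q, (if decide (¬ x.2 q ≤ t x.1 q) = d q.1 q.2 then 1 else 0) with hg
  have hPm : Measurable fun x : (EuclideanSpace ℝ (Fin n) × (Fin N → EuclideanSpace ℝ (Coord s))) ×
      (Fin N × Fin m → ℝ) =>
      ∏ q, (if decide (¬ x.2 q ≤ t x.1 q) = d q.1 q.2 then (1 : ℝ) else 0) := by
    refine Finset.measurable_prod _ fun q _ => Measurable.ite ?_ measurable_const measurable_const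
    have h1 : MeasurableSet {x : (EuclideanSpace ℝ (Fin n) ×
        (Fin N → EuclideanSpace ℝ (Coord s))) × (Fin N × Fin m → ℝ) | x.2 q ≤ t x.1 q} :=
      measurableSet_le ((measurable_pi_apply q).comp measurable_snd) ((htm q).comp measurable_fst)
    cases hd : d q.1 q.2
    · simpa using h1
    · have := h1.compl
      simpa [Set.compl_ofPred] using this
  have hgm : Measurable g := (hX.comp measurable_fst).mul hPm
  have hXi' : Integrable X (μ.map V) :=
    (integrable_map_measure hX.aestronglyMeasurable hVm.aemeasurable).2 hXi
  have hgi : Integrable g ((μ.map V).prod lam) := by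
    refine (hXi'.comp_fst lam).mono hgm.aestronglyMeasurable (Eventually.of_forall fun x => ?_)
    rw [hg, norm_mul]
    refine mul_le_of_le_one_right (norm_nonneg _) ?_
    rw [Real.norm_eq_abs, abs_of_nonneg (Finset.prod_nonneg fun q _ => by split_ifs <;> simp)]
    exact Finset.prod_le_one (fun q _ => by split_ifs <;> simp) fun q _ => by split_ifs <;> simp
  have hinner : ∀ x, ∫ z, g (x, z) ∂lam = X x * ∏ j : Fin N, ∏ i,
      (if d j i then 1 - t x (j, i) else t x (j, i)) := by
    intro x
    simp only [hg]
    rw [integral_const_mul, hlam, integral_fintype_prod_eq_prod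
      (f := fun q z => if decide (¬ z ≤ t x q) = d q.1 q.2 then (1 : ℝ) else 0),
      ← Finset.prod_product', Finset.univ_product_univ]
    congr 1
    exact Finset.prod_congr rfl fun q _ =>
      integral_uniform_decide (trigger_pos _ _).le (trigger_le_one (hY _) _) _
  have hpat : ∀ ω, X (V ω) * (if (fun j : Fin N => pattern A C Y x₀ w v ζ ω j) = d then 1 else 0)
      = g (V ω, Z ω) := by
    intro ω
    simp only [hg]
    congr 1
    rw [Fintype.prod_ite_zero]
    refine if_congr ?_ (by simp) rfl
    simp only [funext_iff, Prod.forall]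
    rfl
  calc _ = ∫ ω, g (V ω, Z ω) ∂μ := integral_congr_ae (Eventually.of_forall hpat)
    _ = ∫ x, g x ∂(μ.map fun ω => (V ω, Z ω)) :=
        (integral_map (hVm.prodMk hZm).aemeasurable hgm.aestronglyMeasurable).symm
    _ = ∫ x, ∫ z, g (x, z) ∂lam ∂(μ.map V) := by rw [hmap, integral_prod _ hgi]
    _ = ∫ x, X x * ∏ j : Fin N, ∏ i,
          (if d j i then 1 - t x (j, i) else t x (j, i)) ∂(μ.map V) := by simp_rw [hinner]
    _ = _ := by
        rw [integral_map hVm.aemeasurable]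
        refine (hX.mul (Finset.measurable_prod _ fun j _ => Finset.measurable_prod _ fun i _ => ?_)
          ).aestronglyMeasurable
        have := htm (j, i)
        split_ifs <;> fun_prop

lemma memLp_predictor_maskedMeas (hmodel : IsNoiseModel μ Q Sigma₀ R x₀ w v ζ)
    (F : Matrix (Coord s) (Coord s) ℝ) (d : ℕ → Fin m → Bool) (N : ℕ) :
    MemLp (fun ω => predictor A Q Sigma₀ C R F d N fun j => maskedMeas A C d x₀ w v j ω) 2 μ := by
  obtain ⟨c, hc, hb⟩ := exists_norm_predictor_le (A := A) (Q := Q) (Sigma₀ := Sigma₀) (C := C)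
    (R := R) (F := F) d N
  have h : MemLp (fun ω => c * ∑ j ∈ Finset.range N, ‖maskedMeas A C d x₀ w v j ω‖) 2 μ :=
    MemLp.const_mul (f := fun ω => ∑ j ∈ Finset.range N, ‖maskedMeas A C d x₀ w v j ω‖)
      (memLp_finsetSum _ fun j _ => (hmodel.memLp_maskedMeas d j).norm) c
  have hm : Measurable fun ω (j : ℕ) => maskedMeas A C d x₀ w v j ω :=
    measurable_pi_iff.2 fun j => hmodel.measurable_maskedMeas d j
  have hp := (continuous_predictor (A := A) (Q := Q) (Sigma₀ := Sigma₀) (C := C) (R := R)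
    (F := F) d N).measurable.comp hm
  exact h.mono' hp.aestronglyMeasurable
    (Eventually.of_forall fun ω => hb fun j => maskedMeas A C d x₀ w v j ω)

/-- On the event of a transmission pattern, the innovation of the Kalman predictor has the moments
of a centered Gaussian vector, and is uncorrelated with functions of the transmitted
measurements. -/
theorem integral_innovation_mul_pattern (hmodel : IsNoiseModel μ Q Sigma₀ R x₀ w v ζ)
    (hQ : Q.PosDef) (hR : R.PosDef) (hSigma₀ : Sigma₀.PosDef) (hY : ∀ i, (Y i).PosDef)
    (hB : ∀ i, (B i)ᵀ * B i = Y i) (hu : IsUnit (Matrix.blockDiagonal' B).det)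
    (d : ℕ → Fin m → Bool) (N : ℕ) {f : EuclideanSpace ℝ (Fin n) → ℝ} (hf : Continuous f)
    {K : ℝ} (hK : 0 ≤ K) (hfK : ∀ x, |f x| ≤ K * (1 + ‖x‖ ^ 2))
    (hf0 : ∫ x, f x ∂(multivariateGaussian 0
      (errCov A Q Sigma₀ C R (Matrix.blockDiagonal' B)⁻¹ d N)) = 0)
    {H : (Fin N → EuclideanSpace ℝ (Coord s)) → ℝ} (hH : Measurable H)
    {b : ℝ} (hHb : ∀ y, |H y| ≤ b) :
    ∫ ω, f (state A x₀ w N ω - predictor A Q Sigma₀ C R (Matrix.blockDiagonal' B)⁻¹ d N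
          fun j => maskedMeas A C d x₀ w v j ω)
        * H (fun j => maskedMeas A C d x₀ w v j ω)
        * (if (fun j : Fin N => pattern A C Y x₀ w v ζ ω j) = fun j : Fin N => d j
            then 1 else 0) ∂μ = 0 := by
  set F := (Matrix.blockDiagonal' B)⁻¹ with hF
  -- The factors 1 - φ of the transmitting sensors depend only on transmitted measurements. They can
  -- be absorbed into the bounded test function `H`, leaving precisely the silence probabilities.
  set G : (Fin N → EuclideanSpace ℝ (Coord s)) → ℝ := fun y => ∏ j : Fin N, ∏ i,
    (if d j i then 1 - trigger (Y i) fun a => y j ⟨i, a⟩ else 1) with hG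
  have htm : ∀ (j : Fin N) (i : Fin m), Measurable fun y : Fin N → EuclideanSpace ℝ (Coord s) =>
      trigger (Y i) fun a => y j ⟨i, a⟩ := fun j i =>
    (measurable_trigger _).comp (measurable_pi_iff.2 fun a => by fun_prop)
  have hGm : Measurable G := Finset.measurable_prod _ fun j _ => Finset.measurable_prod _ fun i _ => by
    have := htm j i
    split_ifs <;> fun_prop
  have hG1 : ∀ y, |G y| ≤ 1 := by
    intro y
    have h0 : ∀ (j : Fin N) (i : Fin m),
        0 ≤ (if d j i then 1 - trigger (Y i) fun a => y j ⟨i, a⟩ else 1) := fun j i => by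
      split_ifs
      · linarith [trigger_le_one (hY i).posSemidef fun a => y j ⟨i, a⟩]
      · simp
    have h1 : ∀ (j : Fin N) (i : Fin m),
        (if d j i then 1 - trigger (Y i) fun a => y j ⟨i, a⟩ else 1) ≤ 1 := fun j i => by
      split_ifs
      · linarith [trigger_pos (Y i) fun a => y j ⟨i, a⟩]
      · simp
    rw [abs_of_nonneg (Finset.prod_nonneg fun j _ => Finset.prod_nonneg fun i _ => h0 j i)]
    exact Finset.prod_le_one (fun j _ => Finset.prod_nonneg fun i _ => h0 j i)
      fun j _ => Finset.prod_le_one (fun i _ => h0 j i) fun i _ => h1 j i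
  have hb : 0 ≤ b := (abs_nonneg _).trans (hHb 0)
  have hmain := integral_innovation_eq_zero hmodel hQ hR hSigma₀ hB hu (A := A) (C := C) d N hf hK
    hfK hf0 (hH.mul hGm) (b := b * 1) fun y => by
      simp only [Pi.mul_apply]
      rw [abs_mul]
      exact mul_le_mul (hHb y) (hG1 y) (abs_nonneg _) hb
  -- The default 0 is immaterial: the predictor at time `N` reads only the observations before `N`.
  set X : EuclideanSpace ℝ (Fin n) × (Fin N → EuclideanSpace ℝ (Coord s)) → ℝ := fun x =>
    f (x.1 - predictor A Q Sigma₀ C R F d N fun j =>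
      if h : j < N then lin (1 - silentMask s (d j)) (x.2 ⟨j, h⟩) else 0)
      * H (fun j => lin (1 - silentMask s (d j)) (x.2 j)) with hXdef
  have hpredm := (continuous_predictor (A := A) (Q := Q) (Sigma₀ := Sigma₀) (C := C) (R := R)
    (F := F) d N).measurable
  have hXm : Measurable X := by
    refine (hf.measurable.comp (measurable_fst.sub (hpredm.comp
      (measurable_pi_iff.2 fun j => ?_)))).mul (hH.comp (measurable_pi_iff.2 fun j => ?_))
    · split_ifs <;> fun_prop
    · fun_prop
  have hXV : ∀ ω, X (state A x₀ w N ω, fun j : Fin N => meas A C x₀ w v j ω)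
      = f (state A x₀ w N ω - predictor A Q Sigma₀ C R F d N
          fun j => maskedMeas A C d x₀ w v j ω)
        * H (fun j => maskedMeas A C d x₀ w v j ω) := by
    intro ω
    have h1 : (predictor A Q Sigma₀ C R F d N fun j =>
        if h : j < N then lin (1 - silentMask s (d j)) (meas A C x₀ w v (⟨j, h⟩ : Fin N) ω) else 0)
        = predictor A Q Sigma₀ C R F d N fun j => maskedMeas A C d x₀ w v j ω :=
      predictor_congr (fun _ _ => rfl) fun j hj => by simp [hj, maskedMeas]
    simp only [hXdef]
    rw [h1]
    rfl
  have hXi : Integrable (fun ω => X (state A x₀ w N ω, fun j : Fin N => meas A C x₀ w v j ω))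
      μ := by
    have hL : MemLp (fun ω => state A x₀ w N ω - predictor A Q Sigma₀ C R F d N
          fun j => maskedMeas A C d x₀ w v j ω) 2 μ :=
      (hmodel.memLp_state N).sub (memLp_predictor_maskedMeas hmodel F d N)
    have hI : Integrable (fun ω => K * (1 + ‖state A x₀ w N ω - predictor A Q Sigma₀ C R F d N
          fun j => maskedMeas A C d x₀ w v j ω‖ ^ 2) * b) μ :=
      (((integrable_const (1 : ℝ)).add hL.norm.integrable_sq).const_mul K).mul_const b
    refine hI.mono' (hXm.comp ((hmodel.measurable_state N).prodMk
      (measurable_pi_iff.2 fun j => hmodel.measurable_meas j))).aestronglyMeasurable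
      (Eventually.of_forall fun ω => ?_)
    rw [hXV, Real.norm_eq_abs, abs_mul]
    exact mul_le_mul (hfK _) (hHb _) (abs_nonneg _) (by positivity)
  have hZ := integral_mul_pattern hmodel (fun i => (hY i).posSemidef) (A := A) (C := C)
    (fun j : Fin N => d j) hXm hXi
  simp only [hXV] at hZ
  rw [hZ, ← hmain]
  refine integral_congr_ae (Eventually.of_forall fun ω => ?_)
  simp only [Pi.mul_apply, hG, mul_assoc]
  congr 2
  rw [← Finset.prod_mul_distrib]
  refine Finset.prod_congr rfl fun j _ => ?_
  rw [← Finset.prod_mul_distrib]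
  refine Finset.prod_congr rfl fun i _ => ?_
  by_cases h : d j i = true
  · simp only [h, if_true, mul_one, maskedMeas_of_transmit h]
  · simp [h]

end Conditioning

/-! ### Identification of the conditional expectations -/

section Information

variable {Ω : Type*} {n m : ℕ} {s : Fin m → ℕ}
  {A Q Sigma₀ : Matrix (Fin n) (Fin n) ℝ} {C : Matrix (Coord s) (Fin n) ℝ}
  {R F : Matrix (Coord s) (Coord s) ℝ}
  {x₀ : Ω → EuclideanSpace ℝ (Fin n)} {w : ℕ → Ω → EuclideanSpace ℝ (Fin n)}
  {v : ℕ → Ω → EuclideanSpace ℝ (Coord s)} {ζ : ℕ → Fin m → Ω → ℝ}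
  {B Y : (i : Fin m) → Matrix (Fin (s i)) (Fin (s i)) ℝ}

/-- The extension of a finite sequence of transmission patterns by silence. -/
def extendPattern {N : ℕ} (d : Fin N → Fin m → Bool) (j : ℕ) : Fin m → Bool :=
  if h : j < N then d ⟨j, h⟩ else fun _ => false

lemma extendPattern_coe {N : ℕ} (d : Fin N → Fin m → Bool) (j : Fin N) :
    extendPattern d j = d j := by
  simp [extendPattern]

lemma extendPattern_of_lt {N : ℕ} (γ : ℕ → Fin m → Bool) {j : ℕ} (hj : j < N) :
    extendPattern (fun j : Fin N => γ j) j = γ j := by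
  simp [extendPattern, hj]

/-- The received measurements as a vector of the Euclidean space. -/
noncomputable def receivedVec (A : Matrix (Fin n) (Fin n) ℝ) (C : Matrix (Coord s) (Fin n) ℝ)
    (Y : (i : Fin m) → Matrix (Fin (s i)) (Fin (s i)) ℝ)
    (x₀ : Ω → EuclideanSpace ℝ (Fin n)) (w : ℕ → Ω → EuclideanSpace ℝ (Fin n))
    (v : ℕ → Ω → EuclideanSpace ℝ (Coord s)) (ζ : ℕ → Fin m → Ω → ℝ)
    (k : ℕ) (ω : Ω) : EuclideanSpace ℝ (Coord s) :=
  WithLp.toLp 2 (received A C Y x₀ w v ζ k ω)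

lemma decision_eq (k : ℕ) (i : Fin m) (ω : Ω) :
    decision A C Y x₀ w v ζ k i ω = if pattern A C Y x₀ w v ζ ω k i then 1 else 0 := by
  by_cases h : ζ k i ω ≤ trigger (Y i) (fun j => meas A C x₀ w v k ω ⟨i, j⟩) <;>
    simp [decision, pattern, h]

lemma receivedVec_eq {d : ℕ → Fin m → Bool} {k : ℕ} {ω : Ω}
    (h : pattern A C Y x₀ w v ζ ω k = d k) :
    receivedVec A C Y x₀ w v ζ k ω = maskedMeas A C d x₀ w v k ω := by
  ext ⟨i, a⟩
  have h1 : (receivedVec A C Y x₀ w v ζ k ω) ⟨i, a⟩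
      = (if d k i then 1 else 0) * meas A C x₀ w v k ω ⟨i, a⟩ := by
    rw [← h, ← decision_eq]
    rfl
  rw [h1]
  by_cases hd : d k i = true
  · rw [maskedMeas_of_transmit hd]
    simp [hd]
  · rw [maskedMeas_of_silent (by simpa using hd)]
    simp [hd]

/-- The Kalman predictor along the actual transmission pattern. -/
noncomputable def estimate (A Q Sigma₀ : Matrix (Fin n) (Fin n) ℝ)
    (C : Matrix (Coord s) (Fin n) ℝ) (R F : Matrix (Coord s) (Coord s) ℝ)
    (Y : (i : Fin m) → Matrix (Fin (s i)) (Fin (s i)) ℝ)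
    (x₀ : Ω → EuclideanSpace ℝ (Fin n)) (w : ℕ → Ω → EuclideanSpace ℝ (Fin n))
    (v : ℕ → Ω → EuclideanSpace ℝ (Coord s)) (ζ : ℕ → Fin m → Ω → ℝ)
    (k : ℕ) (ω : Ω) : EuclideanSpace ℝ (Fin n) :=
  predictor A Q Sigma₀ C R F (pattern A C Y x₀ w v ζ ω) k
    fun j => receivedVec A C Y x₀ w v ζ j ω

lemma estimate_eq {N : ℕ} {d : Fin N → Fin m → Bool} {ω : Ω}
    (h : (fun j : Fin N => pattern A C Y x₀ w v ζ ω j) = d) :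
    estimate A Q Sigma₀ C R F Y x₀ w v ζ N ω
      = predictor A Q Sigma₀ C R F (extendPattern d) N
        fun j => maskedMeas A C (extendPattern d) x₀ w v j ω := by
  subst h
  refine predictor_congr (fun j hj => (extendPattern_of_lt _ hj).symm) fun j hj => ?_
  exact receivedVec_eq (extendPattern_of_lt _ hj).symm

lemma measurable_decision_info {j N : ℕ} (hj : j < N) :
    Measurable[infoBefore A C Y x₀ w v ζ N] fun ω i => decision A C Y x₀ w v ζ j i ω :=
  measurable_iff_comap_le.2 (le_trans le_sup_left
    (le_iSup₂ (f := fun j (_ : j ∈ Finset.range N) =>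
      (MeasurableSpace.comap (fun ω i => decision A C Y x₀ w v ζ j i ω) MeasurableSpace.pi ⊔
        MeasurableSpace.comap (fun ω p => received A C Y x₀ w v ζ j ω p) MeasurableSpace.pi))
      j (Finset.mem_range.2 hj)))

lemma measurable_received_info {j N : ℕ} (hj : j < N) :
    Measurable[infoBefore A C Y x₀ w v ζ N] fun ω p => received A C Y x₀ w v ζ j ω p :=
  measurable_iff_comap_le.2 (le_trans le_sup_right
    (le_iSup₂ (f := fun j (_ : j ∈ Finset.range N) =>
      (MeasurableSpace.comap (fun ω i => decision A C Y x₀ w v ζ j i ω) MeasurableSpace.pi ⊔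
        MeasurableSpace.comap (fun ω p => received A C Y x₀ w v ζ j ω p) MeasurableSpace.pi))
      j (Finset.mem_range.2 hj)))

lemma measurable_pattern_info (N : ℕ) :
    Measurable[infoBefore A C Y x₀ w v ζ N] fun ω (j : Fin N) => pattern A C Y x₀ w v ζ ω j := by
  refine @measurable_pi_lambda _ _ _ (_) _ _ fun j => @measurable_pi_lambda _ _ _ (_) _ _ fun i => ?_
  have h1 : Measurable[infoBefore A C Y x₀ w v ζ N] fun ω => decision A C Y x₀ w v ζ j i ω :=
    (measurable_pi_apply i).comp (measurable_decision_info j.2)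
  have h2 : (fun ω => pattern A C Y x₀ w v ζ ω j i)
      = (fun r : ℝ => decide (r = 1)) ∘ fun ω => decision A C Y x₀ w v ζ j i ω := by
    funext ω
    simp only [Function.comp_apply, decision_eq]
    cases pattern A C Y x₀ w v ζ ω j i <;> simp
  rw [h2]
  refine Measurable.comp ?_ h1
  refine measurable_to_bool ?_
  have : (fun r : ℝ => decide (r = 1)) ⁻¹' {true} = {1} := by
    ext r
    simp
  rw [this]
  exact measurableSet_singleton 1

/-- Only finitely many patterns of length `N` exist, so joint measurability reduces to continuity of
the predictor for each of them. -/
lemma measurable_estimate_info (N : ℕ) :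
    Measurable[infoBefore A C Y x₀ w v ζ N] (estimate A Q Sigma₀ C R F Y x₀ w v ζ N) := by
  have h1 : Measurable fun x : (Fin N → Fin m → Bool) × (ℕ → EuclideanSpace ℝ (Coord s)) =>
      predictor A Q Sigma₀ C R F (extendPattern x.1) N x.2 :=
    measurable_from_prod_countable_right fun d =>
      (continuous_predictor (extendPattern d) N).measurable
  have h2 : Measurable[infoBefore A C Y x₀ w v ζ N] fun ω (j : ℕ) =>
      if j < N then receivedVec A C Y x₀ w v ζ j ω else 0 := by
    refine @measurable_pi_lambda _ _ _ (_) _ _ fun j => ?_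
    split_ifs with hj
    · exact (MeasurableEquiv.toLp 2 _).measurable.comp (measurable_received_info hj)
    · exact measurable_const
  have h3 : estimate A Q Sigma₀ C R F Y x₀ w v ζ N
      = (fun x : (Fin N → Fin m → Bool) × (ℕ → EuclideanSpace ℝ (Coord s)) =>
        predictor A Q Sigma₀ C R F (extendPattern x.1) N x.2) ∘ fun ω =>
          (fun j : Fin N => pattern A C Y x₀ w v ζ ω j,
            fun j : ℕ => if j < N then receivedVec A C Y x₀ w v ζ j ω else 0) := by
    funext ω
    exact predictor_congr (fun j hj => (extendPattern_of_lt _ hj).symm) fun j hj => by simp [hj]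
  rw [h3]
  exact h1.comp ((measurable_pattern_info N).prodMk h2)

/-- The information is contained in the σ-algebra of one random vector, so an event in it becomes a
condition on the received data. -/
lemma exists_preimage_of_info {N : ℕ} {S : Set Ω}
    (hS : MeasurableSet[infoBefore A C Y x₀ w v ζ N] S) :
    ∃ T : Set (Fin N → (Fin m → ℝ) × (Coord s → ℝ)), MeasurableSet T ∧
      (fun ω (j : Fin N) => ((fun i => decision A C Y x₀ w v ζ j i ω),
        (fun p => received A C Y x₀ w v ζ j ω p))) ⁻¹' T = S := by
  set J : Ω → Fin N → (Fin m → ℝ) × (Coord s → ℝ) := fun ω j =>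
    ((fun i => decision A C Y x₀ w v ζ j i ω), (fun p => received A C Y x₀ w v ζ j ω p)) with hJ
  have hle : infoBefore A C Y x₀ w v ζ N ≤ MeasurableSpace.comap J MeasurableSpace.pi := by
    have hJm : Measurable[MeasurableSpace.comap J MeasurableSpace.pi] J := comap_measurable J
    refine iSup₂_le fun j hj => sup_le ?_ ?_
    · exact (measurable_fst.comp
        ((measurable_pi_apply (⟨j, Finset.mem_range.1 hj⟩ : Fin N)).comp hJm)).comap_le
    · exact (measurable_snd.comp
        ((measurable_pi_apply (⟨j, Finset.mem_range.1 hj⟩ : Fin N)).comp hJm)).comap_le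
  exact hle S hS

variable [mΩ : MeasurableSpace Ω] {μ : Measure Ω} [IsProbabilityMeasure μ]

lemma IsNoiseModel.measurable_decision (h : IsNoiseModel μ Q Sigma₀ R x₀ w v ζ)
    (k : ℕ) (i : Fin m) : Measurable (decision A C Y x₀ w v ζ k i) := by
  refine Measurable.ite (measurableSet_le (h.measurable_uniform k i) ?_) measurable_const
    measurable_const
  refine (measurable_trigger _).comp (measurable_pi_iff.2 fun a => ?_)
  have := h.measurable_meas (A := A) (C := C) k
  fun_prop

lemma IsNoiseModel.infoBefore_le (h : IsNoiseModel μ Q Sigma₀ R x₀ w v ζ) (N : ℕ) :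
    infoBefore A C Y x₀ w v ζ N ≤ mΩ := by
  refine iSup₂_le fun j _ => sup_le ?_ ?_
  · exact (measurable_pi_iff.2 fun i => h.measurable_decision j i).comap_le
  · refine (measurable_pi_iff.2 fun p => ?_).comap_le
    refine (h.measurable_decision j p.1).mul ?_
    have := h.measurable_meas (A := A) (C := C) j
    fun_prop

lemma IsNoiseModel.memLp_estimate (h : IsNoiseModel μ Q Sigma₀ R x₀ w v ζ) (N : ℕ) :
    MemLp (estimate A Q Sigma₀ C R F Y x₀ w v ζ N) 2 μ := by
  -- The random pattern is handled by summing over all patterns.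
  have h1 : MemLp (fun ω => ∑ d : Fin N → Fin m → Bool,
      ‖predictor A Q Sigma₀ C R F (extendPattern d) N
        fun j => maskedMeas A C (extendPattern d) x₀ w v j ω‖) 2 μ :=
    memLp_finsetSum _ fun d _ => (memLp_predictor_maskedMeas h F (extendPattern d) N).norm
  have h2 : Measurable (estimate A Q Sigma₀ C R F Y x₀ w v ζ N) :=
    (measurable_estimate_info N).mono (h.infoBefore_le N) le_rfl
  refine h1.mono' h2.aestronglyMeasurable (Eventually.of_forall fun ω => ?_)
  rw [estimate_eq rfl]
  exact Finset.single_le_sum (f := fun d : Fin N → Fin m → Bool =>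
    ‖predictor A Q Sigma₀ C R F (extendPattern d) N
        fun j => maskedMeas A C (extendPattern d) x₀ w v j ω‖) (fun _ _ => norm_nonneg _)
    (Finset.mem_univ _)

lemma integrable_innovation (hmodel : IsNoiseModel μ Q Sigma₀ R x₀ w v ζ)
    (d : ℕ → Fin m → Bool) (N : ℕ) {f : EuclideanSpace ℝ (Fin n) → ℝ} (hf : Continuous f)
    {K : ℝ} (hfK : ∀ x, |f x| ≤ K * (1 + ‖x‖ ^ 2)) :
    Integrable (fun ω => f (state A x₀ w N ω - predictor A Q Sigma₀ C R F d N
          fun j => maskedMeas A C d x₀ w v j ω)) μ := by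
  have hL : MemLp (fun ω => state A x₀ w N ω - predictor A Q Sigma₀ C R F d N
        fun j => maskedMeas A C d x₀ w v j ω) 2 μ :=
    (hmodel.memLp_state N).sub (memLp_predictor_maskedMeas hmodel F d N)
  have hI : Integrable (fun ω => K * (1 + ‖state A x₀ w N ω - predictor A Q Sigma₀ C R F d N
        fun j => maskedMeas A C d x₀ w v j ω‖ ^ 2)) μ :=
    ((integrable_const (1 : ℝ)).add hL.norm.integrable_sq).const_mul K
  exact hI.mono' (hf.comp_aestronglyMeasurable hL.aestronglyMeasurable)
    (Eventually.of_forall fun ω => hfK _)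

/-- Conditionally on the available information, the error of the Kalman predictor along the actual
transmission pattern has the moments of a centered Gaussian vector. -/
theorem setIntegral_innovation (hmodel : IsNoiseModel μ Q Sigma₀ R x₀ w v ζ)
    (hQ : Q.PosDef) (hR : R.PosDef) (hSigma₀ : Sigma₀.PosDef) (hY : ∀ i, (Y i).PosDef)
    (hB : ∀ i, (B i)ᵀ * B i = Y i) (hu : IsUnit (Matrix.blockDiagonal' B).det)
    {N : ℕ} {f : (Fin N → Fin m → Bool) → EuclideanSpace ℝ (Fin n) → ℝ}
    (hf : ∀ d, Continuous (f d)) {K : (Fin N → Fin m → Bool) → ℝ} (hK : ∀ d, 0 ≤ K d)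
    (hfK : ∀ d x, |f d x| ≤ K d * (1 + ‖x‖ ^ 2))
    (hf0 : ∀ d, ∫ x, f d x ∂(multivariateGaussian 0
      (errCov A Q Sigma₀ C R (Matrix.blockDiagonal' B)⁻¹ (extendPattern d) N)) = 0)
    {S : Set Ω} (hS : MeasurableSet[infoBefore A C Y x₀ w v ζ N] S) :
    ∫ ω in S, f (fun j : Fin N => pattern A C Y x₀ w v ζ ω j)
      (state A x₀ w N ω
        - estimate A Q Sigma₀ C R (Matrix.blockDiagonal' B)⁻¹ Y x₀ w v ζ N ω) ∂μ = 0 := by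
  classical
  set F := (Matrix.blockDiagonal' B)⁻¹ with hF
  obtain ⟨T, hT, rfl⟩ := exists_preimage_of_info hS
  set J : Ω → Fin N → (Fin m → ℝ) × (Coord s → ℝ) := fun ω j =>
    ((fun i => decision A C Y x₀ w v ζ j i ω), (fun p => received A C Y x₀ w v ζ j ω p)) with hJ
  -- On the event that the pattern is `d`, the received data are a function of the masked
  -- measurements. The event therefore becomes a bounded test function of these.
  set L : (Fin N → Fin m → Bool) → (Fin N → EuclideanSpace ℝ (Coord s)) →
      Fin N → (Fin m → ℝ) × (Coord s → ℝ) := fun d y j =>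
    ((fun i => if d j i then 1 else 0), (y j).ofLp) with hL
  have hLm : ∀ d, Measurable (L d) := fun d => by
    refine measurable_pi_iff.2 fun j => Measurable.prodMk measurable_const ?_
    fun_prop
  set H : (Fin N → Fin m → Bool) → (Fin N → EuclideanSpace ℝ (Coord s)) → ℝ := fun d =>
    (L d ⁻¹' T).indicator fun _ => 1 with hH
  have hHm : ∀ d, Measurable (H d) := fun d => measurable_const.indicator (hLm d hT)
  have hH1 : ∀ d y, |H d y| ≤ 1 := fun d y => by
    by_cases h : y ∈ L d ⁻¹' T <;> simp [hH, h]
  set Φ : (Fin N → Fin m → Bool) → Ω → ℝ := fun d ω =>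
    f d (state A x₀ w N ω - predictor A Q Sigma₀ C R F (extendPattern d) N
          fun j => maskedMeas A C (extendPattern d) x₀ w v j ω)
        * H d (fun j => maskedMeas A C (extendPattern d) x₀ w v j ω)
        * (if (fun j : Fin N => pattern A C Y x₀ w v ζ ω j) = d then 1 else 0) with hΦ
  have hpm : Measurable fun ω (j : Fin N) => pattern A C Y x₀ w v ζ ω j :=
    (measurable_pattern_info N).mono (hmodel.infoBefore_le N) le_rfl
  have hΦi : ∀ d, Integrable (Φ d) μ := by
    intro d
    have h1 := integrable_innovation (A := A) (C := C) (F := F) hmodel (extendPattern d) N (hf d)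
      (hfK d)
    have h2 : Measurable fun ω => H d (fun j : Fin N => maskedMeas A C (extendPattern d) x₀ w v j ω)
        * (if (fun j : Fin N => pattern A C Y x₀ w v ζ ω j) = d then 1 else 0) := by
      refine ((hHm d).comp (measurable_pi_iff.2 fun j => hmodel.measurable_maskedMeas _ j)).mul
        (Measurable.ite ?_ measurable_const measurable_const)
      exact hpm (measurableSet_singleton d)
    have h3 := h1.mul_bdd (c := 1) h2.aestronglyMeasurable (Eventually.of_forall fun ω => by
      rw [norm_mul, Real.norm_eq_abs]
      refine mul_le_one₀ (hH1 _ _) (norm_nonneg _) ?_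
      split_ifs <;> simp)
    refine h3.congr (Eventually.of_forall fun ω => ?_)
    simp only [hΦ, mul_assoc]
  have hΦ0 : ∀ d, ∫ ω, Φ d ω ∂μ = 0 := by
    intro d
    have h1 := integral_innovation_mul_pattern (A := A) (C := C) hmodel hQ hR hSigma₀ hY hB hu
      (extendPattern d) N (hf d) (hK d) (hfK d) (hf0 d) (hHm d) (hH1 d)
    simpa only [extendPattern_coe] using h1
  -- Exactly one summand survives at each sample point, that of the actual pattern.
  have hsum : ∀ ω, (J ⁻¹' T).indicator (fun ω =>
      f (fun j : Fin N => pattern A C Y x₀ w v ζ ω j)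
      (state A x₀ w N ω - estimate A Q Sigma₀ C R F Y x₀ w v ζ N ω)) ω = ∑ d, Φ d ω := by
    intro ω
    simp only [hΦ, mul_ite, mul_one, mul_zero, Finset.sum_ite_eq, Finset.mem_univ, if_true]
    rw [← estimate_eq (Q := Q) (Sigma₀ := Sigma₀) (R := R) (F := F) rfl]
    have hJL : L (fun j : Fin N => pattern A C Y x₀ w v ζ ω j) (fun j => maskedMeas A C
        (extendPattern fun j : Fin N => pattern A C Y x₀ w v ζ ω j) x₀ w v j ω) = J ω := by
      funext j
      simp only [hL, hJ, decision_eq]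
      rw [← receivedVec_eq (Y := Y) (ζ := ζ) (extendPattern_of_lt _ j.2).symm]
      rfl
    by_cases hω : J ω ∈ T
    · have h1 : ω ∈ J ⁻¹' T := hω
      simp [hH, hJL, hω, h1]
    · have h1 : ω ∉ J ⁻¹' T := hω
      simp [hH, hJL, hω, h1]
  rw [← integral_indicator (hmodel.infoBefore_le N _ hS)]
  calc _ = ∫ ω, ∑ d, Φ d ω ∂μ := integral_congr_ae (Eventually.of_forall hsum)
    _ = 0 := by
      rw [integral_finsetSum _ fun d _ => hΦi d]
      exact Finset.sum_eq_zero fun d _ => hΦ0 d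

/-- The a priori estimate is the Kalman predictor along the actual transmission pattern. -/
theorem prioriEstimate_ae_eq (hmodel : IsNoiseModel μ Q Sigma₀ R x₀ w v ζ)
    (hQ : Q.PosDef) (hR : R.PosDef) (hSigma₀ : Sigma₀.PosDef) (hY : ∀ i, (Y i).PosDef)
    (hB : ∀ i, (B i)ᵀ * B i = Y i) (hu : IsUnit (Matrix.blockDiagonal' B).det) (N : ℕ) :
    prioriEstimate μ A C Y x₀ w v ζ N
      =ᵐ[μ] estimate A Q Sigma₀ C R (Matrix.blockDiagonal' B)⁻¹ Y x₀ w v ζ N := by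
  have hx : Integrable (state A x₀ w N) μ := (hmodel.memLp_state N).integrable (by simp)
  have he : Integrable (estimate A Q Sigma₀ C R (Matrix.blockDiagonal' B)⁻¹ Y x₀ w v ζ N) μ :=
    (hmodel.memLp_estimate N).integrable (by simp)
  refine (ae_eq_condExp_of_forall_setIntegral_eq (hmodel.infoBefore_le N) hx
    (fun S _ _ => he.integrableOn) (fun S hS _ => ?_)
    (measurable_estimate_info N).stronglyMeasurable.aestronglyMeasurable).symm
  ext a
  -- First moments: `f` is a coordinate, whose Gaussian mean is zero for every pattern.
  have h := setIntegral_innovation (A := A) (C := C) hmodel hQ hR hSigma₀ hY hB hu (N := N)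
    (f := fun _ x => x a) (fun _ => by fun_prop) (K := fun _ => 1) (fun _ => zero_le_one)
    (fun _ x => by
      have h1 : |x a| ≤ ‖x‖ := PiLp.norm_apply_le x a
      nlinarith [sq_nonneg (‖x‖ - 1)])
    (fun _ => integral_eval_multivariateGaussian _ _) hS
  have hp := (EuclideanSpace.proj a : EuclideanSpace ℝ (Fin n) →L[ℝ] ℝ).integral_comp_comm
    (μ := μ.restrict S) (hx.sub he).integrableOn
  have hs := integral_sub (μ := μ.restrict S) hx.integrableOn he.integrableOn
  have h2 : (∫ ω in S, state A x₀ w N ω ∂μ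
      - ∫ ω in S, estimate A Q Sigma₀ C R (Matrix.blockDiagonal' B)⁻¹ Y x₀ w v ζ N ω ∂μ) a = 0 := by
    rw [← hs]
    exact hp.symm.trans h
  rw [PiLp.sub_apply, sub_eq_zero] at h2
  exact h2.symm

/-- The a priori error covariance follows the Riccati recursion along the actual transmission
pattern. -/
theorem prioriCov_ae_eq (hmodel : IsNoiseModel μ Q Sigma₀ R x₀ w v ζ)
    (hQ : Q.PosDef) (hR : R.PosDef) (hSigma₀ : Sigma₀.PosDef) (hY : ∀ i, (Y i).PosDef)
    (hB : ∀ i, (B i)ᵀ * B i = Y i) (hu : IsUnit (Matrix.blockDiagonal' B).det) :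
    ∀ᵐ ω ∂μ, ∀ k, prioriCov μ A C Y x₀ w v ζ k ω
      = errCov A Q Sigma₀ C R (Matrix.blockDiagonal' B)⁻¹ (pattern A C Y x₀ w v ζ ω) k := by
  set F := (Matrix.blockDiagonal' B)⁻¹ with hF
  refine ae_all_iff.2 fun N => ?_
  suffices h : ∀ a b, ∀ᵐ ω ∂μ, prioriCov μ A C Y x₀ w v ζ N ω a b
      = errCov A Q Sigma₀ C R F (pattern A C Y x₀ w v ζ ω) N a b by
    filter_upwards [ae_all_iff.2 fun a => ae_all_iff.2 fun b => h a b] with ω hω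
    ext a b
    exact hω a b
  intro a b
  set e : Ω → EuclideanSpace ℝ (Fin n) := fun ω =>
    state A x₀ w N ω - estimate A Q Sigma₀ C R F Y x₀ w v ζ N ω with he
  have heL : MemLp e 2 μ := (hmodel.memLp_state N).sub (hmodel.memLp_estimate N)
  have hcoord : ∀ a, MemLp (fun ω => e ω a) 2 μ := fun a =>
    (EuclideanSpace.proj a : EuclideanSpace ℝ (Fin n) →L[ℝ] ℝ).comp_memLp' heL
  have hee : Integrable (fun ω => e ω a * e ω b) μ := (hcoord a).integrable_mul (hcoord b)
  have hcong : (fun ω' => (state A x₀ w N ω' a - prioriEstimate μ A C Y x₀ w v ζ N ω' a) *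
      (state A x₀ w N ω' b - prioriEstimate μ A C Y x₀ w v ζ N ω' b))
      =ᵐ[μ] fun ω => e ω a * e ω b := by
    filter_upwards [prioriEstimate_ae_eq (A := A) (C := C) hmodel hQ hR hSigma₀ hY hB hu N]
      with ω hω
    rw [hω]
    rfl
  set p : Ω → Fin N → Fin m → Bool := fun ω j => pattern A C Y x₀ w v ζ ω j with hp
  set g : (Fin N → Fin m → Bool) → ℝ := fun d => errCov A Q Sigma₀ C R F (extendPattern d) N a b
    with hg
  have hgp : (fun ω => errCov A Q Sigma₀ C R F (pattern A C Y x₀ w v ζ ω) N a b)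
      = fun ω => g (p ω) := by
    funext ω
    simp only [hg]
    rw [errCov_congr fun j hj => (extendPattern_of_lt (N := N) (pattern A C Y x₀ w v ζ ω) hj).symm]
  have hpm : Measurable[infoBefore A C Y x₀ w v ζ N] p := measurable_pattern_info N
  have hpm' : Measurable p := hpm.mono (hmodel.infoBefore_le N) le_rfl
  have hgm : Measurable[infoBefore A C Y x₀ w v ζ N] fun ω => g (p ω) :=
    (measurable_of_countable g).comp hpm
  have hgi : Integrable (fun ω => g (p ω)) μ := by
    have : IsProbabilityMeasure (μ.map p) := Measure.isProbabilityMeasure_map hpm'.aemeasurable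
    exact (Integrable.of_finite (μ := μ.map p) (f := g)).comp_measurable hpm'
  have hmain : (fun ω => g (p ω))
      =ᵐ[μ] μ[fun ω => e ω a * e ω b | infoBefore A C Y x₀ w v ζ N] := by
    refine ae_eq_condExp_of_forall_setIntegral_eq (hmodel.infoBefore_le N) hee
      (fun S _ _ => hgi.integrableOn) (fun S hS _ => ?_)
      hgm.stronglyMeasurable.aestronglyMeasurable
    -- Second moments: the product of coordinates is centered by the covariance of the current
    -- pattern, which is why `f` may depend on the pattern.
    have h := setIntegral_innovation (A := A) (C := C) hmodel hQ hR hSigma₀ hY hB hu (N := N)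
      (f := fun d x => x a * x b - g d) (fun _ => by fun_prop) (K := fun d => 1 + |g d|)
      (fun _ => by positivity)
      (fun d x => by
        have h1 : |x a| ≤ ‖x‖ := PiLp.norm_apply_le x a
        have h2 : |x b| ≤ ‖x‖ := PiLp.norm_apply_le x b
        have h3 : |x a * x b| ≤ ‖x‖ * ‖x‖ := by
          rw [abs_mul]
          exact mul_le_mul h1 h2 (abs_nonneg _) (norm_nonneg _)
        have h4 := abs_sub (x a * x b) (g d)
        nlinarith [abs_nonneg (g d), mul_nonneg (abs_nonneg (g d)) (sq_nonneg ‖x‖)])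
      (fun d => integral_eval_mul_eval_multivariateGaussian
        (errCov_posSemidef hQ hR hSigma₀ _ N) a b) hS
    have h2 := integral_sub (μ := μ.restrict S) hee.integrableOn hgi.integrableOn
    have h3 : ∫ ω in S, e ω a * e ω b ∂μ - ∫ ω in S, g (p ω) ∂μ = 0 := h2.symm.trans h
    exact (sub_eq_zero.1 h3).symm
  have hfin := hmain.trans (condExp_congr_ae (m := infoBefore A C Y x₀ w v ζ N) hcong).symm
  filter_upwards [hfin] with ω hω
  rw [show errCov A Q Sigma₀ C R F (pattern A C Y x₀ w v ζ ω) N a b = g (p ω) from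
    congrFun hgp ω, hω]
  rfl

end Information

/-! ### Noise regions that force a transmission pattern -/

section OpenPos

lemma isOpenPosMeasure_gaussianReal : (gaussianReal 0 1).IsOpenPosMeasure :=
  (gaussianReal_absolutelyContinuous' 0 one_ne_zero).isOpenPosMeasure

/-- The law is the image of a standard Gaussian under the square root of `S`, which is surjective
for positive definite `S`. -/
lemma isOpenPosMeasure_multivariateGaussian {ι : Type*} [Fintype ι] [DecidableEq ι]
    {S : Matrix ι ι ℝ} (hS : S.PosDef) : (multivariateGaussian 0 S).IsOpenPosMeasure := by
  have h0 := isOpenPosMeasure_gaussianReal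
  have h1 : (stdGaussian (EuclideanSpace ℝ ι)).IsOpenPosMeasure := by
    rw [← map_pi_eq_stdGaussian]
    exact (PiLp.continuous_toLp 2 _).isOpenPosMeasure_map (WithLp.toLp_surjective 2)
  have hsq : CFC.sqrt S * CFC.sqrt S = S := CFC.sqrt_mul_sqrt_self S hS.posSemidef.nonneg
  have hinv : CFC.sqrt S * (CFC.sqrt S * S⁻¹) = 1 := by
    rw [← Matrix.mul_assoc, hsq, Matrix.mul_nonsing_inv _ ((Matrix.isUnit_iff_isUnit_det _).1
      hS.isUnit)]
  refine Continuous.isOpenPosMeasure_map (by fun_prop) fun y => ?_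
  refine ⟨Matrix.toEuclideanCLM (𝕜 := ℝ) (CFC.sqrt S * S⁻¹) y, ?_⟩
  rw [zero_add, ← mul_apply_eq_comp, ← map_mul, hinv, map_one,
    one_apply_eq_self]

end OpenPos

section Forcing

variable {Ω : Type*} {n m : ℕ} {s : Fin m → ℕ}
  {x₀ : Ω → EuclideanSpace ℝ (Fin n)} {w : ℕ → Ω → EuclideanSpace ℝ (Fin n)}
  {v : ℕ → Ω → EuclideanSpace ℝ (Coord s)} {ζ : ℕ → Fin m → Ω → ℝ}

/-- The radius depends only on `A`, `c` and `L`, so the forcing regions chosen from it are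
deterministic and common to all windows. -/
lemma exists_norm_state_le (A : Matrix (Fin n) (Fin n) ℝ) {c : ℝ} (hc : 0 ≤ c) (L : ℕ) :
    ∃ r : ℝ, 0 ≤ r ∧ ∀ (x₀ : Ω → EuclideanSpace ℝ (Fin n)) (w : ℕ → Ω → EuclideanSpace ℝ (Fin n))
      (ω : Ω) (k : ℕ), ‖state A x₀ w k ω‖ ≤ c →
      (∀ j < L, ‖w (k + j) ω‖ < 1) → ∀ j ≤ L, ‖state A x₀ w (k + j) ω‖ ≤ r := by
  induction L with
  | zero =>
    refine ⟨c, hc, fun x₀ w ω k hk _ j hj => ?_⟩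
    obtain rfl : j = 0 := by omega
    exact hk
  | succ L ih =>
    obtain ⟨r, hr, h⟩ := ih
    refine ⟨r + (‖lin A‖ * r + 1), by positivity, fun x₀ w ω k hk hw j hj => ?_⟩
    have h1 := h x₀ w ω k hk fun j hj => hw j (by omega)
    rcases Nat.lt_or_ge L j with hj' | hj'
    · obtain rfl : j = L + 1 := by omega
      have h2 : ‖state A x₀ w (k + L + 1) ω‖ ≤ ‖lin A‖ * r + 1 := by
        rw [state_succ]
        refine (norm_add_le _ _).trans (add_le_add ?_ (hw L (by omega)).le)
        exact ((lin A).le_opNorm _).trans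
          (mul_le_mul_of_nonneg_left (h1 L le_rfl) (norm_nonneg _))
      rw [← add_assoc]
      linarith
    · have := h1 j hj'
      have : 0 ≤ ‖lin A‖ * r + 1 := by positivity
      linarith

lemma continuous_trigger_block {Y : (i : Fin m) → Matrix (Fin (s i)) (Fin (s i)) ℝ} (i : Fin m) :
    Continuous fun y : EuclideanSpace ℝ (Coord s) => trigger (Y i) fun a => y ⟨i, a⟩ := by
  unfold trigger
  fun_prop

lemma trigger_le_exp {r : ℕ} {Y : Matrix (Fin r) (Fin r) ℝ} {l : ℝ} (hl : 0 < l)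
    (hY : l • (1 : Matrix (Fin r) (Fin r) ℝ) ≤ Y) {α : Fin r → ℝ} {a : Fin r} (ha : 1 ≤ α a) :
    trigger Y α ≤ Real.exp (-(1 / 2) * l) := by
  refine Real.exp_le_exp.2 ?_
  have h1 := dotProduct_mulVec_mono hY α
  rw [Matrix.smul_mulVec, Matrix.one_mulVec, dotProduct_smul, smul_eq_mul] at h1
  have h2 : 1 ≤ α ⬝ᵥ α := by
    have h3 : α a * α a ≤ α ⬝ᵥ α :=
      Finset.single_le_sum (f := fun a => α a * α a) (fun b _ => mul_self_nonneg _)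
        (Finset.mem_univ a)
    nlinarith
  nlinarith

/-- There are noise regions of positive probability which force, from a bounded state, the
transmission decisions of all sensors in a window. -/
lemma exists_forcing (A : Matrix (Fin n) (Fin n) ℝ) (C : Matrix (Coord s) (Fin n) ℝ)
    {Y : (i : Fin m) → Matrix (Fin (s i)) (Fin (s i)) ℝ} (hY : ∀ i, (Y i).PosDef)
    (b : Bool) {c : ℝ} (hc : 0 ≤ c) (L : ℕ) :
    ∃ (Vs : Set (EuclideanSpace ℝ (Coord s))) (Zs : Fin m → Set ℝ), IsOpen Vs ∧ Vs.Nonempty ∧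
      (∀ i, MeasurableSet (Zs i) ∧ volume.restrict (Set.Icc (0 : ℝ) 1) (Zs i) ≠ 0) ∧
      ∀ (x₀ : Ω → EuclideanSpace ℝ (Fin n)) (w : ℕ → Ω → EuclideanSpace ℝ (Fin n))
        (v : ℕ → Ω → EuclideanSpace ℝ (Coord s)) (ζ : ℕ → Fin m → Ω → ℝ) (ω : Ω) (k : ℕ),
        ‖state A x₀ w k ω‖ ≤ c →
        (∀ j < L, w (k + j) ω ∈ Metric.ball 0 1 ∧ v (k + j) ω ∈ Vs ∧
          ∀ i, ζ (k + j) i ω ∈ Zs i) →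
        ∀ j < L, ∀ p : Coord s, pattern A C Y x₀ w v ζ ω (k + j) p.1 = b := by
  obtain ⟨r, hr, h⟩ := exists_norm_state_le (Ω := Ω) A hc L
  have hstate : ∀ (x₀ : Ω → EuclideanSpace ℝ (Fin n)) (w : ℕ → Ω → EuclideanSpace ℝ (Fin n))
      (ω : Ω) (k : ℕ), ‖state A x₀ w k ω‖ ≤ c →
      (∀ j < L, w (k + j) ω ∈ Metric.ball 0 1) → ∀ j < L,
        ‖lin C (state A x₀ w (k + j) ω)‖ ≤ ‖lin C‖ * r := fun x₀ w ω k hk hw j hj =>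
    ((lin C).le_opNorm _).trans (mul_le_mul_of_nonneg_left
      (h x₀ w ω k hk (fun j hj => by simpa using hw j hj) j hj.le) (norm_nonneg _))
  cases b with
  | false =>
    -- Silence: the measurements stay in a compact ball, on which the trigger has a positive
    -- minimum; a uniform variable below it forces silence.
    have hδ : ∀ i, ∃ δ : ℝ, 0 < δ ∧ ∀ y : EuclideanSpace ℝ (Coord s),
        ‖y‖ ≤ ‖lin C‖ * r + 1 → δ ≤ trigger (Y i) fun a => y ⟨i, a⟩ := by
      intro i
      obtain ⟨y₀, _, hy₀⟩ := (isCompact_closedBall (0 : EuclideanSpace ℝ (Coord s))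
        (‖lin C‖ * r + 1)).exists_isMinOn ⟨0, by simp; positivity⟩
        (continuous_trigger_block (Y := Y) i).continuousOn
      exact ⟨_, trigger_pos (Y i) fun a => y₀ ⟨i, a⟩, fun y hy => hy₀ (by simpa using hy)⟩
    choose δ hδ0 hδ using hδ
    refine ⟨Metric.ball 0 1, fun i => Set.Iic (δ i), Metric.isOpen_ball, ⟨0, by simp⟩,
      fun i => ⟨measurableSet_Iic, ?_⟩, ?_⟩
    · rw [Measure.restrict_apply measurableSet_Iic]
      have h1 : Set.Icc 0 (min (δ i) 1) ⊆ Set.Iic (δ i) ∩ Set.Icc 0 1 := fun z hz =>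
        ⟨hz.2.trans (min_le_left _ _), hz.1, hz.2.trans (min_le_right _ _)⟩
      refine ((lt_of_lt_of_le ?_ (measure_mono h1))).ne'
      simp [hδ0 i]
    · intro x₀ w v ζ ω k hk hw j hj p
      have hy : ‖meas A C x₀ w v (k + j) ω‖ ≤ ‖lin C‖ * r + 1 := by
        rw [meas_eq]
        refine (norm_add_le _ _).trans (add_le_add
          (hstate x₀ w ω k hk (fun j hj => (hw j hj).1) j hj) ?_)
        have := (hw j hj).2.1
        simp only [Metric.mem_ball, dist_zero_right] at this
        exact this.le
      have h1 : ζ (k + j) p.1 ω ≤ δ p.1 := (hw j hj).2.2 p.1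
      simp [pattern, h1.trans (hδ p.1 _ hy)]
  | true =>
    choose l hl0 hl using fun i => exists_pos_smul_one_le (hY i)
    -- Transmission: this noise outweighs the signal, so every coordinate of the measurement is at
    -- least 1. The trigger is then at most exp(-l/2) < 1, and the uniform variable exceeds this
    -- with positive probability.
    refine ⟨{y | ∀ p, ‖lin C‖ * r + 1 < y p}, fun i => Set.Ioi (Real.exp (-(1 / 2) * l i)), ?_,
      ⟨WithLp.toLp 2 fun _ => ‖lin C‖ * r + 2, fun p => by simp⟩,
      fun i => ⟨measurableSet_Ioi, ?_⟩, ?_⟩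
    · simp only [Set.ofPred_forall]
      exact isOpen_iInter_of_finite fun p => isOpen_lt continuous_const (by fun_prop)
    · rw [Measure.restrict_apply measurableSet_Ioi]
      have h1 : Set.Ioc (Real.exp (-(1 / 2) * l i)) 1
          ⊆ Set.Ioi (Real.exp (-(1 / 2) * l i)) ∩ Set.Icc 0 1 := fun z hz =>
        ⟨hz.1, (Real.exp_pos _).le.trans hz.1.le, hz.2⟩
      refine ((lt_of_lt_of_le ?_ (measure_mono h1))).ne'
      have := hl0 i
      simp [this]
    · intro x₀ w v ζ ω k hk hw j hj p
      have hx := hstate x₀ w ω k hk (fun j hj => (hw j hj).1) j hj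
      have h1 : 1 ≤ meas A C x₀ w v (k + j) ω p := by
        have h2 : |lin C (state A x₀ w (k + j) ω) p| ≤ ‖lin C‖ * r :=
          (PiLp.norm_apply_le (lin C (state A x₀ w (k + j) ω)) p).trans hx
        have h3 : ‖lin C‖ * r + 1 < v (k + j) ω p := (hw j hj).2.1 p
        rw [meas_eq, PiLp.add_apply]
        linarith [(abs_le.1 h2).1]
      have h2 : Real.exp (-(1 / 2) * l p.1) < ζ (k + j) p.1 ω := (hw j hj).2.2 p.1
      have h3 := trigger_le_exp (hl0 p.1) (hl p.1)
        (α := fun a => meas A C x₀ w v (k + j) ω ⟨p.1, a⟩) (a := p.2) h1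
      simp [pattern, h3.trans_lt h2]

end Forcing

/-! ### Borel–Cantelli for noise windows -/

section Windows

variable {Ω : Type*} {n m : ℕ} {s : Fin m → ℕ}
  {x₀ : Ω → EuclideanSpace ℝ (Fin n)} {w : ℕ → Ω → EuclideanSpace ℝ (Fin n)}
  {v : ℕ → Ω → EuclideanSpace ℝ (Coord s)} {ζ : ℕ → Fin m → Ω → ℝ}

/-- The sources that act in the window of length `L` starting at time `k`. -/
def windowSource {L : ℕ} (k : ℕ) : Fin L × Option (Option (Fin m)) → Source m
  | (j, none) => .process (k + j)
  | (j, some none) => .measurement (k + j)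
  | (j, some (some i)) => .uniform (k + j) i

lemma windowSource_injective {L : ℕ} (k : ℕ) :
    Function.Injective (windowSource (m := m) (L := L) k) := by
  rintro ⟨j, _ | _ | i⟩ ⟨j', _ | _ | i'⟩ h <;>
    simp_all [windowSource, Fin.ext_iff]

/-- The elementary events of a window. -/
def windowEvent {L : ℕ} (w : ℕ → Ω → EuclideanSpace ℝ (Fin n))
    (v : ℕ → Ω → EuclideanSpace ℝ (Coord s)) (ζ : ℕ → Fin m → Ω → ℝ)
    (Vs : Set (EuclideanSpace ℝ (Coord s))) (Zs : Fin m → Set ℝ) (k : ℕ) :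
    Fin L × Option (Option (Fin m)) → Set Ω
  | (j, none) => w (k + j) ⁻¹' Metric.ball 0 1
  | (j, some none) => v (k + j) ⁻¹' Vs
  | (j, some (some i)) => ζ (k + j) i ⁻¹' Zs i

lemma measurableSet_windowEvent {L : ℕ} {Vs : Set (EuclideanSpace ℝ (Coord s))}
    {Zs : Fin m → Set ℝ} (hVs : IsOpen Vs) (hZs : ∀ i, MeasurableSet (Zs i)) (k : ℕ)
    (t : Fin L × Option (Option (Fin m))) :
    MeasurableSet[sourceSigma x₀ w v ζ (windowSource k t)] (windowEvent w v ζ Vs Zs k t) := by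
  obtain ⟨j, _ | _ | i⟩ := t
  · exact ⟨_, Metric.isOpen_ball.measurableSet, rfl⟩
  · exact ⟨_, hVs.measurableSet, rfl⟩
  · exact ⟨_, hZs i, rfl⟩

lemma history_mono {k l : ℕ} (hkl : k ≤ l) : history x₀ w v ζ k ≤ history x₀ w v ζ l := by
  refine biSup_mono fun a ha => ?_
  cases a with
  | init => trivial
  | process j => exact lt_of_lt_of_le (show j < k from ha) hkl
  | measurement j => exact lt_of_lt_of_le (show j < k from ha) hkl
  | uniform j i => exact lt_of_lt_of_le (show j < k from ha) hkl

variable {A Q Sigma₀ : Matrix (Fin n) (Fin n) ℝ} {R : Matrix (Coord s) (Coord s) ℝ}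
  [mΩ : MeasurableSpace Ω] {μ : Measure Ω} [IsProbabilityMeasure μ]

/-- Lévy's Borel–Cantelli lemma for windows of noise: whenever the state is bounded infinitely
often, the noise falls infinitely often into a given region of positive probability right after
such a time. -/
lemma frequently_window (hmodel : IsNoiseModel μ Q Sigma₀ R x₀ w v ζ) (hQ : Q.PosDef)
    (hR : R.PosDef) {L : ℕ} {Vs : Set (EuclideanSpace ℝ (Coord s))}
    {Zs : Fin m → Set ℝ} (hVs : IsOpen Vs) (hVs' : Vs.Nonempty)
    (hZs : ∀ i, MeasurableSet (Zs i) ∧ volume.restrict (Set.Icc (0 : ℝ) 1) (Zs i) ≠ 0) (c : ℝ) :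
    ∀ᵐ ω ∂μ, (∃ᶠ j in atTop, ‖state A x₀ w (j * L) ω‖ ≤ c) →
      ∃ᶠ j in atTop, ‖state A x₀ w (j * L) ω‖ ≤ c ∧
        ω ∈ ⋂ t : Fin L × Option (Option (Fin m)), windowEvent w v ζ Vs Zs (j * L) t := by
  set G : ℕ → Set Ω := fun j =>
    ⋂ t : Fin L × Option (Option (Fin m)), windowEvent w v ζ Vs Zs (j * L) t with hG
  set D : ℕ → Set Ω := fun j => {ω | ‖state A x₀ w (j * L) ω‖ ≤ c} with hD
  set law : Fin L × Option (Option (Fin m)) → ENNReal := fun t =>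
    match t.2 with
    | none => multivariateGaussian 0 Q (Metric.ball 0 1)
    | some none => multivariateGaussian 0 R Vs
    | some (some i) => volume.restrict (Set.Icc (0 : ℝ) 1) (Zs i) with hlaw
  have hevent : ∀ k t, μ (windowEvent w v ζ Vs Zs k t) = law t := by
    rintro k ⟨j, _ | _ | i⟩
    · simp only [windowEvent, hlaw]
      rw [← Measure.map_apply (hmodel.measurable_process _) Metric.isOpen_ball.measurableSet,
        (hmodel.law_process _).map_eq]
    · simp only [windowEvent, hlaw]
      rw [← Measure.map_apply (hmodel.measurable_measurement _) hVs.measurableSet,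
        (hmodel.law_measurement _).map_eq]
    · simp only [windowEvent, hlaw]
      rw [← Measure.map_apply (hmodel.measurable_uniform _ _) (hZs i).1,
        (hmodel.law_uniform _ _).map_eq]
  have hlaw0 : ∀ t, law t ≠ 0 := by
    have h1 := isOpenPosMeasure_multivariateGaussian hQ
    have h2 := isOpenPosMeasure_multivariateGaussian hR
    rintro ⟨j, _ | _ | i⟩
    · exact (Metric.isOpen_ball.measure_pos _ ⟨0, by simp⟩).ne'
    · exact (hVs.measure_pos _ hVs').ne'
    · exact (hZs i).2
  have hGμ : ∀ j, μ (G j) = ∏ t, law t := by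
    intro j
    have h1 := hmodel.indep.precomp (windowSource_injective (m := m) (L := L) (j * L))
    rw [hG, h1.meas_iInter fun t =>
      measurableSet_windowEvent hVs (fun i => (hZs i).1) (j * L) t]
    exact Finset.prod_congr rfl fun t _ => hevent _ t
  set p : ℝ := (∏ t, law t).toReal with hp
  have hp0 : 0 < p := by
    refine ENNReal.toReal_pos (Finset.prod_ne_zero_iff.2 fun t _ => hlaw0 t) ?_
    rw [← hGμ 0]
    exact measure_ne_top _ _
  have hGw : ∀ j, MeasurableSet[⨆ a ∈ Set.range (windowSource (m := m) (L := L) (j * L)),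
      sourceSigma x₀ w v ζ a] (G j) := fun j =>
    MeasurableSet.iInter fun t => measurable_sourceSigma_le (Set.mem_range_self t) _
      (measurableSet_windowEvent hVs (fun i => (hZs i).1) (j * L) t)
  have hwin : ∀ j, Set.range (windowSource (m := m) (L := L) (j * L))
      ⊆ Source.before m ((j + 1) * L) := by
    rintro j _ ⟨⟨l, _ | _ | i⟩, rfl⟩
    all_goals
      change j * L + l < (j + 1) * L
      have := l.2
      rw [add_mul]
      omega
  have hdisj : ∀ j, Disjoint (Set.range (windowSource (m := m) (L := L) (j * L)))
      (Source.before m (j * L)) := by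
    intro j
    rw [Set.disjoint_left]
    rintro _ ⟨⟨l, _ | _ | i⟩, rfl⟩ h
    all_goals
      have : j * L + l < j * L := h
      omega
  have hGhist : ∀ j, MeasurableSet[history x₀ w v ζ ((j + 1) * L)] (G j) := fun j =>
    biSup_mono (f := fun a => sourceSigma x₀ w v ζ a) (fun a ha => hwin j ha) _ (hGw j)
  have hDhist : ∀ j, MeasurableSet[history x₀ w v ζ (j * L)] (D j) := fun j =>
    measurableSet_le (measurable_norm.comp (measurable_state_history (j * L))) measurable_const
  set ℱ : Filtration ℕ mΩ :=
    { seq := fun j => history x₀ w v ζ (j * L)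
      mono' := fun i j hij => history_mono (Nat.mul_le_mul_right L hij)
      le' := fun j => hmodel.iSup_sourceSigma_le _ } with hℱ
  -- Shifted by one index: the window starting at grid point `j` is decided only at grid point `j +
  -- 1`, while Lévy's lemma conditions the event at `j + 1` on the past of `j`.
  set S : ℕ → Set Ω := fun j => Nat.casesOn j ∅ fun j => D j ∩ G j with hS
  have hSm : ∀ j, MeasurableSet[ℱ j] (S j) := by
    intro j
    cases j with
    | zero => exact @MeasurableSet.empty _ (ℱ 0)
    | succ j =>
      exact (history_mono (Nat.mul_le_mul_right L (Nat.le_succ j)) _ (hDhist j)).inter (hGhist j)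
  have hcond : ∀ j, μ[(S (j + 1)).indicator (1 : Ω → ℝ) | ℱ j]
      =ᵐ[μ] (D j).indicator fun _ => p := by
    intro j
    have hmem : MeasurableSet (G j) := hmodel.iSup_sourceSigma_le _ _ (hGw j)
    have hind : Integrable ((G j).indicator (1 : Ω → ℝ)) μ :=
      (integrable_const (1 : ℝ)).indicator hmem
    have h1 : (S (j + 1)).indicator (1 : Ω → ℝ)
        = (D j).indicator ((G j).indicator (1 : Ω → ℝ)) := by
      rw [Set.indicator_indicator]
    have h2 := condExp_indicator (m := ℱ j) hind (hDhist j)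
    -- The window uses sources disjoint from the history, so its conditional probability is the
    -- constant `p`.
    have h3 : μ[(G j).indicator (1 : Ω → ℝ) | ℱ j] =ᵐ[μ] fun _ => p := by
      have h4 := condExp_indep_eq (f := (G j).indicator (1 : Ω → ℝ))
        (hmodel.iSup_sourceSigma_le (Set.range (windowSource (m := m) (L := L) (j * L)))) (ℱ.le j)
        ((stronglyMeasurable_const (β := ℝ) (b := 1)).indicator (hGw j))
        (hmodel.indep_iSup (hdisj j))
      have h5 : ∫ ω, (G j).indicator (1 : Ω → ℝ) ω ∂μ = p := by
        rw [integral_indicator_one hmem, measureReal_def, hGμ]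
      rw [h5] at h4
      exact h4
    rw [h1]
    refine h2.trans ?_
    filter_upwards [h3] with ω hω
    by_cases hωD : ω ∈ D j <;> simp [hωD, hω]
  filter_upwards [ae_mem_limsup_atTop_iff (ℱ := ℱ) μ hSm, ae_all_iff.2 hcond] with ω hω hcω hfreq
  have h1 : ω ∈ limsup D atTop := mem_limsup_iff_frequently_mem.2 hfreq
  -- The sum of the conditional probabilities is `p` times the number of bounded visits, so it
  -- diverges exactly when these recur.
  rw [Set.limsup_eq_tendsto_sum_indicator_atTop hp0] at h1
  have h2 : ω ∈ limsup S atTop := by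
    rw [hω]
    simp_rw [hcω]
    exact h1
  have h3 := mem_limsup_iff_frequently_mem.1 h2
  rw [frequently_atTop] at h3 ⊢
  intro a
  obtain ⟨b, hb, hbS⟩ := h3 (a + 1)
  obtain ⟨j, rfl⟩ : ∃ j, b = j + 1 := ⟨b - 1, by omega⟩
  exact ⟨j, by omega, hbS⟩

end Windows

/-! ### Recurrence of the state and of the transmission patterns -/

section Recurrence

variable {Ω : Type*} {n m : ℕ} {s : Fin m → ℕ}
  {x₀ : Ω → EuclideanSpace ℝ (Fin n)} {w : ℕ → Ω → EuclideanSpace ℝ (Fin n)}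
  {v : ℕ → Ω → EuclideanSpace ℝ (Coord s)} {ζ : ℕ → Fin m → Ω → ℝ}
  {A Q Sigma₀ : Matrix (Fin n) (Fin n) ℝ} {R : Matrix (Coord s) (Coord s) ℝ}

/-- With C = 0 the gain vanishes and the prediction error is the state itself. The Kalman filter
theorem then doubles as a computation of the law of the state. -/
lemma predictor_unobserved (F : Matrix (Coord s) (Coord s) ℝ) (d : ℕ → Fin m → Bool) (k : ℕ)
    (o : ℕ → EuclideanSpace ℝ (Coord s)) : predictor A Q Sigma₀ 0 R F d k o = 0 := by
  induction k with
  | zero => rfl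
  | succ k ih => simp [predictor, ih, kalmanGain, lin_apply]

variable [mΩ : MeasurableSpace Ω] {μ : Measure Ω} [IsProbabilityMeasure μ]

lemma integral_norm_sq_multivariateGaussian {ι : Type*} [Fintype ι] [DecidableEq ι]
    {S : Matrix ι ι ℝ} (hS : S.PosSemidef) :
    ∫ x : EuclideanSpace ℝ ι, ‖x‖ ^ 2 ∂(multivariateGaussian 0 S) = ∑ a, S a a := by
  have hi : ∀ a, Integrable (fun x : EuclideanSpace ℝ ι => x a * x a)
      (multivariateGaussian 0 S) := fun a =>
    (memLp_eval_multivariateGaussian S a).integrable_mul (memLp_eval_multivariateGaussian S a)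
  have h : ∀ x : EuclideanSpace ℝ ι, ‖x‖ ^ 2 = ∑ a, x a * x a := fun x => by
    rw [EuclideanSpace.real_norm_sq_eq]
    exact Finset.sum_congr rfl fun a _ => pow_two _
  simp_rw [h]
  rw [integral_finsetSum _ fun a _ => hi a]
  refine Finset.sum_congr rfl fun a _ => ?_
  have h2 := integral_eval_mul_eval_multivariateGaussian hS a a
  rw [integral_sub (hi a) (integrable_const _), integral_const, probReal_univ, one_smul,
    sub_eq_zero] at h2
  exact h2

/-- The second moments of the state of a stable system are bounded. -/
lemma exists_integral_norm_sq_state_le (hmodel : IsNoiseModel μ Q Sigma₀ R x₀ w v ζ)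
    (hA : spectralRadius ℂ (A.map Complex.ofReal) < 1)
    (hQ : Q.PosDef) (hR : R.PosDef) (hSigma₀ : Sigma₀.PosDef) :
    ∃ K : ℝ, ∀ k, ∫ ω, ‖state A x₀ w k ω‖ ^ 2 ∂μ ≤ K := by
  obtain ⟨M, -, hSM, hM⟩ := exists_invariant hA hQ.posSemidef.transpose_eq
    hSigma₀.posSemidef.transpose_eq
  refine ⟨∑ a, M a a, fun k => ?_⟩
  set d : ℕ → Fin m → Bool := fun _ _ => false
  set P := errCov A Q Sigma₀ (0 : Matrix (Coord s) (Fin n) ℝ) R 0 d k with hP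
  have hPp : P.PosSemidef := errCov_posSemidef hQ hR hSigma₀ d k
  have hg := (kalman_filter (A := A) (C := 0) (F := 0) hmodel hQ hR hSigma₀ d (le_refl k)).1
  simp only [predictor_unobserved, sub_zero] at hg
  have hm := hmodel.measurable_state (A := A) k
  have hmap := hg.map_eq hPp (hm.comp measurable_fst)
  have hmap' : μ.map (state A x₀ w k) = multivariateGaussian 0 P := by
    rw [← hmap]
    have := Measure.map_map (μ := μ.prod (auxMeasure k (Coord s))) hm measurable_fst
    rw [Measure.map_fst_prod, measure_univ, one_smul] at this
    exact this
  have h1 : ∫ ω, ‖state A x₀ w k ω‖ ^ 2 ∂μ = ∑ a, P a a := by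
    rw [← integral_norm_sq_multivariateGaussian hPp, ← hmap', integral_map hm.aemeasurable
      (by fun_prop)]
  rw [h1]
  refine Finset.sum_le_sum fun a _ => ?_
  have h2 := (Matrix.le_iff.1 (errCov_le_invariant
    (C := (0 : Matrix (Coord s) (Fin n) ℝ)) (F := 0) hQ hR hSigma₀ hSM hM d k)).diag_nonneg (i := a)
  rw [Matrix.sub_apply] at h2
  linarith

/-- Almost surely, the state is bounded along infinitely many multiples of `L`. -/
lemma ae_exists_frequently_norm_state_le (hmodel : IsNoiseModel μ Q Sigma₀ R x₀ w v ζ)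
    (hA : spectralRadius ℂ (A.map Complex.ofReal) < 1)
    (hQ : Q.PosDef) (hR : R.PosDef) (hSigma₀ : Sigma₀.PosDef) (L : ℕ) :
    ∀ᵐ ω ∂μ, ∃ c : ℕ, ∃ᶠ j in atTop, ‖state A x₀ w (j * L) ω‖ ≤ c := by
  obtain ⟨K, hK⟩ := exists_integral_norm_sq_state_le hmodel hA hQ hR hSigma₀
  have hm : ∀ j, Measurable fun ω => ‖state A x₀ w (j * L) ω‖ₑ := fun j =>
    (hmodel.measurable_state _).enorm
  have hb : ∀ j, ∫⁻ ω, ‖state A x₀ w (j * L) ω‖ₑ ∂μ ≤ ENNReal.ofReal (1 + K) := by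
    intro j
    have hL := hmodel.memLp_state (A := A) (j * L)
    have hi := hL.integrable (by simp)
    rw [← ofReal_integral_norm_eq_lintegral_enorm hi]
    refine ENNReal.ofReal_le_ofReal ?_
    have h1 : ∫ ω, ‖state A x₀ w (j * L) ω‖ ∂μ ≤ ∫ ω, (1 + ‖state A x₀ w (j * L) ω‖ ^ 2) ∂μ := by
      refine integral_mono hi.norm ((integrable_const _).add hL.norm.integrable_sq) fun ω => ?_
      simp only
      nlinarith [sq_nonneg (‖state A x₀ w (j * L) ω‖ - 1)]
    rw [integral_add (integrable_const _) hL.norm.integrable_sq, integral_const, probReal_univ,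
      one_smul] at h1
    linarith [hK (j * L)]
  have hlim : ∫⁻ ω, liminf (fun j => ‖state A x₀ w (j * L) ω‖ₑ) atTop ∂μ
      ≤ ENNReal.ofReal (1 + K) := by
    -- Fatou: bounded first moments along the grid make the lower limit of the norms integrable,
    -- hence almost surely finite.
    refine (lintegral_liminf_le hm).trans ?_
    exact liminf_le_of_frequently_le' (Frequently.of_forall hb)
  have hfin := ae_lt_top (Measurable.liminf hm) (hlim.trans_lt ENNReal.ofReal_lt_top).ne
  filter_upwards [hfin] with ω hω
  obtain ⟨c, hc⟩ := ENNReal.exists_nat_gt hω.ne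
  refine ⟨c, (frequently_lt_of_liminf_lt (by isBoundedDefault) hc).mono fun j hj => ?_⟩
  have := ENNReal.toReal_mono (by simp) hj.le
  simpa using this

/-- Almost surely, every transmission behaviour `b` is shared by all sensors during arbitrarily
late windows of a given length. -/
theorem ae_frequently_pattern_eq (hmodel : IsNoiseModel μ Q Sigma₀ R x₀ w v ζ)
    (hA : spectralRadius ℂ (A.map Complex.ofReal) < 1)
    (hQ : Q.PosDef) (hR : R.PosDef) (hSigma₀ : Sigma₀.PosDef)
    (C : Matrix (Coord s) (Fin n) ℝ) {Y : (i : Fin m) → Matrix (Fin (s i)) (Fin (s i)) ℝ}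
    (hY : ∀ i, (Y i).PosDef) (b : Bool) (L : ℕ) :
    ∀ᵐ ω ∂μ, ∃ᶠ k in atTop, ∀ j < L, ∀ p : Coord s,
      pattern A C Y x₀ w v ζ ω (k + j) p.1 = b := by
  -- The bound on the state is random, so all natural bounds are treated at once. Windows of length
  -- `L + 1` ensure that the grid points j (L + 1) tend to infinity even for L = 0.
  choose Vs Zs hVs hVs' hZs hforce using fun c : ℕ =>
    exists_forcing (Ω := Ω) A C hY b (Nat.cast_nonneg c) (L + 1)
  have hwin : ∀ᵐ ω ∂μ, ∀ c : ℕ, (∃ᶠ j in atTop, ‖state A x₀ w (j * (L + 1)) ω‖ ≤ c) →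
      ∃ᶠ j in atTop, ‖state A x₀ w (j * (L + 1)) ω‖ ≤ c ∧
        ω ∈ ⋂ t : Fin (L + 1) × Option (Option (Fin m)),
          windowEvent w v ζ (Vs c) (Zs c) (j * (L + 1)) t :=
    ae_all_iff.2 fun c => frequently_window hmodel hQ hR (hVs c) (hVs' c) (hZs c) c
  filter_upwards [hwin, ae_exists_frequently_norm_state_le hmodel hA hQ hR hSigma₀ (L + 1)]
    with ω hω ⟨c, hc⟩
  have h := hω c hc
  rw [frequently_atTop] at h ⊢
  intro a
  obtain ⟨j, hj, hx, hG⟩ := h a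
  refine ⟨j * (L + 1), by nlinarith, fun l hl p => ?_⟩
  refine hforce c x₀ w v ζ ω _ hx (fun l hl => ⟨?_, ?_, fun i => ?_⟩) l (by omega) p
  · exact Set.mem_iInter.1 hG (⟨l, hl⟩, none)
  · exact Set.mem_iInter.1 hG (⟨l, hl⟩, some none)
  · exact Set.mem_iInter.1 hG (⟨l, hl⟩, some (some i))

end Recurrence

end EventTrigger

theorem theorem4 {Ω : Type*} [MeasurableSpace Ω] (μ : Measure Ω) [IsProbabilityMeasure μ]
    (n m : ℕ) (s : Fin m → ℕ)
    (A Q Sigma₀ : Matrix (Fin n) (Fin n) ℝ)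
    (C : Matrix (EventTrigger.Coord s) (Fin n) ℝ)
    (R : Matrix (EventTrigger.Coord s) (EventTrigger.Coord s) ℝ)
    (Y : (i : Fin m) → Matrix (Fin (s i)) (Fin (s i)) ℝ)
    (hA : spectralRadius ℂ (A.map Complex.ofReal) < 1)
    (hQ : Q.PosDef) (hR : R.PosDef) (hSigma₀ : Sigma₀.PosDef) (hY : ∀ i, (Y i).PosDef)
    (x₀ : Ω → EuclideanSpace ℝ (Fin n)) (w : ℕ → Ω → EuclideanSpace ℝ (Fin n))
    (v : ℕ → Ω → EuclideanSpace ℝ (EventTrigger.Coord s)) (ζ : ℕ → Fin m → Ω → ℝ)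
    (hmodel : EventTrigger.IsNoiseModel μ Q Sigma₀ R x₀ w v ζ) :
    (∃ M : Matrix (Fin n) (Fin n) ℝ, M.PosDef ∧
      ∀ᵐ ω ∂μ, ∀ k, EventTrigger.prioriCov μ A C Y x₀ w v ζ k ω ≤ M) ∧
    ∃ Xlow Xup : Matrix (Fin n) (Fin n) ℝ,
      (Xlow.PosDef ∧ Xlow = EventTrigger.riccati A Q C R Xlow ∧
        ∀ X : Matrix (Fin n) (Fin n) ℝ, X.PosSemidef →
          X = EventTrigger.riccati A Q C R X → X = Xlow) ∧
      (Xup.PosDef ∧ Xup = EventTrigger.riccati A Q C (R + (Matrix.blockDiagonal' Y)⁻¹) Xup ∧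
        ∀ X : Matrix (Fin n) (Fin n) ℝ, X.PosSemidef →
          X = EventTrigger.riccati A Q C (R + (Matrix.blockDiagonal' Y)⁻¹) X → X = Xup) ∧
      (∀ ε : ℝ, 0 < ε → ∃ N : ℕ, ∀ᵐ ω ∂μ, ∀ k ≥ N,
        Xlow - ε • (1 : Matrix (Fin n) (Fin n) ℝ) ≤
            EventTrigger.prioriCov μ A C Y x₀ w v ζ k ω ∧
          EventTrigger.prioriCov μ A C Y x₀ w v ζ k ω ≤
            Xup + ε • (1 : Matrix (Fin n) (Fin n) ℝ)) ∧
      (∀ ε : ℝ, 0 < ε →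
        (∀ᵐ ω ∂μ, ∃ᶠ k in atTop, Xup - ε • (1 : Matrix (Fin n) (Fin n) ℝ) ≤
            EventTrigger.prioriCov μ A C Y x₀ w v ζ k ω) ∧
        (∀ᵐ ω ∂μ, ∃ᶠ k in atTop, EventTrigger.prioriCov μ A C Y x₀ w v ζ k ω ≤
            Xlow + ε • (1 : Matrix (Fin n) (Fin n) ℝ))) := by
  obtain ⟨B, hB, hu⟩ := EventTrigger.exists_block_factor Y hY
  exact EventTrigger.conclusion_of_errCov μ hA hQ hR hSigma₀
    (EventTrigger.inv_blockDiagonal_mul_transpose hB) _ _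
    (EventTrigger.prioriCov_ae_eq hmodel hQ hR hSigma₀ hY hB hu)
    (EventTrigger.ae_frequently_pattern_eq hmodel hA hQ hR hSigma₀ C hY false)
    (EventTrigger.ae_frequently_pattern_eq hmodel hA hQ hR hSigma₀ C hY true)
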